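/- Let $\mathfrak g=\mathfrak g_{\bar0}\oplus\mathfrak g_{\bar1}$ be a basic Lie superalgebra over $\mathbb C$: it is finite-dimensional, has no non-trivial $\mathbb Z/2$-graded ideal, $\mathfrak g_{\bar 0}$ is reductive and acts completely reducibly on $\mathfrak g_{\bar1}$, and $\mathfrak g$ has a non-degenerate invariant even supersymmetric bilinear form. Fix a Cartan subalgebra $\mathfrak h$ of $\mathfrak g_{\bar 0}$ and a total order, compatible with the vector space structure, on the real span of the roots. Let $\mathfrak n^{+}$ and $\mathfrak n^-$ be the sums of the positive and of the negative root spaces, and $\mathfrak b=\mathfrak h\oplus\mathfrak n^+$. For $\mu\in\mathfrak h^*$ let $M_{\mathfrak b}(\mu)$ be the Verma module. The weight $\mu$ is dominant integral if the simple quotient of $M_{\mathfrak b}(\mu)$ is finite-dimensional; then $K_{\mathfrak b}(\mu)$ is the maximal finite-dimensional quotient of $M_{\mathfrak b}(\mu)$, with (even) highest weight vector $v_\mu$. Let $\lambda\in\mathfrak h^*$ be such that $k\lambda$ is dominant integral for all $k\in\mathbb N_0$. **Essential monomials.** Fix an ordered homogeneous basis $f_1,\dots,f_N$ of $\mathfrak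 n^-$. Put $f^{a}=f_N^{a_N}\cdots f_1^{a_1}$ for $a\in\mathbb N_0^N$, and call $a$ admissible if $a_i\le1$ whenever $f_i$ is odd. An admissible $a$ is the same as a pair $(I,\mathbf m)$, with $I$ the exponents of the odd and $\mathbf m$ those of the even basis vectors; $|I|$ is its parity. Fix a total order $<$ on $\mathbb N_0^N$ with $a<b\Rightarrow a+c<b+c$. An admissible $a$ is essential for $K_{\mathfrak b}(k\lambda)$ if $f^{a}v_{k\lambda}\notin\operatorname{span}\{f^{b}v_{k\lambda}: b \text{ admissible},\ b<a\}$. Write $\mathrm{es}_k$ for the set of essential $a$. Assume that $K_{\mathfrak b}(\lambda)$ is favourable: for every $k\in\mathbb N_0$ each element of $\mathrm{es}_k$ is a sum of $k$ elements of $\mathrm{es}_1$. **The superalgebra $R(\lambda)$.** Let $R(\lambda)=\bigoplus_{k\ge0}K_{\mathfrak b}(k\lambda)^*$. The product of $\varphi\in K_{\mathfrak b}(m\lambda)^*$ and $\psi\in K_{\mathfrak b}(n\lambda)^*$ is the composite of the $\mathfrak g$-map $K_{\mathfrak b}((m+n)\lambda)\to K_{\mathfrak b}(n\lambda)\otimes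 K_{\mathfrak b}(m\lambda)$, $v_{(m+n)\lambda}\mapsto v_{n\lambda}\otimes v_{m\lambda}$, with $r\otimes s\mapsto\psi(r)\varphi(s)$. For $a\in\mathrm{es}_k$ let $\eta_{a,k}$ be the element dual to $\frac1{\prod_i a_i!}f^av_{k\lambda}$ in the basis dual to the vectors $\frac1{\prod_i b_i!}f^bv_{k\lambda}$, $b\in\mathrm{es}_k$. Put $R_k^{>a}=\operatorname{span}\{\eta_{b,k}:b\in\mathrm{es}_k,\ b>a\}$, and define $R_k^{\ge a}$ likewise with $b\geq a$. Let $\mathrm{gr}\,R(\lambda)=\bigoplus_{k}\bigoplus_{a\in \mathrm{es}_k}R_k^{\ge a}/R_k^{>a}$, in which the product of components with inadmissible sum of exponents is $0$, and let $\overline\eta_{a,k}$ be the class of $\eta_{a,k}$. **Relations.** Let $\mathcal S$ be the polynomial superalgebra over $\mathbb C$ with one generator for each $a\in\mathrm{es}_1$, of parity that of $a$. A monomial that is a product of $h$ generators, with exponents summing to $a$, has degree $(a,h)$. Let $\overline g_1,\dots,\overline g_m$ generate the kernel of the superalgebra map $\mathcal S\to\mathrm{gr}\,R(\lambda)$ that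 sends the generator of $a$ to $\overline\eta_{a,1}$. Each $\overline g_k$ is homogeneous of some degree $(J_k,h_k)$ and is either a monomial with $J_k$ inadmissible, or a binomial $M+(-1)^\sigma M'$ of two monomials of the same degree with $J_k$ admissible. Choose $g_k=\overline g_k+\sum_{j=1}^{r_k}g_{k,j}$ (with $r_k\ge 0$), where $g_{k,j}\in\mathcal S$ is homogeneous of degree $(U_{k,j},h_k)$ with $U_{k,j}$ admissible and $U_{k,j}>J_k$, such that $g_k$ vanishes under $\mathcal S\to R(\lambda)$, (generator of $a$) $\mapsto\eta_{a,1}$. Choose $w\in\mathbb Z^N$, with $w(a)=\sum_iw_ia_i$, such that $w(U_{k,j})>w(J_k)$ for all $k,j$. For $h\in\mathbb N_0$ let $\mathcal I'_h$ be the set of all binomials $M+(-1)^\sigma M'$ of monomials of degree $(a^{h,\max},h)$ that lie in the kernel of $\mathcal S\to\mathrm{gr}\,R(\lambda)$, where $a^{h,\max}$ is the largest element of $\mathrm{es}_h$. **The family.** Let $\mathcal R=\mathcal S[t]/\mathcal I$, where $t$ is even and central and $\mathcal I$ is the two-sided ideal generated by $$\Big\{\overline g_k+\sum_{j=1}^{r_k}t^{\,w(U_{k,j})-w(J_k)}g_{k,j}\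 :\ 1\le k\le m\Big\}\cup\bigcup_{h\ge0}\mathcal I'_h .$$ For $a=(I,\mathbf m)\in\mathrm{es}_h$ let $\theta_{I,\mathbf m,h}\in\mathcal R$ be the class of an arbitrarily chosen element of $\mathcal S$ that is homogeneous of degree $(a,h)$ and is mapped to $\overline\eta_{a,h}$ in $\mathrm{gr}\,R(\lambda)$. **Claim.** For all these choices, the elements $\theta_{I,\mathbf m,h}\,t^r$ with $h\in\mathbb N_0$, $(I,\mathbf m)\in\mathrm{es}_h$ and $r\in\mathbb N_0$ form a $\mathbb C$-basis of $\mathcal R$, and the elements $\theta_{I,\mathbf m,h}$ form a $\mathbb C[t]$-basis of $\mathcal R$. In particular $\mathcal R$ is a free, hence flat, $\mathbb C[t]$-module. -/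

import Mathlib

open scoped TensorProduct Polynomial

noncomputable section

namespace FlatFamily

universe u

/-! ### Signs and Lie superalgebras -/

/-- The sign `(-1)^(i j)` for parities `i, j`, as an element of `R`. -/
def superSign (R : Type*) [Ring R] (i j : ZMod 2) : R := if i = 1 ∧ j = 1 then -1 else 1

/-- A complex Lie superalgebra: a supervector space with an even bracket which is
super-antisymmetric and satisfies the super Jacobi identity. -/
class LieSuperalgebra (g : Type u) [AddCommGroup g] [Module ℂ g] where
  /-- the homogeneous parts -/
  part : ZMod 2 → Submodule ℂ g
  isCompl : IsCompl (part 0) (part 1)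
  /-- the bracket -/
  bracket : g →ₗ[ℂ] g →ₗ[ℂ] g
  bracket_mem : ∀ {i j : ZMod 2} {x y : g}, x ∈ part i → y ∈ part j →
    bracket x y ∈ part (i + j)
  skew : ∀ {i j : ZMod 2} {x y : g}, x ∈ part i → y ∈ part j →
    bracket x y = -(superSign ℂ i j • bracket y x)
  jacobi : ∀ {i j k : ZMod 2} {x y z : g}, x ∈ part i → y ∈ part j → z ∈ part k →
    bracket x (bracket y z) =
      bracket (bracket x y) z + superSign ℂ i j • bracket y (bracket x z)

open LieSuperalgebra

section General

variable (g : Type u) [AddCommGroup g] [Module ℂ g] [LieSuperalgebra g]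

/-- The even part, an ordinary Lie algebra. -/
abbrev EvenPart : Type u := ↥(part (g := g) 0)

variable {g}

lemma superSign_zero_left (R : Type*) [Ring R] (j : ZMod 2) : superSign R 0 j = 1 := by
  simp [superSign]

lemma superSign_one_one (R : Type*) [Ring R] : superSign R 1 1 = -1 := by
  simp [superSign]

lemma superSign_zero_right (R : Type*) [Ring R] (j : ZMod 2) : superSign R j 0 = 1 := by
  simp [superSign]

instance instLieRingEven : LieRing (EvenPart g) where
  bracket x y := ⟨bracket x.1 y.1, by simpa using bracket_mem x.2 y.2⟩
  add_lie x y z := by ext; simp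
  lie_add x y z := by ext; simp
  lie_self x := by
    ext
    have h : bracket x.1 x.1 = -bracket x.1 x.1 := by
      simpa [superSign_zero_left] using skew x.2 x.2
    have h2 : (2 : ℂ) • bracket x.1 x.1 = 0 := by
      rw [two_smul]; nth_rewrite 1 [h]; simp
    simpa using h2
  leibniz_lie x y z := by
    ext
    simpa [superSign_zero_left] using jacobi x.2 y.2 z.2

instance instLieAlgebraEven : LieAlgebra ℂ (EvenPart g) where
  lie_smul t x y := by
    ext
    exact (bracket (g := g) x.1).map_smul t y.1

/-- The projection of `g` to its even part along the odd part. -/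
def evenProj : g →ₗ[ℂ] g := Submodule.projection _ _ (isCompl (g := g))

/-- The projection of `g` to its odd part along the even part. -/
def oddProj : g →ₗ[ℂ] g := LinearMap.id - evenProj

/-- A graded ideal of a Lie superalgebra. -/
def IsGradedIdeal (I : Submodule ℂ g) : Prop :=
  (∀ x y : g, y ∈ I → bracket x y ∈ I) ∧ I ≤ (I ⊓ part 0) ⊔ (I ⊓ part 1)

variable (g)

/-- No non-trivial graded ideals. -/
def IsSimple : Prop := ∀ I : Submodule ℂ g, IsGradedIdeal I → I = ⊥ ∨ I = ⊤

/-- The adjoint action of `g₀` on `g₁` is completely reducible. -/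
def EvenActsCompletelyReducibly : Prop :=
  ∀ W : Submodule ℂ g, W ≤ part 1 → (∀ x ∈ part (g := g) 0, ∀ y ∈ W, bracket x y ∈ W) →
    ∃ W' : Submodule ℂ g, W' ≤ part 1 ∧ (∀ x ∈ part (g := g) 0, ∀ y ∈ W', bracket x y ∈ W') ∧
      W ⊓ W' = ⊥ ∧ W ⊔ W' = part 1

/-- Basic (classical) Lie superalgebras: finite-dimensional, simple, with reductive even part
(acting completely reducibly on the odd part), and with a non-degenerate invariant even
supersymmetric bilinear form. -/
structure IsBasic : Prop where
  finite : FiniteDimensional ℂ g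
  simple : IsSimple g
  reductive : LieAlgebra.HasCentralRadical ℂ (EvenPart g)
  completelyReducible : EvenActsCompletelyReducibly g
  form : ∃ B : g →ₗ[ℂ] g →ₗ[ℂ] ℂ, B.Nondegenerate ∧
    (∀ x y z, B (bracket x y) z = B x (bracket y z)) ∧
    (∀ (i j : ZMod 2) (x y : g), x ∈ part i → y ∈ part j →
      B x y = superSign ℂ i j * B y x) ∧
    (∀ x y : g, x ∈ part 0 → y ∈ part 1 → B x y = 0)

/-! ### The universal enveloping algebra and its super coproduct -/

/-- The defining relations `x y - (-1)^(|x||y|) y x = [x, y]` of the enveloping superalgebra. -/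
inductive UEA.Rel : TensorAlgebra ℂ g → TensorAlgebra ℂ g → Prop
  | mk {i j : ZMod 2} {x y : g} (hx : x ∈ part i) (hy : y ∈ part j) :
      UEA.Rel (TensorAlgebra.ι ℂ x * TensorAlgebra.ι ℂ y)
        (superSign ℂ i j • (TensorAlgebra.ι ℂ y * TensorAlgebra.ι ℂ x) +
          TensorAlgebra.ι ℂ (bracket x y))

/-- The universal enveloping superalgebra `U(g)`. -/
def UEA : Type u := RingQuot (UEA.Rel g)

instance instRingUEA : Ring (UEA g) := inferInstanceAs (Ring (RingQuot (UEA.Rel g)))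

instance instAlgebraUEA : Algebra ℂ (UEA g) :=
  inferInstanceAs (Algebra ℂ (RingQuot (UEA.Rel g)))

variable {g}

/-- The quotient map from the tensor algebra. -/
def UEA.mk : TensorAlgebra ℂ g →ₐ[ℂ] UEA g := RingQuot.mkAlgHom ℂ (UEA.Rel g)

/-- The canonical map `g → U(g)`. -/
def UEA.ι : g →ₗ[ℂ] UEA g := UEA.mk.toLinearMap ∘ₗ TensorAlgebra.ι ℂ

lemma UEA.ι_mul_ι {i j : ZMod 2} {x y : g} (hx : x ∈ part i) (hy : y ∈ part j) :
    UEA.ι x * UEA.ι y = superSign ℂ i j • (UEA.ι y * UEA.ι x) + UEA.ι (bracket x y) := by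
  have : UEA.mk _ = UEA.mk _ := RingQuot.mkAlgHom_rel ℂ (UEA.Rel.mk hx hy)
  simpa [UEA.ι] using this

/-- The universal property of `U(g)`. -/
def UEA.lift {A : Type*} [Semiring A] [Algebra ℂ A] (f : g →ₗ[ℂ] A)
    (hf : ∀ (i j : ZMod 2) (x y : g), x ∈ part i → y ∈ part j →
      f x * f y = superSign ℂ i j • (f y * f x) + f (bracket x y)) : UEA g →ₐ[ℂ] A :=
  RingQuot.liftAlgHom ℂ (s := UEA.Rel g) ⟨TensorAlgebra.lift ℂ f, by
    rintro _ _ ⟨hx, hy⟩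
    simpa using hf _ _ _ _ hx hy⟩

@[simp] lemma UEA.lift_ι {A : Type*} [Semiring A] [Algebra ℂ A] (f : g →ₗ[ℂ] A)
    (hf : ∀ (i j : ZMod 2) (x y : g), x ∈ part i → y ∈ part j →
      f x * f y = superSign ℂ i j • (f y * f x) + f (bracket x y)) (x : g) :
    UEA.lift f hf (UEA.ι x) = f x := by
  have h := RingQuot.liftAlgHom_mkAlgHom_apply ℂ (s := UEA.Rel g) (TensorAlgebra.lift ℂ f)
    (by rintro _ _ ⟨hx, hy⟩; simpa using hf _ _ _ _ hx hy) (TensorAlgebra.ι ℂ x)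
  rw [TensorAlgebra.lift_ι_apply] at h
  exact h

lemma zmod_two_cases (i : ZMod 2) : i = 0 ∨ i = 1 := by
  revert i; decide

lemma evenProj_of_mem_zero {x : g} (hx : x ∈ part 0) : evenProj x = x :=
  Submodule.projection_apply_of_mem_left _ hx

lemma evenProj_of_mem_one {x : g} (hx : x ∈ part 1) : evenProj x = 0 :=
  Submodule.projection_apply_of_mem_right _ hx

lemma oddProj_of_mem_zero {x : g} (hx : x ∈ part 0) : oddProj x = 0 := by
  simp [oddProj, evenProj_of_mem_zero hx]

lemma oddProj_of_mem_one {x : g} (hx : x ∈ part 1) : oddProj x = x := by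
  simp [oddProj, evenProj_of_mem_one hx]

/-- The parity automorphism `u ↦ (-1)^|u| u` of `U(g)`. -/
def parityAut : UEA g →ₐ[ℂ] UEA g :=
  UEA.lift (UEA.ι ∘ₗ (evenProj - oddProj)) (by
    intro i j x y hx hy
    have hxy := bracket_mem hx hy
    have h := UEA.ι_mul_ι hx hy
    rcases zmod_two_cases i with rfl | rfl <;> rcases zmod_two_cases j with rfl | rfl
    · rw [add_zero] at hxy
      simpa [evenProj_of_mem_zero, oddProj_of_mem_zero, hx, hy, hxy] using h
    · rw [zero_add] at hxy
      simp only [LinearMap.comp_apply, LinearMap.sub_apply, evenProj_of_mem_zero hx,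
        oddProj_of_mem_zero hx, evenProj_of_mem_one hy, oddProj_of_mem_one hy,
        evenProj_of_mem_one hxy, oddProj_of_mem_one hxy, zero_sub, sub_zero, map_neg, mul_neg,
        neg_mul, h, smul_neg, neg_add]
    · rw [add_zero] at hxy
      simp only [LinearMap.comp_apply, LinearMap.sub_apply, evenProj_of_mem_zero hy,
        oddProj_of_mem_zero hy, evenProj_of_mem_one hx, oddProj_of_mem_one hx,
        evenProj_of_mem_one hxy, oddProj_of_mem_one hxy, zero_sub, sub_zero, map_neg, mul_neg,
        neg_mul, h, smul_neg, neg_add]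
    · have h11 : (1 : ZMod 2) + 1 = 0 := by decide
      rw [h11] at hxy
      simp only [LinearMap.comp_apply, LinearMap.sub_apply, evenProj_of_mem_zero hxy,
        oddProj_of_mem_zero hxy, evenProj_of_mem_one hx, oddProj_of_mem_one hx,
        evenProj_of_mem_one hy, oddProj_of_mem_one hy, zero_sub, sub_zero, map_neg, mul_neg,
        neg_mul, h, neg_neg])

lemma parityAut_ι {i : ZMod 2} {x : g} (hx : x ∈ part i) :
    parityAut (UEA.ι x) = superSign ℂ i 1 • UEA.ι x := by
  rcases zmod_two_cases i with rfl | rfl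
  · rw [parityAut, UEA.lift_ι]
    simp [evenProj_of_mem_zero hx, oddProj_of_mem_zero hx, superSign_zero_left]
  · rw [parityAut, UEA.lift_ι]
    simp [evenProj_of_mem_one hx, oddProj_of_mem_one hx, superSign_one_one]

/-- The `i`-th power of the parity automorphism, as a linear endomorphism of `U(g)`. -/
def parityPow (i : ZMod 2) : Module.End ℂ (UEA g) :=
  if i = 1 then parityAut.toLinearMap else 1

/-- Left multiplication on `U(g)`. -/
abbrev lmul (u : UEA g) : Module.End ℂ (UEA g) := LinearMap.mulLeft ℂ u

lemma adjoin_range_ι : Algebra.adjoin ℂ (Set.range (UEA.ι : g → UEA g)) = ⊤ := by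
  have h1 := TensorAlgebra.adjoin_range_ι (R := ℂ) (M := g)
  have h2 : (⊤ : Subalgebra ℂ (TensorAlgebra ℂ g)).map UEA.mk = ⊤ := by
    rw [Algebra.map_top, AlgHom.range_eq_top]
    exact RingQuot.mkAlgHom_surjective ℂ _
  rw [← h2, ← h1, AlgHom.map_adjoin, ← Set.range_comp]
  rfl

/-- A subspace of `U(g)` containing `1` and stable under left multiplication by homogeneous
elements of `g` is everything. -/
lemma UEA.induction (S : Submodule ℂ (UEA g)) (h1 : 1 ∈ S)
    (hmul : ∀ (i : ZMod 2) (x : g), x ∈ part i → ∀ u ∈ S, UEA.ι x * u ∈ S) (u : UEA g) :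
    u ∈ S := by
  have hall : ∀ (x : g), ∀ u ∈ S, UEA.ι x * u ∈ S := by
    intro x u hu
    have hx : x ∈ part (g := g) 0 ⊔ part 1 := by
      rw [(isCompl (g := g)).sup_eq_top]; trivial
    obtain ⟨a, ha, b, hb, rfl⟩ := Submodule.mem_sup.1 hx
    rw [map_add, add_mul]
    exact S.add_mem (hmul 0 a ha u hu) (hmul 1 b hb u hu)
  have key : ∀ a ∈ Algebra.adjoin ℂ (Set.range (UEA.ι : g → UEA g)), ∀ u ∈ S, a * u ∈ S := by
    intro a ha
    induction ha using Algebra.adjoin_induction with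
    | mem x hx => obtain ⟨y, rfl⟩ := hx; exact hall y
    | algebraMap r => intro u hu; rw [← Algebra.smul_def]; exact S.smul_mem r hu
    | add x y _ _ hx hy => intro u hu; rw [add_mul]; exact S.add_mem (hx u hu) (hy u hu)
    | mul x y _ _ hx hy => intro u hu; rw [mul_assoc]; exact hx _ (hy u hu)
  have := key u (by rw [adjoin_range_ι]; trivial) 1 h1
  simpa using this

lemma parityAut_parityAut (u : UEA g) : parityAut (parityAut u) = u := by
  have := UEA.induction (LinearMap.eqLocus
    (parityAut.toLinearMap ∘ₗ parityAut.toLinearMap : UEA g →ₗ[ℂ] UEA g) LinearMap.id)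
    (by simp [LinearMap.mem_eqLocus]) (by
      intro i x hx u hu
      simp only [LinearMap.mem_eqLocus, LinearMap.comp_apply, AlgHom.toLinearMap_apply,
        LinearMap.id_apply, map_mul, parityAut_ι hx, map_smul] at hu ⊢
      rw [hu, smul_mul_assoc, smul_mul_assoc, smul_smul]
      rcases zmod_two_cases i with rfl | rfl <;> simp [superSign]) u
  simpa using this

lemma parityPow_mul_lmul {i j : ZMod 2} {x : g} (hx : x ∈ part i) :
    parityPow j * lmul (UEA.ι x) = superSign ℂ i j • (lmul (UEA.ι x) * parityPow j) := by
  rcases zmod_two_cases j with rfl | rfl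
  · simp [parityPow, superSign]
  · refine LinearMap.ext fun u => ?_
    simp [parityPow, parityAut_ι hx]

/-- The linear map sending a homogeneous `x : g` to `x ⊗ 1 + (parity)^|x| ⊗ x`. -/
def twist : g →ₗ[ℂ] Module.End ℂ (UEA g) ⊗[ℂ] UEA g :=
  (TensorProduct.mk ℂ (Module.End ℂ (UEA g)) (UEA g)).flip 1 ∘ₗ
      LinearMap.mul ℂ (UEA g) ∘ₗ UEA.ι +
    TensorProduct.mk ℂ (Module.End ℂ (UEA g)) (UEA g) (parityPow 0) ∘ₗ UEA.ι ∘ₗ evenProj +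
    TensorProduct.mk ℂ (Module.End ℂ (UEA g)) (UEA g) (parityPow 1) ∘ₗ UEA.ι ∘ₗ oddProj

lemma twist_apply {i : ZMod 2} {x : g} (hx : x ∈ part i) :
    twist x = lmul (UEA.ι x) ⊗ₜ[ℂ] 1 + parityPow i ⊗ₜ[ℂ] UEA.ι x := by
  have h : LinearMap.mul ℂ (UEA g) (UEA.ι x) = lmul (UEA.ι x) := rfl
  rcases zmod_two_cases i with rfl | rfl
  · simp [twist, evenProj_of_mem_zero hx, oddProj_of_mem_zero hx, h]
  · simp [twist, evenProj_of_mem_one hx, oddProj_of_mem_one hx, h]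

lemma parityPow_mul_parityPow (i j : ZMod 2) :
    (parityPow i * parityPow j : Module.End ℂ (UEA g)) = parityPow (i + j) := by
  rcases zmod_two_cases i with rfl | rfl <;> rcases zmod_two_cases j with rfl | rfl
  · simp [parityPow]
  · simp [parityPow]
  · simp [parityPow]
  · have h11 : (1 : ZMod 2) + 1 = 0 := by decide
    rw [h11]
    refine LinearMap.ext fun u => ?_
    simp [parityPow, parityAut_parityAut]

lemma superSign_comm (R : Type*) [Ring R] (i j : ZMod 2) : superSign R i j = superSign R j i := by
  simp [superSign, and_comm]

lemma superSign_mul_self (R : Type*) [Ring R] (i j : ZMod 2) :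
    superSign R i j * superSign R i j = 1 := by
  unfold superSign; split <;> simp

lemma twist_mul_twist {i j : ZMod 2} {x y : g} (hx : x ∈ part i) (hy : y ∈ part j) :
    twist x * twist y = superSign ℂ i j • (twist y * twist x) + twist (bracket x y) := by
  rw [twist_apply hx, twist_apply hy, twist_apply (bracket_mem hx hy)]
  have hL : lmul (UEA.ι x) * lmul (UEA.ι y) =
      superSign ℂ i j • (lmul (UEA.ι y) * lmul (UEA.ι x)) + lmul (UEA.ι (bracket x y)) := by
    refine LinearMap.ext fun u => ?_
    have := congrArg (· * u) (UEA.ι_mul_ι hx hy)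
    simpa [mul_assoc, add_mul] using this
  simp only [add_mul, mul_add, Algebra.TensorProduct.tmul_mul_tmul, one_mul, mul_one,
    parityPow_mul_parityPow, hL, UEA.ι_mul_ι hx hy, parityPow_mul_lmul hx,
    parityPow_mul_lmul hy, add_comm j i, TensorProduct.add_tmul, TensorProduct.tmul_add,
    ← TensorProduct.smul_tmul', TensorProduct.tmul_smul, smul_add, smul_smul,
    superSign_comm ℂ j i, superSign_mul_self, one_smul]
  abel

/-- The super coproduct, as an algebra homomorphism `U(g) → End(U(g)) ⊗ U(g)` sending a
homogeneous `x` to `x ⊗ 1 + (parity)^|x| ⊗ x`. -/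
def twistedComul : UEA g →ₐ[ℂ] Module.End ℂ (UEA g) ⊗[ℂ] UEA g :=
  UEA.lift twist fun _ _ _ _ => twist_mul_twist

lemma twistedComul_ι {i : ZMod 2} {x : g} (hx : x ∈ part i) :
    twistedComul (UEA.ι x) = lmul (UEA.ι x) ⊗ₜ[ℂ] 1 + parityPow i ⊗ₜ[ℂ] UEA.ι x := by
  rw [twistedComul, UEA.lift_ι, twist_apply hx]

/-- The super coproduct `Δ : U(g) → U(g) ⊗ U(g)`.  It is the map `u ↦ u • (1 ⊗ 1)`, where `g` acts
on `U(g) ⊗ U(g)` by `x • (a ⊗ b) = x a ⊗ b + (-1)^(|x||a|) a ⊗ x b`, see `comul_one`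
and `comul_ι_mul`. -/
def comul : UEA g →ₗ[ℂ] UEA g ⊗[ℂ] UEA g :=
  TensorProduct.map (LinearMap.applyₗ (1 : UEA g)) LinearMap.id ∘ₗ twistedComul.toLinearMap

lemma comul_one : comul (1 : UEA g) = 1 ⊗ₜ[ℂ] 1 := by
  have h1 : twistedComul (1 : UEA g) = 1 :=
    (twistedComul (g := g)).toRingHom.map_one
  change TensorProduct.map _ _ (twistedComul 1) = _
  rw [h1, Algebra.TensorProduct.one_def, TensorProduct.map_tmul]
  rfl

lemma comul_ι_mul {i : ZMod 2} {x : g} (hx : x ∈ part i) (u : UEA g) :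
    comul (UEA.ι x * u) =
      TensorProduct.map (lmul (UEA.ι x)) LinearMap.id (comul u) +
        TensorProduct.map (parityPow i) (lmul (UEA.ι x)) (comul u) := by
  simp only [comul, LinearMap.comp_apply, AlgHom.toLinearMap_apply, map_mul, twistedComul_ι hx]
  generalize twistedComul u = t
  induction t with
  | zero => simp
  | add a b ha hb => rw [mul_add, map_add, ha, hb]; simp only [map_add]; abel
  | tmul a b => simp [add_mul]

/-- The counit of `U(g)`. -/
def counit : UEA g →ₐ[ℂ] ℂ := UEA.lift 0 (by simp)

lemma counit_ι_mul (x : g) (u : UEA g) : counit (UEA.ι x * u) = 0 := by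
  rw [map_mul, counit, UEA.lift_ι]; simp

lemma counit_parityPow (i : ZMod 2) (u : UEA g) : counit (parityPow i u) = counit u := by
  rcases zmod_two_cases i with rfl | rfl
  · simp [parityPow]
  · have := UEA.induction (LinearMap.eqLocus
      (counit.toLinearMap ∘ₗ parityPow 1 : UEA g →ₗ[ℂ] ℂ) counit.toLinearMap)
      (by simp [parityPow]) (by
        intro i x hx u _
        simp [parityPow, parityAut_ι hx, counit_ι_mul]) u
    simpa using this

lemma counit_comul_left (u : UEA g) :
    TensorProduct.lid ℂ _ (TensorProduct.map counit.toLinearMap LinearMap.id (comul u)) = u := by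
  have := UEA.induction (LinearMap.eqLocus
    ((TensorProduct.lid ℂ (UEA g)).toLinearMap ∘ₗ
      TensorProduct.map counit.toLinearMap LinearMap.id ∘ₗ comul) LinearMap.id)
    (by simp [comul_one]) (by
      intro i x hx u hu
      simp only [LinearMap.mem_eqLocus, LinearMap.comp_apply, LinearEquiv.coe_coe,
        LinearMap.id_apply, comul_ι_mul hx, map_add] at hu ⊢
      conv_rhs => rw [← hu]
      generalize comul u = t
      rw [← LinearMap.mulLeft_apply (R := ℂ) (UEA.ι x)]
      induction t with
      | zero => simp
      | add a b ha hb => simp only [map_add, ← ha, ← hb]; abel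
      | tmul a b => simp [counit_ι_mul, counit_parityPow]) u
  simpa using this

lemma counit_comul_right (u : UEA g) :
    TensorProduct.rid ℂ _ (TensorProduct.map LinearMap.id counit.toLinearMap (comul u)) = u := by
  have := UEA.induction (LinearMap.eqLocus
    ((TensorProduct.rid ℂ (UEA g)).toLinearMap ∘ₗ
      TensorProduct.map LinearMap.id counit.toLinearMap ∘ₗ comul) LinearMap.id)
    (by simp [comul_one]) (by
      intro i x hx u hu
      simp only [LinearMap.mem_eqLocus, LinearMap.comp_apply, LinearEquiv.coe_coe,
        LinearMap.id_apply, comul_ι_mul hx, map_add] at hu ⊢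
      conv_rhs => rw [← hu]
      generalize comul u = t
      rw [← LinearMap.mulLeft_apply (R := ℂ) (UEA.ι x)]
      induction t with
      | zero => simp
      | add a b ha hb => simp only [map_add, ← ha, ← hb]; abel
      | tmul a b => simp [counit_ι_mul]) u
  simpa using this

lemma comul_parityPow (i : ZMod 2) (u : UEA g) :
    comul (parityPow i u) = TensorProduct.map (parityPow i) (parityPow i) (comul u) := by
  have := UEA.induction (LinearMap.eqLocus
    (comul ∘ₗ parityPow i : UEA g →ₗ[ℂ] UEA g ⊗[ℂ] UEA g)
    (TensorProduct.map (parityPow i) (parityPow i) ∘ₗ comul))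
    (by
      have h1 : parityPow i (1 : UEA g) = 1 := by
        rcases zmod_two_cases i with rfl | rfl <;> simp [parityPow]
      simp [comul_one, h1]) (by
      intro j x hx u hu
      have hpl : ∀ a : UEA g, parityPow i (UEA.ι x * a) =
          superSign ℂ j i • (UEA.ι x * parityPow i a) := fun a => by
        simpa using LinearMap.congr_fun (parityPow_mul_lmul (j := i) hx) a
      have hpp : ∀ a : UEA g, parityPow i (parityPow j a) = parityPow j (parityPow i a) :=
        fun a => by
          have := parityPow_mul_parityPow (g := g) i j
          rw [add_comm, ← parityPow_mul_parityPow] at this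
          exact LinearMap.congr_fun this a
      simp only [LinearMap.mem_eqLocus, LinearMap.comp_apply] at hu ⊢
      rw [hpl, map_smul, comul_ι_mul hx, hu, comul_ι_mul hx]
      generalize comul u = t
      induction t with
      | zero => simp
      | add a b ha hb =>
        simp only [map_add, smul_add] at ha hb ⊢
        rw [add_add_add_comm, ha, hb]; abel
      | tmul a b =>
        simp [hpl, hpp, TensorProduct.smul_tmul', TensorProduct.tmul_smul]) u
  simpa using this

lemma comul_coassoc (u : UEA g) :
    TensorProduct.assoc ℂ _ _ _ (TensorProduct.map comul LinearMap.id (comul u)) =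
      TensorProduct.map LinearMap.id comul (comul u) := by
  have := UEA.induction (LinearMap.eqLocus
    ((TensorProduct.assoc ℂ (UEA g) (UEA g) (UEA g)).toLinearMap ∘ₗ
      TensorProduct.map comul LinearMap.id ∘ₗ comul)
    (TensorProduct.map LinearMap.id comul ∘ₗ comul))
    (by simp [comul_one]) (by
      intro i x hx u hu
      simp only [LinearMap.mem_eqLocus, LinearMap.comp_apply, LinearEquiv.coe_coe] at hu ⊢
      set Ω : UEA g ⊗[ℂ] (UEA g ⊗[ℂ] UEA g) →ₗ[ℂ] UEA g ⊗[ℂ] (UEA g ⊗[ℂ] UEA g) :=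
        TensorProduct.map (lmul (UEA.ι x)) LinearMap.id +
        TensorProduct.map (parityPow i) (TensorProduct.map (lmul (UEA.ι x)) LinearMap.id) +
        TensorProduct.map (parityPow i) (TensorProduct.map (parityPow i) (lmul (UEA.ι x)))
        with hΩ
      have hl : ∀ t : UEA g ⊗[ℂ] UEA g,
          TensorProduct.assoc ℂ _ _ _ (TensorProduct.map comul LinearMap.id
            (TensorProduct.map (lmul (UEA.ι x)) LinearMap.id t +
              TensorProduct.map (parityPow i) (lmul (UEA.ι x)) t)) =
          Ω (TensorProduct.assoc ℂ _ _ _ (TensorProduct.map comul LinearMap.id t)) := by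
        intro t
        induction t with
        | zero => simp
        | add a b ha hb =>
          simp only [map_add] at ha hb ⊢
          rw [← ha, ← hb]; abel
        | tmul a b =>
          simp only [map_add, TensorProduct.map_tmul, LinearMap.mulLeft_apply,
            LinearMap.id_apply, comul_ι_mul hx, comul_parityPow]
          generalize comul a = c
          induction c with
          | zero => simp
          | add p q hp hq =>
            simp only [map_add, TensorProduct.add_tmul] at hp hq ⊢
            rw [← hp, ← hq]; abel
          | tmul p q => simp [hΩ, TensorProduct.add_tmul]
      have hr : ∀ t : UEA g ⊗[ℂ] UEA g,
          TensorProduct.map LinearMap.id comul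
            (TensorProduct.map (lmul (UEA.ι x)) LinearMap.id t +
              TensorProduct.map (parityPow i) (lmul (UEA.ι x)) t) =
          Ω (TensorProduct.map LinearMap.id comul t) := by
        intro t
        induction t with
        | zero => simp
        | add a b ha hb =>
          simp only [map_add] at ha hb ⊢
          rw [← ha, ← hb]; abel
        | tmul a b =>
          simp [comul_ι_mul hx, hΩ, TensorProduct.tmul_add, add_assoc]
      rw [comul_ι_mul hx, hl, hr, hu]) u
  simpa using this

/-- The super swap `a ⊗ b ↦ (-1)^(|a||b|) b ⊗ a` on `U(g) ⊗ U(g)`. -/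
def superSwap : UEA g ⊗[ℂ] UEA g →ₗ[ℂ] UEA g ⊗[ℂ] UEA g :=
  (TensorProduct.comm ℂ (UEA g) (UEA g)).toLinearMap ∘ₗ
    ((1 / 2 : ℂ) • (LinearMap.id + TensorProduct.map (parityPow 1) LinearMap.id +
      TensorProduct.map LinearMap.id (parityPow 1) -
      TensorProduct.map (parityPow 1) (parityPow 1)))

lemma superSwap_comul (u : UEA g) : superSwap (comul u) = comul u := by
  have := UEA.induction (LinearMap.eqLocus (superSwap ∘ₗ comul : UEA g →ₗ[ℂ] _) comul)
    (by
      have h1 : parityPow 1 (1 : UEA g) = 1 := by simp [parityPow]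
      simp [superSwap, comul_one, h1, ← two_smul ℂ, smul_smul]) (by
      intro i x hx u hu
      simp only [LinearMap.mem_eqLocus, LinearMap.comp_apply] at hu ⊢
      have hpl : ∀ a : UEA g, parityPow 1 (UEA.ι x * a) =
          superSign ℂ i 1 • (UEA.ι x * parityPow 1 a) := fun a => by
        simpa using LinearMap.congr_fun (parityPow_mul_lmul (j := 1) hx) a
      have hpp : ∀ a : UEA g, parityPow 1 (parityPow 1 a) = a := fun a => by
        simp [parityPow, parityAut_parityAut]
      have hp0 : ∀ a : UEA g, parityPow 0 a = a := fun a => by simp [parityPow]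
      have h : ∀ t : UEA g ⊗[ℂ] UEA g,
          superSwap (TensorProduct.map (lmul (UEA.ι x)) LinearMap.id t +
            TensorProduct.map (parityPow i) (lmul (UEA.ι x)) t) =
          TensorProduct.map (lmul (UEA.ι x)) LinearMap.id (superSwap t) +
            TensorProduct.map (parityPow i) (lmul (UEA.ι x)) (superSwap t) := by
        intro t
        induction t with
        | zero => simp
        | add a b ha hb =>
          simp only [map_add] at ha hb ⊢
          rw [add_add_add_comm, ha, hb]; abel
        | tmul a b =>
          rcases zmod_two_cases i with rfl | rfl
          · simp [superSwap, hpl, hp0, superSign]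
            module
          · simp [superSwap, hpl, hpp, superSign, TensorProduct.tmul_neg, TensorProduct.neg_tmul]
            module
      rw [comul_ι_mul hx, h, hu]) u
  simpa using this

/-! ### The superalgebra of functionals on `U(g)` -/

variable (g) in
/-- The dual space `U(g)^*`, with the multiplication dual to the super coproduct. -/
def SuperDual : Type u := Module.Dual ℂ (UEA g)

instance : AddCommGroup (SuperDual g) := inferInstanceAs (AddCommGroup (Module.Dual ℂ (UEA g)))
instance : Module ℂ (SuperDual g) := inferInstanceAs (Module ℂ (Module.Dual ℂ (UEA g)))

/-- Evaluation of a functional. -/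
def SuperDual.eval (u : UEA g) : SuperDual g →ₗ[ℂ] ℂ := LinearMap.applyₗ u

/-- Build an element of `U(g)^*`. -/
def SuperDual.of (φ : Module.Dual ℂ (UEA g)) : SuperDual g := φ

@[simp] lemma SuperDual.eval_of (φ : Module.Dual ℂ (UEA g)) (u : UEA g) :
    SuperDual.eval u (SuperDual.of φ) = φ u := rfl

@[ext] lemma SuperDual.ext {φ ψ : SuperDual g}
    (h : ∀ u, SuperDual.eval u φ = SuperDual.eval u ψ) : φ = ψ :=
  LinearMap.ext h

/-- The functional `r ⊗ s ↦ ψ(r) φ(s)` on `U(g) ⊗ U(g)`. -/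
def dualPair (φ ψ : SuperDual g) : UEA g ⊗[ℂ] UEA g →ₗ[ℂ] ℂ :=
  LinearMap.mul' ℂ ℂ ∘ₗ TensorProduct.map (ψ : Module.Dual ℂ (UEA g)) (φ : Module.Dual ℂ (UEA g))

@[simp] lemma dualPair_tmul (φ ψ : SuperDual g) (r s : UEA g) :
    dualPair φ ψ (r ⊗ₜ s) = SuperDual.eval r ψ * SuperDual.eval s φ := rfl

/-- The product of `φ` and `ψ` is `u ↦ ∑ ψ(u') φ(u'')` where `Δ u = ∑ u' ⊗ u''`. -/
instance : Mul (SuperDual g) where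
  mul φ ψ := SuperDual.of (dualPair φ ψ ∘ₗ comul)

instance : One (SuperDual g) where
  one := SuperDual.of counit.toLinearMap

lemma SuperDual.eval_mul (φ ψ : SuperDual g) (u : UEA g) :
    SuperDual.eval u (φ * ψ) = dualPair φ ψ (comul u) := rfl

lemma SuperDual.eval_one (u : UEA g) : SuperDual.eval u (1 : SuperDual g) = counit u := rfl

instance : Ring (SuperDual g) where
  __ := (inferInstance : AddCommGroup (SuperDual g))
  left_distrib φ ψ χ := by
    ext u
    simp only [SuperDual.eval_mul, map_add]
    generalize comul u = t
    induction t with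
    | zero => simp
    | add a b ha hb => simp only [map_add, ha, hb]; ring
    | tmul a b => simp; ring
  right_distrib φ ψ χ := by
    ext u
    simp only [SuperDual.eval_mul, map_add]
    generalize comul u = t
    induction t with
    | zero => simp
    | add a b ha hb => simp only [map_add, ha, hb]; ring
    | tmul a b => simp; ring
  zero_mul φ := by
    ext u
    simp only [SuperDual.eval_mul, map_zero]
    generalize comul u = t
    induction t with
    | zero => simp
    | add a b ha hb => simp only [map_add, ha, hb]; ring
    | tmul a b => simp
  mul_zero φ := by
    ext u
    simp only [SuperDual.eval_mul, map_zero]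
    generalize comul u = t
    induction t with
    | zero => simp
    | add a b ha hb => simp only [map_add, ha, hb]; ring
    | tmul a b => simp
  mul_assoc φ ψ χ := by
    ext u
    simp only [SuperDual.eval_mul]
    have hl : ∀ t : UEA g ⊗[ℂ] UEA g, dualPair (φ * ψ) χ t =
        LinearMap.mul' ℂ ℂ (TensorProduct.map (χ : Module.Dual ℂ (UEA g)) (dualPair φ ψ)
          (TensorProduct.map LinearMap.id comul t)) := by
      intro t
      induction t with
      | zero => simp
      | add a b ha hb => simp only [map_add, ha, hb]
      | tmul a b => rfl
    have hr : ∀ t : UEA g ⊗[ℂ] UEA g, dualPair φ (ψ * χ) t =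
        LinearMap.mul' ℂ ℂ (TensorProduct.map (χ : Module.Dual ℂ (UEA g)) (dualPair φ ψ)
          (TensorProduct.assoc ℂ _ _ _ (TensorProduct.map comul LinearMap.id t))) := by
      intro t
      induction t with
      | zero => simp
      | add a b ha hb => simp only [map_add, ha, hb]
      | tmul a b =>
        rw [dualPair_tmul, SuperDual.eval_mul, TensorProduct.map_tmul]
        generalize comul a = c
        induction c with
        | zero => simp
        | add p q hp hq => simp only [map_add, TensorProduct.add_tmul, add_mul, hp, hq]
        | tmul p q =>
          rw [dualPair_tmul, mul_assoc]
          rfl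
    rw [hl, hr, comul_coassoc]
  one_mul φ := by
    ext u
    rw [SuperDual.eval_mul]
    conv_rhs => rw [← counit_comul_right u]
    generalize comul u = t
    induction t with
    | zero => simp only [map_zero]; exact (LinearMap.map_zero (φ : Module.Dual ℂ (UEA g))).symm
    | add a b ha hb =>
      rw [map_add, ha, hb]
      simp only [map_add]
      exact ((φ : Module.Dual ℂ (UEA g)).map_add _ _).symm
    | tmul a b =>
      rw [dualPair_tmul, SuperDual.eval_one, TensorProduct.map_tmul, TensorProduct.rid_tmul]
      exact (mul_comm _ _).trans ((φ : Module.Dual ℂ (UEA g)).map_smul _ _).symm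
  mul_one φ := by
    ext u
    rw [SuperDual.eval_mul]
    conv_rhs => rw [← counit_comul_left u]
    generalize comul u = t
    induction t with
    | zero => simp only [map_zero]; exact (LinearMap.map_zero (φ : Module.Dual ℂ (UEA g))).symm
    | add a b ha hb =>
      rw [map_add, ha, hb]
      simp only [map_add]
      exact ((φ : Module.Dual ℂ (UEA g)).map_add _ _).symm
    | tmul a b =>
      rw [dualPair_tmul, SuperDual.eval_one, TensorProduct.map_tmul, TensorProduct.lid_tmul]
      exact ((φ : Module.Dual ℂ (UEA g)).map_smul _ _).symm

instance : Algebra ℂ (SuperDual g) :=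
  Algebra.ofModule
    (by
      intro c φ ψ
      ext u
      simp only [SuperDual.eval_mul, map_smul]
      generalize comul u = t
      induction t with
      | zero => simp
      | add a b ha hb => simp only [map_add, ha, hb, smul_add]
      | tmul a b => simp; ring)
    (by
      intro c φ ψ
      ext u
      simp only [SuperDual.eval_mul, map_smul]
      generalize comul u = t
      induction t with
      | zero => simp
      | add a b ha hb => simp only [map_add, ha, hb, smul_add]
      | tmul a b => simp; ring)

/-- A functional on `U(g)` is homogeneous of parity `p` if it vanishes on the elements of the
opposite parity. -/
def SuperDual.IsHomogeneous (φ : SuperDual g) (p : ZMod 2) : Prop :=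
  ∀ u, SuperDual.eval (parityAut u) φ = superSign ℂ p 1 * SuperDual.eval u φ

/-- `U(g)^*` is supercommutative. -/
lemma SuperDual.mul_comm' {φ ψ : SuperDual g} {p q : ZMod 2} (hφ : φ.IsHomogeneous p)
    (hψ : ψ.IsHomogeneous q) : φ * ψ = superSign ℂ p q • (ψ * φ) := by
  ext u
  rw [map_smul, SuperDual.eval_mul, SuperDual.eval_mul]
  have h : ∀ t : UEA g ⊗[ℂ] UEA g,
      dualPair φ ψ (superSwap t) = superSign ℂ p q • dualPair ψ φ t := by
    intro t
    induction t with
    | zero => simp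
    | add a b ha hb => simp only [map_add, ha, hb, smul_add]
    | tmul a b =>
      have h1 := hφ a
      have h2 := hψ b
      have hp : ∀ c : UEA g, parityPow 1 c = parityAut c := fun c => by simp [parityPow]
      simp only [superSwap, LinearMap.comp_apply, LinearMap.smul_apply, LinearMap.sub_apply,
        LinearMap.add_apply, LinearMap.id_apply, TensorProduct.map_tmul, hp, map_smul, map_sub,
        map_add, LinearEquiv.coe_coe, TensorProduct.comm_tmul, dualPair_tmul, h1, h2, smul_eq_mul]
      rcases zmod_two_cases p with rfl | rfl <;> rcases zmod_two_cases q with rfl | rfl <;>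
        simp [superSign] <;> ring
  rw [← h, superSwap_comul]

end General

/-! ### Roots, Borel subalgebras, Verma modules and their maximal finite-dimensional quotients -/

section Roots

variable {g : Type u} [AddCommGroup g] [Module ℂ g] [LieSuperalgebra g]

/-- The root space `g_α = {x | [h, x] = α(h) x for all h}`. -/
def rootSpace (h : LieSubalgebra ℂ (EvenPart g)) (α : Module.Dual ℂ h) : Submodule ℂ g where
  carrier := {x | ∀ H : h, bracket ((H : EvenPart g) : g) x = α H • x}
  add_mem' hx hy H := by rw [map_add, hx H, hy H, smul_add]
  zero_mem' H := by simp
  smul_mem' c x hx H := by rw [map_smul, hx H, smul_comm]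

/-- The set of roots. -/
def roots (h : LieSubalgebra ℂ (EvenPart g)) : Set (Module.Dual ℂ h) :=
  {α | α ≠ 0 ∧ rootSpace h α ≠ ⊥}

/-- The real span of the roots. -/
abbrev rootSpan (h : LieSubalgebra ℂ (EvenPart g)) : Submodule ℝ (Module.Dual ℂ h) :=
  Submodule.span ℝ (roots h)

/-- A total order on a real vector space compatible with the vector space structure. -/
structure CompatibleOrder (E : Type*) [AddCommGroup E] [Module ℝ E] where
  /-- the strict order -/
  lt : E → E → Prop
  total : IsStrictTotalOrder E lt
  add : ∀ a b c : E, lt a b → lt (a + c) (b + c)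
  smul : ∀ (r : ℝ) (a b : E), 0 < r → lt a b → lt (r • a) (r • b)

variable {h : LieSubalgebra ℂ (EvenPart g)} (ord : CompatibleOrder (rootSpan h))

/-- The positive roots. -/
def posRoots : Set (Module.Dual ℂ h) :=
  {α | ∃ hα : α ∈ roots h, ord.lt 0 ⟨α, Submodule.subset_span hα⟩}

/-- The negative roots. -/
def negRoots : Set (Module.Dual ℂ h) :=
  {α | ∃ hα : α ∈ roots h, ord.lt ⟨α, Submodule.subset_span hα⟩ 0}

/-- The sum `n⁺` of the positive root spaces. -/
def nPlus : Submodule ℂ g := ⨆ α ∈ posRoots ord, rootSpace h α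

/-- The sum `n⁻` of the negative root spaces. -/
def nMinus : Submodule ℂ g := ⨆ α ∈ negRoots ord, rootSpace h α

/-- The left ideal of `U(g)` generated by `n⁺` and by all `H - μ(H)`, `H ∈ h`.
The Verma module `U(g) ⊗_{U(b)} ℂ_μ` is the quotient of `U(g)` by it. -/
def vermaIdeal (μ : Module.Dual ℂ h) : Submodule (UEA g) (UEA g) :=
  Submodule.span (UEA g)
    ({u | ∃ x ∈ nPlus ord, u = UEA.ι x} ∪
      {u | ∃ H : h, u = UEA.ι ((H : EvenPart g) : g) - algebraMap ℂ (UEA g) (μ H)})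

/-- The Verma module `M_b(μ)`. -/
abbrev Verma (μ : Module.Dual ℂ h) : Type u := UEA g ⧸ vermaIdeal ord μ

/-- `μ` is dominant integral: the simple quotient of the Verma module is finite-dimensional. -/
def IsDominantIntegral (μ : Module.Dual ℂ h) : Prop :=
  ∃ P : Submodule (UEA g) (Verma ord μ),
    IsSimpleModule (UEA g) (Verma ord μ ⧸ P) ∧ FiniteDimensional ℂ (Verma ord μ ⧸ P)

/-- The kernel of `U(g) → K_b(μ)`, `u ↦ u v_μ`: the intersection of all left ideals of finite
codimension containing the Verma ideal.  These correspond to the finite-dimensional quotients of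
the Verma module, so that the quotient is the maximal finite-dimensional one. -/
def maxFinIdeal (μ : Module.Dual ℂ h) : Submodule (UEA g) (UEA g) :=
  sInf {L | vermaIdeal ord μ ≤ L ∧ FiniteDimensional ℂ (UEA g ⧸ L)}

/-- The maximal finite-dimensional quotient `K_b(μ)` of the Verma module. -/
abbrev MaxFinQuot (μ : Module.Dual ℂ h) : Type u := UEA g ⧸ maxFinIdeal ord μ

end Roots

/-! ### Highest weight data, essential monomials -/

/-- A total order on multi-exponents which is compatible with addition. -/
structure ExponentOrder (N : ℕ) where
  /-- the strict order -/
  lt : (Fin N → ℕ) → (Fin N → ℕ) → Prop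
  total : IsStrictTotalOrder (Fin N → ℕ) lt
  add : ∀ a b c : Fin N → ℕ, lt a b → lt (a + c) (b + c)

/-- The choices that are fixed throughout: a Cartan subalgebra `h` of the even part, a total order
on the real span of the roots (hence a Borel subalgebra), a weight, a homogeneous ordered basis
`f_1, …, f_N` of `n⁻`, and a monomial order. -/
structure Datum (g : Type u) [AddCommGroup g] [Module ℂ g] [LieSuperalgebra g] where
  h : LieSubalgebra ℂ (EvenPart g)
  cartan : h.IsCartanSubalgebra
  ord : CompatibleOrder (rootSpan h)
  weight : Module.Dual ℂ h
  N : ℕ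
  f : Module.Basis (Fin N) ℂ (nMinus ord)
  par : Fin N → ZMod 2
  f_mem : ∀ i, (f i : g) ∈ part (g := g) (par i)
  mono : ExponentOrder N

section Data

variable {g : Type u} [AddCommGroup g] [Module ℂ g] [LieSuperalgebra g] (D : Datum g)

namespace Datum

/-- Multi-exponents `(I, 𝐦)`, written as a single tuple indexed by the basis of `n⁻`. -/
abbrev Exp : Type := Fin D.N → ℕ

/-- `K_b(kλ)`. -/
abbrev K (k : ℕ) : Type u := MaxFinQuot D.ord (k • D.weight)

/-- The highest weight vector `v_{kλ}`. -/
def hwv (k : ℕ) : D.K k := Submodule.Quotient.mk 1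

/-- Exponents with entries in `{0, 1}` at the odd basis vectors. -/
def Admissible (a : D.Exp) : Prop := ∀ i, D.par i = 1 → a i ≤ 1

/-- The parity of a multi-exponent, i.e. the parity of `|I|`. -/
def expParity (a : D.Exp) : ZMod 2 := ∑ i, (a i : ZMod 2) * D.par i

/-- The ordered monomial `f^a = f_N^{a_N} ⋯ f_1^{a_1}` in `U(n⁻)`. -/
def monomial (a : D.Exp) : UEA g :=
  ((List.finRange D.N).reverse.map fun i => UEA.ι (D.f i : g) ^ a i).prod

/-- `a` is essential for `K_b(kλ)`: `f^a v_{kλ}` is not in the span of the `f^b v_{kλ}`, `b < a`. -/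
def IsEssential (k : ℕ) (a : D.Exp) : Prop :=
  D.Admissible a ∧ D.monomial a • D.hwv k ∉
    Submodule.span ℂ {v | ∃ b, D.Admissible b ∧ D.mono.lt b a ∧ v = D.monomial b • D.hwv k}

/-- The set `Γ(λ, <)` of pairs of an essential monomial of `K_b(kλ)` and `k`. -/
abbrev Gam : Type := {p : D.Exp × ℕ // D.IsEssential p.2 p.1}

/-- The essential monomials of `K_b(λ)`. -/
abbrev Gen : Type := {a : D.Exp // D.IsEssential 1 a}

/-- `K_b(λ)` is favourable: each essential monomial of `K_b(kλ)` is a sum of `k` essential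
monomials of `K_b(λ)`. -/
def IsFavourable : Prop :=
  ∀ (k : ℕ) (a : D.Exp), D.IsEssential k a → ∃ s : Fin k → D.Gen, a = ∑ i, (s i : D.Exp)

/-! ### The section superalgebra `R(λ) = ⨁ₖ K_b(kλ)^*`

The space `K_b(kλ)^*` is identified with the space of functionals on `U(g)` that vanish on the
annihilator of `v_{kλ}`, via `φ ↦ (u ↦ φ (u v_{kλ}))`. The product of `φ ∈ K_b(mλ)^*` and
`ψ ∈ K_b(nλ)^*` dual to the Cartan map `K_b((m+n)λ) → K_b(nλ) ⊗ K_b(mλ)`,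
`u v_{(m+n)λ} ↦ u (v_{nλ} ⊗ v_{mλ})`, is then the product of `U(g)^*`, and `R(λ)` is the
subalgebra `⨁ₖ K_b(kλ)^* vᵏ` of the polynomial ring `U(g)^*[v]`. -/

/-- The functional on `U(g)` defined by a functional on `K_b(kλ)`. -/
def pull (k : ℕ) : Module.Dual ℂ (D.K k) →ₗ[ℂ] SuperDual g :=
  (LinearMap.lcomp ℂ ℂ ((maxFinIdeal D.ord (k • D.weight)).mkQ.restrictScalars ℂ) :
    Module.Dual ℂ (D.K k) →ₗ[ℂ] Module.Dual ℂ (UEA g))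

/-- `η` is the functional on `K_b(kλ)` dual to `f^a v_{kλ} / ∏ aᵢ!` with respect to the basis of
essential vectors `f^b v_{kλ} / ∏ bᵢ!` (it is homogeneous of the parity of `a`). -/
def IsDualVector (k : ℕ) (a : D.Exp) (η : Module.Dual ℂ (D.K k)) : Prop :=
  (D.pull k η).IsHomogeneous (D.expParity a) ∧
    ∀ b, D.IsEssential k b →
      η ((∏ i, ((b i).factorial : ℂ))⁻¹ • D.monomial b • D.hwv k) = if b = a then 1 else 0

open Classical in
/-- The dual basis vector `η_{a,k}` in `K_b(kλ)^*`. -/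
def eta (k : ℕ) (a : D.Exp) : Module.Dual ℂ (D.K k) :=
  if hη : ∃ η, D.IsDualVector k a η then hη.choose else 0

lemma eta_homogeneous (k : ℕ) (a : D.Exp) :
    (D.pull k (D.eta k a)).IsHomogeneous (D.expParity a) := by
  unfold eta
  split
  case isTrue hη => exact hη.choose_spec.1
  case isFalse => intro u; simp

/-- The element `η_{a,k}` of `R(λ)`, in degree `k`. -/
def etaR (k : ℕ) (a : D.Exp) : (SuperDual g)[X] :=
  Polynomial.monomial k (D.pull k (D.eta k a))

/-- The subspace `R_k(λ)^{> a}`, spanned by the `η_{b,k}` with `b > a` essential. -/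
def filt (k : ℕ) (a : D.Exp) : Submodule ℂ (SuperDual g)[X] :=
  Submodule.span ℂ {r | ∃ b, D.IsEssential k b ∧ D.mono.lt a b ∧ r = D.etaR k b}

end Datum

end Data

/-! ### Free supercommutative superalgebras -/

/-- The relations `X_i X_j = (-1)^(|i||j|) X_j X_i`. -/
inductive SuperPoly.Rel (R : Type*) [CommRing R] (ι : Type*) (p : ι → ZMod 2) :
    FreeAlgebra R ι → FreeAlgebra R ι → Prop
  | mk (i j : ι) : SuperPoly.Rel R ι p (FreeAlgebra.ι R i * FreeAlgebra.ι R j)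
      (superSign R (p i) (p j) • (FreeAlgebra.ι R j * FreeAlgebra.ι R i))

/-- The free supercommutative superalgebra over `R` on generators `X_i` of parity `p i`; for
`R = ℂ` these are the polynomial superalgebras `ℂ[x_1, …, x_r, ξ_1, …, ξ_s]`. -/
def SuperPoly (R : Type*) [CommRing R] (ι : Type*) (p : ι → ZMod 2) : Type _ :=
  RingQuot (SuperPoly.Rel R ι p)

namespace SuperPoly

variable (R : Type*) [CommRing R] {ι : Type*} (p : ι → ZMod 2)

instance : Ring (SuperPoly R ι p) := inferInstanceAs (Ring (RingQuot (SuperPoly.Rel R ι p)))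

instance {S : Type*} [CommRing S] [Algebra S R] : Algebra S (SuperPoly R ι p) :=
  inferInstanceAs (Algebra S (RingQuot (SuperPoly.Rel R ι p)))

/-- The generator `X_i`. -/
def X (i : ι) : SuperPoly R ι p := RingQuot.mkAlgHom R (SuperPoly.Rel R ι p) (FreeAlgebra.ι R i)

lemma X_mul_X (i j : ι) : X R p i * X R p j = superSign R (p i) (p j) • (X R p j * X R p i) := by
  have h := RingQuot.mkAlgHom_rel R (SuperPoly.Rel.mk (R := R) (p := p) i j)
  rw [map_mul, map_smul, map_mul] at h
  exact h

/-- The word `X_{i_1} ⋯ X_{i_h}`. -/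
def word (l : List ι) : SuperPoly R ι p := (l.map (X R p)).prod

/-- The universal property. -/
def lift {A : Type*} [Ring A] [Algebra R A] (x : ι → A)
    (hx : ∀ i j, x i * x j = superSign R (p i) (p j) • (x j * x i)) : SuperPoly R ι p →ₐ[R] A :=
  RingQuot.liftAlgHom R (s := SuperPoly.Rel R ι p) ⟨FreeAlgebra.lift R x, by
    rintro _ _ ⟨i, j⟩
    simpa using hx i j⟩

end SuperPoly

section Family

variable {g : Type u} [AddCommGroup g] [Module ℂ g] [LieSuperalgebra g] (D : Datum g)

namespace Datum

/-- The parity of a generator. -/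
def genParity (a : D.Gen) : ZMod 2 := D.expParity a

/-- The polynomial superalgebra `𝒮`, with one generator for each essential monomial of `K_b(λ)`. -/
abbrev S : Type := SuperPoly ℂ D.Gen D.genParity

/-- `𝒮[t]`, as a superalgebra over `ℂ[t]`. -/
abbrev St : Type := SuperPoly ℂ[X] D.Gen D.genParity

/-- The inclusion `𝒮 → 𝒮[t]`. -/
def incl : D.S →ₐ[ℂ] D.St :=
  SuperPoly.lift ℂ D.genParity (SuperPoly.X ℂ[X] D.genParity) (by
    intro i j
    rw [SuperPoly.X_mul_X]
    unfold superSign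
    split <;> simp)

/-- The superalgebra map `𝒮 → R(λ)` sending the generator of `a` to `η_{a,1}`. -/
def evalR : D.S →ₐ[ℂ] (SuperDual g)[X] :=
  SuperPoly.lift ℂ D.genParity (fun a => D.etaR 1 a) (by
    intro a b
    simp only [etaR, Polynomial.monomial_mul_monomial, Polynomial.smul_monomial]
    rw [SuperDual.mul_comm' (D.eta_homogeneous 1 a) (D.eta_homogeneous 1 b)]
    rfl)

/-- The sum of the exponents of the letters of a word. -/
def wordExp (l : List D.Gen) : D.Exp := (l.map Subtype.val).sum

/-- The span of the words of length `k` and exponent `a`; for admissible `a` this is the component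
of degree `(a, k)` of `𝒮`. -/
def comp (a : D.Exp) (k : ℕ) : Submodule ℂ D.S :=
  Submodule.span ℂ {s | ∃ l : List D.Gen, l.length = k ∧ D.wordExp l = a ∧
    s = SuperPoly.word ℂ D.genParity l}

/-- The kernel of the surjection `𝒮 → gr R(λ)`, `X_a ↦ (class of η_{a,1})`. A word whose exponent
is not admissible is mapped to `0`, and an element of degree `(a, k)` with `a` admissible is mapped
to the class of its value in `R_k(λ)^{≥ a} / R_k(λ)^{> a}`. -/
def grKer : Submodule ℂ D.S :=
  Submodule.span ℂ
    ({s | ∃ l : List D.Gen, ¬ D.Admissible (D.wordExp l) ∧ s = SuperPoly.word ℂ D.genParity l} ∪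
      {s | ∃ (a : D.Exp) (k : ℕ), D.Admissible a ∧ s ∈ D.comp a k ∧ D.evalR s ∈ D.filt k a})

/-- Binomials `M + (-1)^σ M'`, where `M, M'` are words of length `k` and exponent `a`. -/
def IsBinomial (a : D.Exp) (k : ℕ) (s : D.S) : Prop :=
  ∃ (l l' : List D.Gen) (σ : ℕ), l.length = k ∧ l'.length = k ∧ D.wordExp l = a ∧
    D.wordExp l' = a ∧
    s = SuperPoly.word ℂ D.genParity l + (-1 : ℂ) ^ σ • SuperPoly.word ℂ D.genParity l'

/-- The largest essential monomial of `K_b(kλ)`. -/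
def IsMaxEssential (k : ℕ) (a : D.Exp) : Prop :=
  D.IsEssential k a ∧ ∀ b, D.IsEssential k b → b = a ∨ D.mono.lt b a

/-- The value `w(a) = ∑ wᵢ aᵢ` of a weight vector. -/
def wt (w : Fin D.N → ℤ) (a : D.Exp) : ℤ := ∑ i, w i * (a i : ℤ)

/-- The choices entering the construction of the family:
* generators `ḡ_1, …, ḡ_m` of the kernel of `𝒮 → gr R(λ)`, each of which is either a monomial
  with inadmissible exponent or a binomial `M + (-1)^σ M'` in an admissible degree;
* lifts `g_k = ḡ_k + ∑ⱼ g_{k,j}` to relations of `R(λ)`, where `g_{k,j}` is homogeneous of degree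
  `(U_{k,j}, h_k)` with `U_{k,j} > J_k`, and `(J_k, h_k)` is the degree of `ḡ_k`;
* a weight vector `w` with `w(U_{k,j}) > w(J_k)` for all `k` and `j`. -/
structure FamilyChoice where
  m : ℕ
  gbar : Fin m → D.S
  J : Fin m → D.Exp
  deg : Fin m → ℕ
  gbar_form : ∀ k,
    (¬ D.Admissible (J k) ∧ ∃ l : List D.Gen, l.length = deg k ∧ D.wordExp l = J k ∧
      gbar k = SuperPoly.word ℂ D.genParity l) ∨
    (D.Admissible (J k) ∧ D.IsBinomial (J k) (deg k) (gbar k))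
  gbar_span : (TwoSidedIdeal.span (Set.range gbar) : Set D.S) = D.grKer
  r : Fin m → ℕ
  U : ∀ k, Fin (r k) → D.Exp
  gtail : ∀ k, Fin (r k) → D.S
  U_admissible : ∀ k j, D.Admissible (U k j)
  U_gt : ∀ k j, D.mono.lt (J k) (U k j)
  gtail_mem : ∀ k j, gtail k j ∈ D.comp (U k j) (deg k)
  relation : ∀ k, D.evalR (gbar k + ∑ j, gtail k j) = 0
  w : Fin D.N → ℤ
  w_lt : ∀ k j, D.wt w (J k) < D.wt w (U k j)

variable {D} (C : D.FamilyChoice)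

/-- The generators of the ideal `𝓘` of `𝒮[t]`: the elements
`ḡ_k + ∑ⱼ t^(w(U_{k,j}) - w(J_k)) g_{k,j}`, and for each `h` all binomial relations of
`gr R(λ)` in the degree of the largest essential monomial of `K_b(hλ)`. -/
def FamilyChoice.relations : Set D.St :=
  {s | ∃ k, s = D.incl (C.gbar k) + ∑ j,
      (Polynomial.X ^ (D.wt C.w (C.U k j) - D.wt C.w (C.J k)).toNat : ℂ[X]) •
        D.incl (C.gtail k j)} ∪
  {s | ∃ (k : ℕ) (a : D.Exp) (b : D.S), D.IsMaxEssential k a ∧ D.IsBinomial a k b ∧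
      b ∈ D.grKer ∧ s = D.incl b}

/-- The family superalgebra `𝓡 = 𝒮[t]/𝓘`. -/
def FamilyChoice.Fam : Type := RingQuot fun x y : D.St => x ∈ C.relations ∧ y = 0

instance : Ring C.Fam :=
  inferInstanceAs (Ring (RingQuot fun x y : D.St => x ∈ C.relations ∧ y = 0))

instance : Algebra ℂ[X] C.Fam :=
  inferInstanceAs (Algebra ℂ[X] (RingQuot fun x y : D.St => x ∈ C.relations ∧ y = 0))

instance : Algebra ℂ C.Fam :=
  inferInstanceAs (Algebra ℂ (RingQuot fun x y : D.St => x ∈ C.relations ∧ y = 0))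

/-- The quotient map `𝒮[t] → 𝓡`. -/
def FamilyChoice.proj : D.St →ₐ[ℂ[X]] C.Fam :=
  RingQuot.mkAlgHom ℂ[X] fun x y : D.St => x ∈ C.relations ∧ y = 0

variable (D) in
/-- A choice, for each `(a, k) ∈ Γ(λ, <)`, of a homogeneous element of `𝒮` of degree `(a, k)`
whose image in `gr R(λ)` is the class of `η_{a,k}`. -/
def IsLift (s : D.Gam → D.S) : Prop :=
  ∀ γ : D.Gam, s γ ∈ D.comp γ.1.1 γ.1.2 ∧
    D.evalR (s γ) - D.etaR γ.1.2 γ.1.1 ∈ D.filt γ.1.2 γ.1.1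

/-- The elements `θ_{a,k}` of `𝓡`. -/
def FamilyChoice.theta (s : D.Gam → D.S) (γ : D.Gam) : C.Fam := C.proj (D.incl (s γ))

end Datum

end Family

end FlatFamily

end

noncomputable section

namespace FlatFamily

open LieSuperalgebra
open scoped LaurentPolynomial

/-! ### Reductive Lie algebras -/

section Reductive

open LieAlgebra LieModule

variable {G : Type*} [LieRing G] [LieAlgebra ℂ G]

/-! The family is a Gröbner-type degeneration: spanning comes from a terminating rewriting process,
independence from a rescaled evaluation in R(λ).

Leading exponents. An element of K(kλ)^* is viewed as a functional on U(g), and the product of R(λ)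
is dual to the super coproduct. For admissible c, the coproduct of f^c is a combination of the f^p ⊗
f^q with p + q = c, and each of them occurs with a nonzero coefficient, a product of binomial
coefficients and signs (`comul_monomial`). Hence the smallest exponents at which functionals do not
vanish add up under multiplication, provided the sum is admissible (`Lead.mul`). As η_{a,k} has
leading exponent a, the value of a word of 𝒮 in R(λ) leads at the sum of the exponents of its
letters (`exists_lead_word`).

Spanning. A word of degree (a, k) with a admissible has the same leading exponent as the chosen lift
of η_{a,k}, so a multiple of that lift can be subtracted to reach the kernel of 𝒮 → gr R(λ); a word
of inadmissible degree lies in this kernel already. A homogeneous element of the kernel is a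
combination of homogeneous multiples of the ḡ_i, and in 𝓡 each ḡ_i equals minus its tail, whose
exponents are larger (`toFam_gbar`). Words of length k have only finitely many exponents, so the
process stops (`toFam_word_mem`).

Independence. Sending the generator of a to t^(-w(a)) η_{a,1} makes all terms of the i-th deformed
relation carry the same factor t^(-w(J_i)), so that the relation becomes a multiple of g_i(η) = 0.
The additional binomials live in the largest degree, where R_k^{>a} = 0, so they hold in R(λ)
itself. This gives a map from 𝓡 to Laurent polynomials in t over a ring containing R(λ) (`famMap`).
The image of θ_{a,k} is t^(-w(a)) times an element with leading exponent a, and distinct leading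
exponents exclude linear relations.

Two facts about K(μ) support this: it is finite-dimensional, and n⁻ acts nilpotently on it. They
make the essential vectors a finite basis although the order on exponents need not be a well-order,
and they give the map K(μ+ν) → K(ν) ⊗ K(μ). Both rest on the triangular decomposition of g, which is
derived from the axioms of a basic Lie superalgebra: Cartan subalgebras of the even part are
abelian, they act diagonalizably on g, and the weight 0 is not odd. -/

/-- The quotient map of a Lie algebra by its center. -/
def centerQuotient (G : Type*) [LieRing G] [LieAlgebra ℂ G] : G →ₗ⁅ℂ⁆ G ⧸ center ℂ G where
  __ := (LieSubmodule.Quotient.mk' (center ℂ G) : G →ₗ[ℂ] G ⧸ center ℂ G)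
  map_lie' := rfl

lemma centerQuotient_surjective : Function.Surjective (centerQuotient G) :=
  Quot.mk_surjective

lemma centerQuotient_eq_zero {x : G} : centerQuotient G x = 0 ↔ x ∈ center ℂ G :=
  LieSubmodule.Quotient.mk_eq_zero _

lemma mem_center_iff {x : G} : x ∈ center ℂ G ↔ ∀ y : G, ⁅y, x⁆ = 0 :=
  mem_maxTrivSubmodule ℂ G G x

/-- Central elements normalize every subalgebra, and H is its own normalizer. -/
lemma center_le_cartan (H : LieSubalgebra ℂ G) [hH : H.IsCartanSubalgebra] {x : G}
    (hx : x ∈ center ℂ G) : x ∈ H := by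
  rw [← hH.self_normalizing, LieSubalgebra.mem_normalizer_iff]
  intro y hy
  rw [← lie_skew, mem_center_iff.1 hx, neg_zero]
  exact H.zero_mem

variable [FiniteDimensional ℂ G]

/-- The preimage of an abelian ideal has its derived ideal in the centre, so it is solvable of
derived length at most two. It therefore lies in the radical, which is the centre, and its image
vanishes. -/
lemma hasTrivialRadical_quotient_center [HasCentralRadical ℂ G] :
    HasTrivialRadical ℂ (G ⧸ center ℂ G) := by
  rw [hasTrivialRadical_iff_no_abelian_ideals]
  intro I hI
  have hJ : IsSolvable (I.comap (centerQuotient G)) := by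
    refine IsSolvable.mk (R := ℂ) (k := 2) ?_
    rw [LieIdeal.derivedSeries_eq_bot_iff]
    have h1 : derivedSeriesOfIdeal ℂ G 1 (I.comap (centerQuotient G)) ≤ center ℂ G := by
      rw [derivedSeriesOfIdeal_succ, derivedSeriesOfIdeal_zero, LieSubmodule.lieIdeal_oper_eq_span,
        LieSubmodule.lieSpan_le]
      rintro _ ⟨x, y, rfl⟩
      rw [SetLike.mem_coe, ← centerQuotient_eq_zero, LieHom.map_lie]
      have hx := (LieIdeal.mem_comap).1 x.2
      have hy := (LieIdeal.mem_comap).1 y.2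
      exact congrArg Subtype.val (hI.trivial ⟨_, hx⟩ ⟨_, hy⟩)
    rw [derivedSeriesOfIdeal_succ, LieSubmodule.lie_eq_bot_iff]
    intro x hx y hy
    exact mem_center_iff.1 (h1 hy) x
  rw [LieIdeal.solvable_iff_le_radical, HasCentralRadical.radical_eq_center] at hJ
  rw [LieSubmodule.eq_bot_iff]
  intro x hx
  obtain ⟨x, rfl⟩ := centerQuotient_surjective x
  exact centerQuotient_eq_zero.2 (hJ (LieIdeal.mem_comap.2 hx))

variable (H : LieSubalgebra ℂ G) [hH : H.IsCartanSubalgebra]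

/-- If the image of x normalizes the image of H, then [x, y] lies in H up to the centre; the centre
is contained in H, so x normalizes H. -/
lemma isCartanSubalgebra_map_centerQuotient :
    (H.map (centerQuotient G)).IsCartanSubalgebra where
  nilpotent := by
    let f : H →ₗ⁅ℂ⁆ H.map (centerQuotient G) :=
      { toFun := fun x => ⟨centerQuotient G x, x, x.2, rfl⟩
        map_add' := fun x y => by ext; simp
        map_smul' := fun c x => by ext; simp
        map_lie' := fun {x y} => by ext; simp }
    have hf : Function.Surjective f := by
      rintro ⟨_, x, hx, rfl⟩
      exact ⟨⟨x, hx⟩, rfl⟩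
    exact hf.lieAlgebra_isNilpotent
  self_normalizing := by
    refine le_antisymm ?_ (LieSubalgebra.le_normalizer _)
    intro x hx
    obtain ⟨x, rfl⟩ := centerQuotient_surjective x
    rw [LieSubalgebra.mem_normalizer_iff] at hx
    refine ⟨x, ?_, rfl⟩
    change x ∈ H
    rw [← hH.self_normalizing, LieSubalgebra.mem_normalizer_iff]
    intro y hy
    obtain ⟨z, hz, hzy⟩ := hx (centerQuotient G y) ⟨y, hy, rfl⟩
    have h0 : ⁅x, y⁆ - z ∈ center ℂ G := by
      rw [← centerQuotient_eq_zero, map_sub, LieHom.map_lie, sub_eq_zero]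
      exact hzy.symm
    have := H.add_mem (center_le_cartan H h0) hz
    rwa [sub_add_cancel] at this

variable [HasCentralRadical ℂ G]

/-- In a reductive Lie algebra, brackets of elements of a Cartan subalgebra are central. -/
lemma lie_mem_center_of_mem_cartan {x y : G} (hx : x ∈ H) (hy : y ∈ H) :
    ⁅x, y⁆ ∈ center ℂ G := by
  have := hasTrivialRadical_quotient_center (G := G)
  have := isCartanSubalgebra_map_centerQuotient H
  rw [← centerQuotient_eq_zero, LieHom.map_lie]
  -- The quotient has trivial radical, hence a nondegenerate Killing form in characteristic zero,
  -- and there Cartan subalgebras are abelian.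
  have hab : IsLieAbelian (H.map (centerQuotient G)) := inferInstance
  exact congrArg Subtype.val (hab.trivial ⟨_, x, hx, rfl⟩ ⟨_, y, hy, rfl⟩)

/-- In a reductive Lie algebra, a Cartan subalgebra acts diagonalizably. -/
lemma lie_eq_smul_of_mem_rootSpace_of_hasCentralRadical {α : H → ℂ} (hα : α ≠ 0) {x : G}
    (hx : x ∈ LieAlgebra.rootSpace H α) (y : H) : ⁅(y : G), x⁆ = α y • x := by
  have := hasTrivialRadical_quotient_center (G := G)
  have := isCartanSubalgebra_map_centerQuotient H
  classical
  have hch : ∀ z : H.map (centerQuotient G), ∃ y : H, centerQuotient G y = z := by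
    rintro ⟨_, y, hy, rfl⟩
    exact ⟨⟨y, hy⟩, rfl⟩
  choose s hs using hch
  -- The value of `α'` depends on the choice of lifts, since it is not yet known that α vanishes on
  -- the centre. Generalized weight spaces make sense for arbitrary functions, so no linearity is
  -- needed.
  let α' : H.map (centerQuotient G) → ℂ := fun z => α (s z)
  have hpow : ∀ (z : H.map (centerQuotient G)) (k : ℕ) (v : G),
      ((toEnd ℂ (H.map (centerQuotient G)) (G ⧸ center ℂ G) z - algebraMap ℂ _ (α' z)) ^ k)
        (centerQuotient G v) =
      centerQuotient G (((toEnd ℂ H G (s z) - algebraMap ℂ _ (α (s z))) ^ k) v) := by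
    intro z k
    induction k with
    | zero => simp
    | succ k ih =>
      intro v
      rw [pow_succ, pow_succ, Module.End.mul_apply, Module.End.mul_apply, ← ih]
      congr 1
      have h1 : ⁅z, centerQuotient G v⁆ = centerQuotient G ⁅s z, v⁆ := by
        change ⁅(z : G ⧸ center ℂ G), centerQuotient G v⁆ = centerQuotient G ⁅(s z : G), v⁆
        rw [LieHom.map_lie, hs]
      simp [Module.algebraMap_end_apply, h1, α']
  have hx' : centerQuotient G x ∈ LieAlgebra.rootSpace (H.map (centerQuotient G)) α' := by
    rw [LieAlgebra.rootSpace, LieModule.mem_genWeightSpace]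
    intro z
    obtain ⟨k, hk⟩ := (LieModule.mem_genWeightSpace G α x).1 hx (s z)
    refine ⟨k, ?_⟩
    have := hpow z k x
    simp only [Algebra.algebraMap_eq_smul_one] at this hk
    rw [this, hk, map_zero]
  have hdisj : Disjoint (LieAlgebra.rootSpace H α) (LieAlgebra.rootSpace H 0) :=
    LieModule.disjoint_genWeightSpace ℂ H G hα
  -- In the semisimple quotient the image of x is a true eigenvector, so [y, x] is a multiple of x
  -- up to a central error. The error lies in H, hence in the generalized weight space of 0, and
  -- also in that of α ≠ 0; these are disjoint.
  have key : ∀ y : H, ∃ c : ℂ, ⁅(y : G), x⁆ = c • x := by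
    intro y
    refine ⟨α' ⟨centerQuotient G y, y, y.2, rfl⟩, ?_⟩
    have h1 := LieAlgebra.IsKilling.lie_eq_smul_of_mem_rootSpace hx'
      ⟨centerQuotient G y, y, y.2, rfl⟩
    have h2 : ⁅(y : G), x⁆ - α' ⟨centerQuotient G y, y, y.2, rfl⟩ • x ∈ center ℂ G := by
      rw [← centerQuotient_eq_zero, map_sub, LieHom.map_lie, map_smul, sub_eq_zero]
      exact h1
    rw [← sub_eq_zero]
    have h3 := LieAlgebra.toLieSubmodule_le_rootSpace_zero ℂ G H
      (x := ⁅(y : G), x⁆ - α' ⟨centerQuotient G y, y, y.2, rfl⟩ • x) (center_le_cartan H h2)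
    have h4 : ⁅(y : G), x⁆ - α' ⟨centerQuotient G y, y, y.2, rfl⟩ • x ∈
        LieAlgebra.rootSpace H α :=
      sub_mem (LieSubmodule.lie_mem _ (x := y) hx) (SMulMemClass.smul_mem _ hx)
    have h5 := (disjoint_iff_inf_le.1 hdisj) ((LieSubmodule.mem_inf _ _ _).2 ⟨h4, h3⟩)
    exact (LieSubmodule.mem_bot _).1 h5
  obtain ⟨c, hc⟩ := key y
  by_cases hx0 : x = 0
  · simp [hx0]
  obtain ⟨k, hk⟩ := (LieModule.mem_genWeightSpace G α x).1 hx y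
  -- The eigenvalue c need not be α(y) a priori; it is, because x is also a generalized eigenvector
  -- for α(y).
  have hpow2 : ((toEnd ℂ H G y - α y • 1) ^ k) x = (c - α y) ^ k • x := by
    clear hk
    induction k with
    | zero => simp
    | succ k ih =>
      have h1 : ⁅y, x⁆ = c • x := hc
      rw [pow_succ', Module.End.mul_apply, ih, map_smul, pow_succ, mul_smul]
      simp [h1, sub_smul]
  rw [hpow2] at hk
  rcases smul_eq_zero.1 hk with h | h
  · rw [hc, sub_eq_zero.1 (eq_zero_of_pow_eq_zero h)]
  · exact absurd h hx0

end Reductive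

/-! ### The root decomposition of a basic Lie superalgebra -/

section Super

variable {g : Type*} [AddCommGroup g] [Module ℂ g] [LieSuperalgebra g]

lemma exists_add_parts (x : g) : ∃ a ∈ part (g := g) 0, ∃ b ∈ part (g := g) 1, a + b = x := by
  have hx : x ∈ part (g := g) 0 ⊔ part 1 := by
    rw [(isCompl (g := g)).sup_eq_top]; trivial
  exact Submodule.mem_sup.1 hx

lemma evenProj_mem (x : g) : evenProj x ∈ part (g := g) 0 := by
  obtain ⟨a, ha, b, hb, rfl⟩ := exists_add_parts x
  rw [map_add, evenProj_of_mem_zero ha, evenProj_of_mem_one hb, add_zero]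
  exact ha

lemma oddProj_mem (x : g) : oddProj x ∈ part (g := g) 1 := by
  obtain ⟨a, ha, b, hb, rfl⟩ := exists_add_parts x
  rw [map_add, oddProj_of_mem_zero ha, oddProj_of_mem_one hb, zero_add]
  exact hb

lemma evenProj_add_oddProj (x : g) : evenProj x + oddProj x = x := by
  simp [oddProj]

lemma bracket_add_left (x y z : g) : bracket (x + y) z = bracket x z + bracket y z := by
  rw [map_add, LinearMap.add_apply]

lemma bracket_smul_left (c : ℂ) (x y : g) : bracket (c • x) y = c • bracket x y := by
  rw [map_smul, LinearMap.smul_apply]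

lemma jacobi_even {x : g} (hx : x ∈ part 0) (y z : g) :
    bracket x (bracket y z) = bracket (bracket x y) z + bracket y (bracket x z) := by
  obtain ⟨a, ha, b, hb, rfl⟩ := exists_add_parts y
  obtain ⟨c, hc, d, hd, rfl⟩ := exists_add_parts z
  have h1 := jacobi hx ha hc
  have h2 := jacobi hx ha hd
  have h3 := jacobi hx hb hc
  have h4 := jacobi hx hb hd
  simp only [superSign_zero_left, one_smul] at h1 h2 h3 h4
  simp only [map_add, LinearMap.add_apply, h1, h2, h3, h4]
  abel

lemma skew_even {x : g} (hx : x ∈ part 0) (y : g) : bracket y x = - bracket x y := by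
  obtain ⟨a, ha, b, hb, rfl⟩ := exists_add_parts y
  have h1 := skew ha hx
  have h2 := skew hb hx
  simp only [superSign_zero_right, one_smul] at h1 h2
  simp only [map_add, LinearMap.add_apply, h1, h2]
  abel

instance instLieRingModuleEven : LieRingModule (EvenPart g) g where
  bracket x m := bracket x.1 m
  add_lie _ _ _ := bracket_add_left _ _ _
  lie_add _ _ _ := map_add _ _ _
  leibniz_lie x _ _ := jacobi_even x.2 _ _

lemma even_lie_def (x : EvenPart g) (m : g) : ⁅x, m⁆ = bracket x.1 m := rfl

instance instLieModuleEven : LieModule ℂ (EvenPart g) g where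
  smul_lie _ _ _ := bracket_smul_left _ _ _
  lie_smul _ _ _ := map_smul _ _ _

lemma coe_even_lie (x y : EvenPart g) : ((⁅x, y⁆ : EvenPart g) : g) = bracket x.1 y.1 := rfl

variable {h : LieSubalgebra ℂ (EvenPart g)}

/-- Elements of the Cartan subalgebra are even, so the eigenvalue equation splits into its even and
odd components. -/
lemma evenProj_mem_rootSpace {α : Module.Dual ℂ h} {x : g} (hx : x ∈ rootSpace h α) :
    evenProj x ∈ rootSpace h α ∧ oddProj x ∈ rootSpace h α := by
  have key : ∀ H : h, bracket ((H : EvenPart g) : g) (evenProj x) - α H • evenProj x = 0 ∧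
      bracket ((H : EvenPart g) : g) (oddProj x) - α H • oddProj x = 0 := by
    intro H
    have h1 := hx H
    rw [← evenProj_add_oddProj x, map_add, smul_add] at h1
    have h2 : bracket ((H : EvenPart g) : g) (evenProj x) - α H • evenProj x ∈ part (g := g) 0 :=
      sub_mem (by simpa using bracket_mem H.1.2 (evenProj_mem x))
        (Submodule.smul_mem _ _ (evenProj_mem x))
    have h3 : bracket ((H : EvenPart g) : g) (oddProj x) - α H • oddProj x ∈ part (g := g) 1 :=
      sub_mem (by simpa using bracket_mem H.1.2 (oddProj_mem x))
        (Submodule.smul_mem _ _ (oddProj_mem x))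
    have h4 : (bracket ((H : EvenPart g) : g) (evenProj x) - α H • evenProj x) +
      (bracket ((H : EvenPart g) : g) (oddProj x) - α H • oddProj x) = 0 := by
      rw [sub_add_sub_comm, h1, sub_self]
    have h5 := (Submodule.disjoint_def.1 (isCompl (g := g)).disjoint) _ h2 (by
      rw [eq_neg_of_add_eq_zero_left h4]; exact neg_mem h3)
    rw [h5, zero_add] at h4
    exact ⟨h5, h4⟩
  exact ⟨fun H => sub_eq_zero.1 (key H).1, fun H => sub_eq_zero.1 (key H).2⟩

lemma bracket_mem_rootSpace {α β : Module.Dual ℂ h} {x y : g} (hx : x ∈ rootSpace h α)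
    (hy : y ∈ rootSpace h β) : bracket x y ∈ rootSpace h (α + β) := by
  intro H
  rw [jacobi_even H.1.2, hx H, hy H, bracket_smul_left, map_smul, LinearMap.add_apply, add_smul]

/-- A central even element of a simple Lie superalgebra with a nontrivial bracket vanishes. -/
lemma eq_zero_or_top_of_central (hs : IsSimple g) {z : g} {i : ZMod 2} (hi : z ∈ part i)
    (hz : ∀ y, bracket y z = 0) : z = 0 ∨ Submodule.span ℂ {z} = ⊤ := by
  have : IsGradedIdeal (Submodule.span ℂ {z}) := by
    constructor
    · intro x y hy
      obtain ⟨c, rfl⟩ := Submodule.mem_span_singleton.1 hy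
      rw [map_smul, hz, smul_zero]
      exact zero_mem _
    · rw [Submodule.span_singleton_le_iff_mem]
      rcases zmod_two_cases i with rfl | rfl
      · exact Submodule.mem_sup_left ⟨Submodule.mem_span_singleton_self z, hi⟩
      · exact Submodule.mem_sup_right ⟨Submodule.mem_span_singleton_self z, hi⟩
  rcases hs _ this with h | h
  · exact Or.inl (Submodule.span_singleton_eq_bot.1 h)
  · exact Or.inr h

/-- A central element which is a bracket vanishes. -/
lemma eq_zero_of_central_of_bracket (hs : IsSimple g) {x y : g} {i : ZMod 2}
    (hi : bracket x y ∈ part i) (hz : ∀ w, bracket w (bracket x y) = 0) : bracket x y = 0 := by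
  rcases eq_zero_or_top_of_central hs hi hz with h | h
  · exact h
  · have hy : y ∈ Submodule.span ℂ {bracket x y} := h ▸ trivial
    obtain ⟨c, hc⟩ := Submodule.mem_span_singleton.1 hy
    conv_lhs => rw [← hc]
    rw [map_smul, hz, smul_zero]

end Super

/-! ### The Cartan subalgebra is abelian and acts diagonalizably on g -/

section Cartan

variable {g : Type*} [AddCommGroup g] [Module ℂ g] [LieSuperalgebra g]

/-- A nonzero submodule of `g` over the even part contains a common eigenvector of a nilpotent
subalgebra. -/
lemma exists_eigenvector [FiniteDimensional ℂ g] (h : LieSubalgebra ℂ (EvenPart g))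
    [LieRing.IsNilpotent h] {W : Submodule ℂ g}
    (hW : ∀ x ∈ part (g := g) 0, ∀ y ∈ W, bracket x y ∈ W) (hne : W ≠ ⊥) :
    ∃ χ : Module.Dual ℂ h, ∃ m ∈ W, m ≠ 0 ∧ m ∈ rootSpace h χ := by
  let W' : LieSubmodule ℂ (EvenPart g) g := { W with lie_mem := fun {x m} hm => hW x.1 x.2 m hm }
  have hnt : Nontrivial W' := (Submodule.nontrivial_iff_ne_bot).2 hne
  obtain ⟨χ, hχ⟩ := LieModule.exists_nontrivial_weightSpace_of_isNilpotent (k := ℂ) (L := h)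
    (M := W')
  obtain ⟨⟨m, hm⟩, hm0⟩ := exists_ne (0 : LieModule.weightSpace W' χ)
  rw [LieModule.mem_weightSpace] at hm
  refine ⟨χ, m, m.2, ?_, fun H => ?_⟩
  · intro h0
    apply hm0
    ext
    exact h0
  · exact congrArg Subtype.val (hm H)

/-- Cartan subalgebras of the even part of a basic Lie superalgebra are abelian. -/
lemma cartan_lie_eq_zero (hg : IsBasic g) (h : LieSubalgebra ℂ (EvenPart g))
    [hH : h.IsCartanSubalgebra] (x y : h) : ⁅(x : EvenPart g), (y : EvenPart g)⁆ = 0 := by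
  have := hg.finite
  have := hg.reductive
  set z : EvenPart g := ⁅(x : EvenPart g), (y : EvenPart g)⁆ with hzdef
  have hz : z ∈ LieAlgebra.center ℂ (EvenPart g) := lie_mem_center_of_mem_cartan h x.2 y.2
  have hcomm : ∀ w : EvenPart g, ⁅w, z⁆ = 0 := mem_center_iff.1 hz
  have hcomm' : ∀ w ∈ part (g := g) 0, ∀ m : g,
      bracket z.1 (bracket w m) = bracket w (bracket z.1 m) := by
    intro w hw m
    rw [jacobi_even z.2, skew_even hw]
    have h1 := congrArg Subtype.val (hcomm ⟨w, hw⟩)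
    rw [coe_even_lie] at h1
    simp [h1]
  -- The element z commutes with the even part, so its kernel on the odd part is a submodule and has
  -- an invariant complement.
  let W : Submodule ℂ g := LinearMap.ker (bracket z.1) ⊓ part 1
  obtain ⟨W', hW'1, hW', hinf, hsup⟩ := hg.completelyReducible W inf_le_right (by
    rintro a ha b ⟨hb, hb1⟩
    refine ⟨?_, by simpa using bracket_mem ha hb1⟩
    rw [SetLike.mem_coe, LinearMap.mem_ker] at hb ⊢
    rw [hcomm' a ha, hb, map_zero])
  -- A nonzero complement would contain a common eigenvector of h, on which the commutator z = [x,
  -- y] acts by 0; this vector would lie in W as well. So z is central in g, and a central bracket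
  -- vanishes by simplicity.
  have hbot : W' = ⊥ := by
    by_contra hne
    obtain ⟨χ, m, hm, hm0, hχ⟩ := exists_eigenvector h hW' hne
    apply hm0
    rw [← Submodule.mem_bot ℂ, ← hinf]
    refine ⟨⟨?_, hW'1 hm⟩, hm⟩
    have h1 := jacobi_even x.1.2 y.1.1 m
    rw [hχ, hχ, map_smul, map_smul, hχ, hχ, smul_smul, smul_smul, mul_comm] at h1
    rw [SetLike.mem_coe, LinearMap.mem_ker, hzdef, coe_even_lie]
    simpa using h1
  rw [hbot, sup_bot_eq] at hsup
  have hcentral : ∀ w : g, bracket w z.1 = 0 := by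
    intro w
    have h1 : bracket z.1 (oddProj w) = 0 := by
      have : oddProj w ∈ W := hsup ▸ oddProj_mem w
      exact this.1
    have h2 := congrArg Subtype.val (hcomm ⟨evenProj w, evenProj_mem w⟩)
    rw [coe_even_lie] at h2
    rw [← evenProj_add_oddProj w, bracket_add_left, skew_even z.2 (oddProj w), h1]
    simpa using h2
  have := eq_zero_of_central_of_bracket hg.simple z.2 hcentral
  exact Subtype.ext this

lemma mem_rootSpace_zero_of_mem_cartan (hg : IsBasic g) (h : LieSubalgebra ℂ (EvenPart g))
    [h.IsCartanSubalgebra] (H : h) : ((H : EvenPart g) : g) ∈ rootSpace h 0 := by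
  intro H'
  rw [← coe_even_lie, cartan_lie_eq_zero hg h]
  simp

/-- An even element of weight 0 commutes with h, hence normalizes it, and h is self-normalizing. -/
lemma mem_cartan_of_mem_rootSpace_zero (h : LieSubalgebra ℂ (EvenPart g))
    [hH : h.IsCartanSubalgebra] {x : g} (hx : x ∈ rootSpace h 0) (hx0 : x ∈ part 0) :
    ∃ H : h, ((H : EvenPart g) : g) = x := by
  have : (⟨x, hx0⟩ : EvenPart g) ∈ h := by
    rw [← hH.self_normalizing, LieSubalgebra.mem_normalizer_iff]
    intro y hy
    have h1 : ⁅y, (⟨x, hx0⟩ : EvenPart g)⁆ = 0 := Subtype.ext (by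
      rw [coe_even_lie]; simpa using hx ⟨y, hy⟩)
    rw [← lie_skew, h1, neg_zero]
    exact h.zero_mem
  exact ⟨⟨_, this⟩, rfl⟩

lemma bracket_mem_iSup_rootSpace {h : LieSubalgebra ℂ (EvenPart g)} {x y : g}
    (hx : x ∈ ⨆ χ, rootSpace h χ) (hy : y ∈ ⨆ χ, rootSpace h χ) :
    bracket x y ∈ ⨆ χ, rootSpace h χ := by
  induction hx using Submodule.iSup_induction' with
  | zero => simp
  | add a b _ _ ha hb => rw [bracket_add_left]; exact add_mem ha hb
  | mem α x hx =>
    induction hy using Submodule.iSup_induction' with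
    | zero => simp
    | add a b _ _ ha hb => rw [map_add]; exact add_mem ha hb
    | mem β y hy => exact Submodule.mem_iSup_of_mem _ (bracket_mem_rootSpace hx hy)

/-- The root decomposition. -/
lemma iSup_rootSpace_eq_top (hg : IsBasic g) (h : LieSubalgebra ℂ (EvenPart g))
    [hH : h.IsCartanSubalgebra] : ⨆ χ, rootSpace h χ = ⊤ := by
  have := hg.finite
  have := hg.reductive
  have h0 : part (g := g) 0 ≤ ⨆ χ, rootSpace h χ := by
    intro x hx
    have hx' : (⟨x, hx⟩ : EvenPart g) ∈
        ⨆ χ : LieModule.Weight ℂ h (EvenPart g), LieModule.genWeightSpace (EvenPart g) χ := by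
      rw [LieModule.iSup_genWeightSpace_eq_top']; trivial
    change ((⟨x, hx⟩ : EvenPart g) : g) ∈ _
    generalize (⟨x, hx⟩ : EvenPart g) = z at hx'
    induction hx' using LieSubmodule.iSup_induction' with
    | zero => exact zero_mem _
    | add a b _ _ ha hb => exact add_mem ha hb
    | mem χ z hz =>
      -- The generalized weight space of 0 is h itself, which is abelian; the others consist of true
      -- eigenvectors because the even part is reductive.
      by_cases hχ : (χ : h → ℂ) = 0
      · rw [hχ] at hz
        have hz' : z ∈ LieAlgebra.rootSpace h 0 := hz
        rw [LieAlgebra.rootSpace_zero_eq] at hz'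
        exact Submodule.mem_iSup_of_mem 0 (mem_rootSpace_zero_of_mem_cartan hg h ⟨z, hz'⟩)
      · refine Submodule.mem_iSup_of_mem χ.toLinear fun H => ?_
        exact congrArg Subtype.val
          (lie_eq_smul_of_mem_rootSpace_of_hasCentralRadical h hχ hz H)
  -- An invariant complement, in the odd part, to the span of the weight vectors contains no
  -- eigenvector of h, so it is zero.
  have h1 : part (g := g) 1 ≤ ⨆ χ, rootSpace h χ := by
    obtain ⟨W', hW'1, hW', hinf, hsup⟩ :=
      hg.completelyReducible ((⨆ χ, rootSpace h χ) ⊓ part 1) inf_le_right (by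
        rintro a ha b ⟨hb, hb1⟩
        exact ⟨bracket_mem_iSup_rootSpace (h0 ha) hb, by simpa using bracket_mem ha hb1⟩)
    have hbot : W' = ⊥ := by
      by_contra hne
      obtain ⟨χ, m, hm, hm0, hχ⟩ := exists_eigenvector h hW' hne
      apply hm0
      rw [← Submodule.mem_bot ℂ, ← hinf]
      exact ⟨⟨Submodule.mem_iSup_of_mem χ hχ, hW'1 hm⟩, hm⟩
    rw [hbot, sup_bot_eq] at hsup
    rw [← hsup]
    exact inf_le_left
  rw [eq_top_iff, ← (isCompl (g := g)).sup_eq_top]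
  exact sup_le h0 h1

end Cartan

/-! ### The invariant form, sl₂-triples and the triangular decomposition -/

section Form

variable {g : Type*} [AddCommGroup g] [Module ℂ g] [LieSuperalgebra g]

/-- A nondegenerate invariant even supersymmetric bilinear form. -/
structure IsInvariantForm (B : g →ₗ[ℂ] g →ₗ[ℂ] ℂ) : Prop where
  nondeg : ∀ x, (∀ y, B x y = 0) → x = 0
  inv : ∀ x y z, B (bracket x y) z = B x (bracket y z)
  symm : ∀ (i j : ZMod 2) (x y : g), x ∈ part i → y ∈ part j → B x y = superSign ℂ i j * B y x
  even : ∀ x y : g, x ∈ part 0 → y ∈ part 1 → B x y = 0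

lemma IsBasic.exists_form (hg : IsBasic g) :
    ∃ B : g →ₗ[ℂ] g →ₗ[ℂ] ℂ, IsInvariantForm B := by
  obtain ⟨B, h1, h2, h3, h4⟩ := hg.form
  exact ⟨B, h1.1, h2, h3, h4⟩

variable {B : g →ₗ[ℂ] g →ₗ[ℂ] ℂ} (hB : IsInvariantForm B)
  {h : LieSubalgebra ℂ (EvenPart g)}

namespace IsInvariantForm

lemma apply_eq_zero_of_ne (hB : IsInvariantForm B) {i j : ZMod 2} (hij : i ≠ j) {x y : g}
    (hx : x ∈ part i) (hy : y ∈ part j) : B x y = 0 := by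
  rcases zmod_two_cases i with rfl | rfl <;> rcases zmod_two_cases j with rfl | rfl
  · exact absurd rfl hij
  · exact hB.even x y hx hy
  · rw [hB.symm 1 0 x y hx hy, hB.even y x hy hx, mul_zero]
  · exact absurd rfl hij

/-- Invariance under H gives (α + β)(H) B(x, y) = 0. -/
lemma apply_rootSpace (hB : IsInvariantForm B) {α β : Module.Dual ℂ h} (hαβ : α + β ≠ 0)
    {x y : g} (hx : x ∈ rootSpace h α) (hy : y ∈ rootSpace h β) : B x y = 0 := by
  obtain ⟨H, hH⟩ : ∃ H, (α + β) H ≠ 0 := by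
    by_contra! hall
    exact hαβ (LinearMap.ext hall)
  have h1 := hB.inv x ((H : EvenPart g) : g) y
  rw [skew_even H.1.2, hx H, hy H] at h1
  simp only [map_neg, map_smul, LinearMap.neg_apply, LinearMap.smul_apply, smul_eq_mul] at h1
  have h2 : (α + β) H * B x y = 0 := by
    rw [LinearMap.add_apply, add_mul, ← h1]; ring
  exact (mul_eq_zero.1 h2).resolve_left hH

/-- The form pairs opposite root spaces perfectly. -/
lemma exists_apply_ne_zero (hB : IsInvariantForm B) (htop : ⨆ χ, rootSpace h χ = ⊤)
    {α : Module.Dual ℂ h} {i : ZMod 2} {x : g} (hx : x ∈ rootSpace h α) (hi : x ∈ part i)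
    (hne : x ≠ 0) : ∃ y ∈ rootSpace h (-α), y ∈ part i ∧ B x y ≠ 0 := by
  by_contra! hall
  apply hne
  apply hB.nondeg
  intro y
  have hy : y ∈ ⨆ χ, rootSpace h χ := htop ▸ trivial
  induction hy using Submodule.iSup_induction' with
  | zero => simp
  | add a b _ _ ha hb => rw [map_add, ha, hb, add_zero]
  | mem β y hy =>
    by_cases hβ : α + β = 0
    · obtain rfl : β = -α := (neg_eq_of_add_eq_zero_right hβ).symm
      obtain ⟨h0, h1⟩ := evenProj_mem_rootSpace hy
      rw [← evenProj_add_oddProj y, map_add]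
      rcases zmod_two_cases i with rfl | rfl
      · rw [hall _ h0 (evenProj_mem y),
          hB.apply_eq_zero_of_ne (by decide) hi (oddProj_mem y), add_zero]
      · rw [hall _ h1 (oddProj_mem y),
          hB.apply_eq_zero_of_ne (by decide) hi (evenProj_mem y), add_zero]
    · exact hB.apply_rootSpace hβ hx hy

/-- If `x, y` are in opposite root spaces and have the same parity, then `[x, y] = B(x, y) t` for
a vector `t` which only depends on the root. -/
lemma exists_coroot (hB : IsInvariantForm B) (hg : IsBasic g) [h.IsCartanSubalgebra]
    {α : Module.Dual ℂ h} (hne : ∃ i, ∃ x ∈ rootSpace h α, x ∈ part i ∧ x ≠ 0) :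
    ∃ t : h, ∀ i, ∀ x ∈ rootSpace h α, ∀ y ∈ rootSpace h (-α), x ∈ part i → y ∈ part i →
      bracket x y = B x y • ((t : EvenPart g) : g) := by
  have htop := iSup_rootSpace_eq_top hg h
  have hii : ∀ i : ZMod 2, i + i = 0 := by decide
  -- The bracket is even of weight 0, so it lies in h, and invariance of the form computes its
  -- pairing with h.
  have hmem : ∀ i, ∀ x ∈ rootSpace h α, ∀ y ∈ rootSpace h (-α), x ∈ part i → y ∈ part i →
      ∃ H : h, ((H : EvenPart g) : g) = bracket x y ∧
        ∀ H' : h, B ((H : EvenPart g) : g) ((H' : EvenPart g) : g) = α H' * B x y := by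
    intro i x hx y hy hxi hyi
    obtain ⟨H, hH⟩ := mem_cartan_of_mem_rootSpace_zero h
      (by simpa using bracket_mem_rootSpace hx hy) (by simpa [hii] using bracket_mem hxi hyi)
    refine ⟨H, hH, fun H' => ?_⟩
    rw [hH, hB.inv, skew_even H'.1.2, hy H']
    simp
  obtain ⟨i, x, hx, hxi, hx0⟩ := hne
  obtain ⟨y, hy, hyi, hxy⟩ := hB.exists_apply_ne_zero htop hx hxi hx0
  obtain ⟨t, ht, ht'⟩ := hmem i x hx y hy hxi hyi
  refine ⟨(B x y)⁻¹ • t, fun j u hu v hv huj hvj => ?_⟩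
  obtain ⟨s, hs, hs'⟩ := hmem j u hu v hv huj hvj
  -- The form is nondegenerate on h, so an element of h is determined by its pairings with h; the
  -- two sides have proportional pairings.
  have hz : s - (B u v * (B x y)⁻¹) • t = 0 := by
    have hz0 : (((s - (B u v * (B x y)⁻¹) • t : h) : EvenPart g) : g) = 0 := by
      by_contra hne
      obtain ⟨w, hw, hw0, hw'⟩ := hB.exists_apply_ne_zero htop
        (mem_rootSpace_zero_of_mem_cartan hg h _)
        (s - (B u v * (B x y)⁻¹) • t : h).1.2 hne
      obtain ⟨H', rfl⟩ := mem_cartan_of_mem_rootSpace_zero h (by simpa using hw) hw0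
      apply hw'
      have h1 := hs' H'
      have h2 := ht' H'
      change B (((s : EvenPart g) : g) - (B u v * (B x y)⁻¹) • ((t : EvenPart g) : g)) _ = 0
      rw [map_sub, map_smul, LinearMap.sub_apply, LinearMap.smul_apply, h1, h2, smul_eq_mul]
      field_simp
      ring
    exact Subtype.ext (Subtype.ext hz0)
  rw [← hs, sub_eq_zero.1 hz]
  simp [mul_smul]

/-- The coroot represents the root. -/
lemma apply_coroot (hB : IsInvariantForm B) {α : Module.Dual ℂ h} {x y : g}
    (hy : y ∈ rootSpace h (-α)) {t H : h}
    (hxy : bracket x y = B x y • ((t : EvenPart g) : g)) (h0 : B x y ≠ 0) :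
    B ((t : EvenPart g) : g) ((H : EvenPart g) : g) = α H := by
  have h1 := hB.inv x y ((H : EvenPart g) : g)
  rw [hxy, skew_even H.1.2, hy H] at h1
  simp only [map_neg, map_smul, LinearMap.smul_apply, LinearMap.neg_apply, smul_eq_mul,
    neg_mul, neg_neg] at h1
  apply mul_left_cancel₀ h0
  rw [h1, mul_comm]

end IsInvariantForm

/-- If the commutator of two endomorphisms commutes with both of them and is diagonalizable, then
it vanishes. -/
lemma eq_zero_of_commutator_apply {V : Type*} [AddCommGroup V] [Module ℂ V]
    [FiniteDimensional ℂ V] {E F T : Module.End ℂ V} (hT : E * F - F * E = T)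
    (hE : E * T = T * E) (hF : F * T = T * F) {c : ℂ} {v : V} (hv : T v = c • v) : T v = 0 := by
  by_contra hne
  have hc : c ≠ 0 := by rintro rfl; simp [hv] at hne
  have hv0 : v ≠ 0 := by rintro rfl; simp at hne
  -- E and F preserve the eigenspace W of T, where their commutator is the scalar c. A commutator
  -- has trace 0, so c · dim W = 0.
  let W := T.eigenspace c
  have hEW : ∀ w ∈ W, E w ∈ W := by
    intro w hw
    rw [Module.End.mem_eigenspace_iff] at hw ⊢
    rw [← Module.End.mul_apply, ← hE, Module.End.mul_apply, hw, map_smul]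
  have hFW : ∀ w ∈ W, F w ∈ W := by
    intro w hw
    rw [Module.End.mem_eigenspace_iff] at hw ⊢
    rw [← Module.End.mul_apply, ← hF, Module.End.mul_apply, hw, map_smul]
  have hcomm : E.restrict hEW * F.restrict hFW - F.restrict hFW * E.restrict hEW =
      c • (1 : Module.End ℂ W) := by
    ext w
    have h1 := LinearMap.congr_fun hT w.1
    have h2 := Module.End.mem_eigenspace_iff.1 w.2
    rw [h2] at h1
    simpa using h1
  have htr := congrArg (LinearMap.trace ℂ W) hcomm
  rw [map_sub, LinearMap.trace_mul_comm, sub_self, map_smul, LinearMap.trace_one] at htr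
  have hpos : 0 < Module.finrank ℂ W :=
    Module.finrank_pos_iff_exists_ne_zero.2
      ⟨⟨v, Module.End.mem_eigenspace_iff.2 hv⟩, fun h0 => hv0 (congrArg Subtype.val h0)⟩
  rw [smul_eq_mul, eq_comm, mul_eq_zero] at htr
  rcases htr with h1 | h1
  · exact hc h1
  · exact hpos.ne' (by exact_mod_cast h1)

variable [h.IsCartanSubalgebra]

/-- Even roots are not isotropic. -/
lemma IsInvariantForm.apply_coroot_ne_zero (hB : IsInvariantForm B) (hg : IsBasic g)
    {α : Module.Dual ℂ h} (hα : α ≠ 0) {e f : g} (he : e ∈ rootSpace h α)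
    (hf : f ∈ rootSpace h (-α)) (he0 : e ∈ part 0) {t : h}
    (ht : bracket e f = B e f • ((t : EvenPart g) : g)) (hef : B e f ≠ 0) : α t ≠ 0 := by
  have := hg.finite
  intro hαt
  obtain ⟨H, hH⟩ : ∃ H, α H ≠ 0 := by
    by_contra! hall
    exact hα (LinearMap.ext hall)
  have hBt := hB.apply_coroot (H := H) hf ht hef
  -- If α(t) = 0, then t commutes with e and f, while ad t is up to a scalar the commutator of ad e
  -- and ad f. By the trace argument the diagonalizable operator ad t vanishes. Then t is a central
  -- bracket, so t = 0, contradicting B(t, H) = α(H) ≠ 0.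
  have hct : ∀ w, bracket w ((t : EvenPart g) : g) = 0 := by
    intro w
    rw [skew_even t.1.2, neg_eq_zero]
    have hw : w ∈ ⨆ χ, rootSpace h χ := iSup_rootSpace_eq_top hg h ▸ trivial
    induction hw using Submodule.iSup_induction' with
    | zero => simp
    | add a b _ _ ha hb => rw [map_add, ha, hb, add_zero]
    | mem β y hy =>
      refine eq_zero_of_commutator_apply (E := (B e f)⁻¹ • bracket e) (F := bracket f)
        (T := bracket ((t : EvenPart g) : g)) ?_ ?_ ?_ (hy t)
      · ext m
        have h1 := jacobi_even he0 f m
        rw [ht, bracket_smul_left] at h1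
        simp only [LinearMap.sub_apply, Module.End.mul_apply, LinearMap.smul_apply, map_smul, h1,
          smul_add, smul_smul, inv_mul_cancel₀ hef, one_smul]
        abel
      · ext m
        have h1 := jacobi_even t.1.2 e m
        rw [he t, hαt, zero_smul, map_zero, LinearMap.zero_apply, zero_add] at h1
        simp [h1]
      · ext m
        have h1 := jacobi_even t.1.2 f m
        rw [hf t, LinearMap.neg_apply, hαt, neg_zero, zero_smul, map_zero, LinearMap.zero_apply,
          zero_add] at h1
        simp [h1]
  have h2 : bracket e ((B e f)⁻¹ • f) = ((t : EvenPart g) : g) := by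
    rw [map_smul, ht, smul_smul, inv_mul_cancel₀ hef, one_smul]
  have h3 := eq_zero_of_central_of_bracket hg.simple (x := e) (y := (B e f)⁻¹ • f) (i := 0)
    (h2 ▸ t.1.2) (fun w => h2 ▸ hct w)
  rw [h2] at h3
  rw [h3, map_zero, LinearMap.zero_apply] at hBt
  exact hH hBt.symm

/-- For every even root vector `f` there is an `sl₂`-triple containing it. -/
lemma exists_sl2 (hg : IsBasic g) {α : Module.Dual ℂ h} (hα : α ≠ 0) {f : g}
    (hf : f ∈ rootSpace h (-α)) (hf0 : f ∈ part 0) (hne : f ≠ 0) :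
    ∃ (e : EvenPart g) (H : h), e.1 ∈ rootSpace h α ∧ α H = 2 ∧
      IsSl2Triple (H : EvenPart g) e ⟨f, hf0⟩ := by
  obtain ⟨B, hB⟩ := hg.exists_form
  have htop := iSup_rootSpace_eq_top hg h
  obtain ⟨e, he, he0, hfe⟩ := hB.exists_apply_ne_zero htop hf hf0 hne
  rw [neg_neg] at he
  have hef : B e f ≠ 0 := by
    rwa [hB.symm 0 0 e f he0 hf0, superSign_zero_left, one_mul]
  have hene : e ≠ 0 := by rintro rfl; simp at hef
  obtain ⟨t, ht⟩ := hB.exists_coroot hg ⟨0, e, he, he0, hene⟩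
  have hef' := ht 0 e he f hf he0 hf0
  have hαt := hB.apply_coroot_ne_zero hg hα he hf he0 hef' hef
  -- The scalar is forced by [c e, f] = (2 / α(t)) t, where [e, f] = B(e, f) t.
  set c : ℂ := 2 / (α t * B e f) with hc
  refine ⟨⟨c • e, Submodule.smul_mem _ _ he0⟩, (2 / α t) • t, Submodule.smul_mem _ _ he, ?_, ?_⟩
  · simp [hαt]
  · refine ⟨?_, ?_, ?_, ?_⟩
    · intro h0
      have h1 : (2 / α t) • t = 0 := Subtype.ext h0
      have h2 := congrArg α h1
      simp [hαt] at h2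
    · apply Subtype.ext
      rw [coe_even_lie]
      change bracket (c • e) f = (2 / α t) • ((t : EvenPart g) : g)
      rw [bracket_smul_left, hef', smul_smul]
      congr 1
      rw [hc]; field_simp
    · apply Subtype.ext
      rw [coe_even_lie]
      have h1 := (Submodule.smul_mem (rootSpace h α) c he) ((2 / α t) • t)
      change bracket _ (c • e) = (2 : ℕ) • (c • e)
      rw [h1]
      simp [hαt, two_smul]
    · apply Subtype.ext
      rw [coe_even_lie]
      have h1 := hf ((2 / α t) • t)
      change bracket _ f = -((2 : ℕ) • f)
      rw [h1]
      simp [hαt, two_smul]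

/-- A vector of nonzero natural weight in a finite-dimensional `sl₂`-module which is killed by `f`
vanishes. -/
lemma eq_zero_of_lie_f_eq_zero {L M : Type*} [LieRing L] [LieAlgebra ℂ L] [AddCommGroup M]
    [Module ℂ M] [LieRingModule L M] [LieModule ℂ L M] [FiniteDimensional ℂ M] {H e f : L}
    (hs : IsSl2Triple H e f) {m : M} {n : ℕ} (hn : n ≠ 0) (hm : ⁅H, m⁆ = (n : ℂ) • m)
    (hf : ⁅f, m⁆ = 0) : m = 0 := by
  by_contra hne
  -- For the triple with e and f exchanged, m is a primitive vector of weight -n. Weights of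
  -- primitive vectors in finite dimension are natural numbers.
  have hp : hs.symm.HasPrimitiveVectorWith m (-(n : ℂ)) :=
    ⟨hne, by rw [neg_lie, hm, neg_smul], hf⟩
  obtain ⟨k, hk⟩ := hp.exists_nat
  have h1 : ((k + n : ℕ) : ℂ) = 0 := by push_cast; rw [← hk]; ring
  have h2 : k + n = 0 := by exact_mod_cast h1
  omega

/-- Twice an even root is not an even root. -/
lemma eq_zero_of_mem_rootSpace_add_self (hg : IsBasic g) {α : Module.Dual ℂ h} (hα : α ≠ 0)
    {e : g} (he : e ∈ rootSpace h α) (he0 : e ∈ part 0) (hne : e ≠ 0) {y : g}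
    (hy : y ∈ rootSpace h (α + α)) (hy0 : y ∈ part 0) : y = 0 := by
  have := hg.finite
  obtain ⟨B, hB⟩ := hg.exists_form
  obtain ⟨f, hf, hf0, hef⟩ := hB.exists_apply_ne_zero (iSup_rootSpace_eq_top hg h) he he0 hne
  have hfne : f ≠ 0 := by rintro rfl; simp at hef
  obtain ⟨e', H, -, hH, hs⟩ := exists_sl2 hg hα hf hf0 hfne
  obtain ⟨t, ht⟩ := hB.exists_coroot hg ⟨0, e, he, he0, hne⟩
  have hx : bracket f y ∈ rootSpace h α := by
    have := bracket_mem_rootSpace hf hy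
    rwa [neg_add_cancel_left] at this
  have hx0 : bracket f y ∈ part 0 := by simpa using bracket_mem hf0 hy0
  have hff : bracket f f = 0 := by
    have h1 := congrArg Subtype.val (lie_self (⟨f, hf0⟩ : EvenPart g))
    rwa [coe_even_lie] at h1
  -- Since [f, f] = 0, the vector [f, y] is orthogonal to f, and so [f, [f, y]], a multiple of the
  -- coroot by this pairing, vanishes. Then [f, y] has sl₂-weight 2 and is killed by f, so it is 0;
  -- the same argument in weight 4 gives y = 0.
  have hBf : B (bracket f y) f = 0 := by
    rw [skew_even hy0, map_neg, LinearMap.neg_apply, hB.inv, hff, map_zero, neg_zero]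
  have h1 : bracket f (bracket f y) = 0 := by
    rw [skew_even hx0, ht 0 _ hx f hf hx0 hf0, hBf, zero_smul, neg_zero]
  have h2 : bracket f y = 0 := by
    refine eq_zero_of_lie_f_eq_zero (n := 2) hs (by norm_num) ?_ h1
    rw [even_lie_def, hx H, hH]
    norm_num
  refine eq_zero_of_lie_f_eq_zero (n := 4) hs (by norm_num) ?_ h2
  rw [even_lie_def, hy H, LinearMap.add_apply, hH]
  norm_num

lemma eq_zero_of_eq_neg {V : Type*} [AddCommGroup V] [Module ℂ V] {x : V} (hx : x = -x) :
    x = 0 := by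
  have h2 : (2 : ℂ) • x = 0 := by
    rw [two_smul]
    nth_rewrite 1 [hx]
    exact neg_add_cancel x
  simpa using h2

/-- An even root is not an odd root. -/
lemma eq_zero_of_mem_rootSpace_of_odd (hg : IsBasic g) {α : Module.Dual ℂ h} (hα : α ≠ 0)
    {e : g} (he : e ∈ rootSpace h α) (he0 : e ∈ part 0) (hne : e ≠ 0) {y : g}
    (hy : y ∈ rootSpace h α) (hy1 : y ∈ part 1) : y = 0 := by
  have := hg.finite
  have h11 : (1 : ZMod 2) + 1 = 0 := by decide
  obtain ⟨B, hB⟩ := hg.exists_form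
  have htop := iSup_rootSpace_eq_top hg h
  by_contra hyne
  obtain ⟨f, hf, hf0, hef⟩ := hB.exists_apply_ne_zero htop he he0 hne
  obtain ⟨y', hy', hy'1, hyy⟩ := hB.exists_apply_ne_zero htop hy hy1 hyne
  obtain ⟨t, ht⟩ := hB.exists_coroot hg ⟨0, e, he, he0, hne⟩
  have hαt := hB.apply_coroot_ne_zero hg hα he hf he0 (ht 0 e he f hf he0 hf0) hef
  -- The square [y, y] is even of weight 2α, hence 0. The Jacobi identity then gives [y, [y, y']] =
  -- -[y, [y, y']], so this vector vanishes; but it equals -B(y, y') α(t) y, where every factor is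
  -- nonzero.
  have hsq : bracket y y = 0 := eq_zero_of_mem_rootSpace_add_self hg hα he he0 hne
    (bracket_mem_rootSpace hy hy) (h11 ▸ bracket_mem hy1 hy1)
  have h1 := jacobi hy1 hy1 hy'1
  rw [hsq, map_zero, LinearMap.zero_apply, zero_add, superSign_one_one, neg_one_smul,
    ht 1 y hy y' hy' hy1 hy'1, map_smul, skew_even t.1.2, hy t] at h1
  replace h1 := eq_zero_of_eq_neg h1
  simp only [smul_neg, neg_eq_zero, smul_eq_zero] at h1
  rcases h1 with h1 | h1 | h1
  · exact hyy h1
  · exact hαt h1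
  · exact hyne h1

/-- The weight `0` does not occur in the odd part of a basic Lie superalgebra. -/
lemma eq_zero_of_mem_rootSpace_zero_of_odd (hg : IsBasic g) {x : g} (hx : x ∈ rootSpace h 0)
    (hx1 : x ∈ part 1) : x = 0 := by
  have h11 : (1 : ZMod 2) + 1 = 0 := by decide
  obtain ⟨B, hB⟩ := hg.exists_form
  have htop := iSup_rootSpace_eq_top hg h
  have hev : ∀ w ∈ part (g := g) 0, bracket w x = 0 := by
    have key : ∀ w : g, bracket (evenProj w) x = 0 := by
      intro w
      have hw : w ∈ ⨆ χ, rootSpace h χ := htop ▸ trivial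
      induction hw using Submodule.iSup_induction' with
      | zero => simp
      | add a b _ _ ha hb => rw [map_add, bracket_add_left, ha, hb, add_zero]
      | mem α w hw =>
        have hw0 := (evenProj_mem_rootSpace hw).1
        by_cases hne : evenProj w = 0
        · rw [hne]; simp
        by_cases hα : α = 0
        · subst hα
          obtain ⟨H, hH⟩ := mem_cartan_of_mem_rootSpace_zero h hw0 (evenProj_mem w)
          rw [← hH, hx H]
          simp
        -- The bracket of x with an even root vector of weight α is odd of weight α, and an even
        -- root is never an odd root.
        · refine eq_zero_of_mem_rootSpace_of_odd hg hα hw0 (evenProj_mem w) hne ?_ ?_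
          · simpa using bracket_mem_rootSpace hw0 hx
          · simpa using bracket_mem (evenProj_mem w) hx1
    intro w hw
    rw [← evenProj_of_mem_zero hw]
    exact key w
  have hodd : ∀ w ∈ part (g := g) 1, bracket w x = 0 := by
    intro w hw
    -- The bracket is even, so it suffices to pair it with even z, where invariance moves the
    -- bracket to [x, z] = 0.
    have h0 : bracket w x ∈ part (g := g) 0 := h11 ▸ bracket_mem hw hx1
    apply hB.nondeg
    intro z
    rw [← evenProj_add_oddProj z, map_add, hB.even _ _ h0 (oddProj_mem z), add_zero, hB.inv,
      skew_even (evenProj_mem z), hev _ (evenProj_mem z), neg_zero, map_zero]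
  have hall : ∀ w, bracket w x = 0 := by
    intro w
    rw [← evenProj_add_oddProj w, bracket_add_left, hev _ (evenProj_mem w),
      hodd _ (oddProj_mem w), add_zero]
  rcases eq_zero_or_top_of_central hg.simple hx1 hall with h0 | h0
  · exact h0
  · apply hB.nondeg
    intro z
    have hz : z ∈ Submodule.span ℂ {x} := h0 ▸ trivial
    obtain ⟨c, rfl⟩ := Submodule.mem_span_singleton.1 hz
    -- Here g would be spanned by x; the form is skew on odd elements, so B(x, x) = 0 and the form
    -- would be degenerate.
    have h2 := hB.symm 1 1 x x hx1 hx1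
    rw [superSign_one_one, neg_one_mul, self_eq_neg] at h2
    rw [map_smul, h2, smul_zero]

/-- The triangular decomposition. -/
lemma exists_triangular (hg : IsBasic g) (ord : CompatibleOrder (rootSpan h)) (x : g) :
    ∃ a ∈ nMinus ord, ∃ H : h, ∃ b ∈ nPlus ord, a + ((H : EvenPart g) : g) + b = x := by
  have hx : x ∈ ⨆ χ, rootSpace h χ := iSup_rootSpace_eq_top hg h ▸ trivial
  induction hx using Submodule.iSup_induction' with
  | zero => exact ⟨0, zero_mem _, 0, 0, zero_mem _, by simp⟩
  | add u v _ _ hu hv =>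
    obtain ⟨a, ha, H, b, hb, rfl⟩ := hu
    obtain ⟨a', ha', H', b', hb', rfl⟩ := hv
    refine ⟨a + a', add_mem ha ha', H + H', b + b', add_mem hb hb', ?_⟩
    change _ + (((H : EvenPart g) : g) + ((H' : EvenPart g) : g)) + _ = _
    abel
  | mem α x hx =>
    by_cases hα : α = 0
    · subst hα
      have h1 := eq_zero_of_mem_rootSpace_zero_of_odd hg (evenProj_mem_rootSpace hx).2
        (oddProj_mem x)
      have h2 := evenProj_add_oddProj x
      rw [h1, add_zero] at h2
      obtain ⟨H, hH⟩ := mem_cartan_of_mem_rootSpace_zero h hx (h2 ▸ evenProj_mem x)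
      exact ⟨0, zero_mem _, H, 0, zero_mem _, by simp [hH]⟩
    · by_cases hx0 : x = 0
      · exact ⟨0, zero_mem _, 0, 0, zero_mem _, by simp [hx0]⟩
      have hroot : α ∈ roots h := ⟨hα, fun hbot => hx0 (by
        rwa [hbot, Submodule.mem_bot] at hx)⟩
      have := ord.total
      rcases trichotomous_of ord.lt ⟨α, Submodule.subset_span hroot⟩ 0 with hlt | heq | hgt
      · refine ⟨x, ?_, 0, 0, zero_mem _, by simp⟩
        exact Submodule.mem_iSup_of_mem α (Submodule.mem_iSup_of_mem ⟨hroot, hlt⟩ hx)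
      · exact absurd (congrArg Subtype.val heq) hα
      · refine ⟨0, zero_mem _, 0, x, ?_, by simp⟩
        exact Submodule.mem_iSup_of_mem α (Submodule.mem_iSup_of_mem ⟨hroot, hgt⟩ hx)

end Form

/-! ### Ordered monomials -/

section OrderedMonomial

variable {A : Type*} [Ring A] {N : ℕ}

/-- The ordered monomial `F_N^{a_N} ⋯ F_1^{a_1}`. -/
def orderedMonomial (F : Fin N → A) (a : Fin N → ℕ) : A :=
  ((List.finRange N).reverse.map fun i => F i ^ a i).prod

/-- The word with exponent `a` whose letters are in decreasing order. -/
def descWord (a : Fin N → ℕ) : List (Fin N) :=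
  (List.finRange N).reverse.flatMap fun i => List.replicate (a i) i

lemma orderedMonomial_eq_prod (F : Fin N → A) (a : Fin N → ℕ) :
    orderedMonomial F a = ((descWord a).map F).prod := by
  unfold orderedMonomial descWord
  induction (List.finRange N).reverse with
  | nil => simp
  | cons i l ih => simp [ih]

lemma count_descWord (a : Fin N → ℕ) (i : Fin N) : (descWord a).count i = a i := by
  unfold descWord
  rw [List.count_flatMap]
  have h1 : ((List.finRange N).reverse.map
      (List.count i ∘ fun j => List.replicate (a j) j)).sum = ∑ j, if j = i then a j else 0 := by
    rw [← List.sum_reverse, List.map_reverse, List.reverse_reverse, ← List.ofFn_eq_map,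
      List.sum_ofFn]
    refine Finset.sum_congr rfl fun j _ => ?_
    simp [List.count_replicate]
  rw [h1]
  simp

lemma length_descWord (a : Fin N → ℕ) : (descWord a).length = ∑ i, a i := by
  unfold descWord
  rw [List.length_flatMap, ← List.sum_reverse, List.map_reverse, List.reverse_reverse,
    ← List.ofFn_eq_map, List.sum_ofFn]
  simp

lemma perm_descWord (w : List (Fin N)) : w.Perm (descWord fun i => w.count i) := by
  rw [List.perm_iff_count]
  intro i
  rw [count_descWord]

variable [Algebra ℂ A]

/-- The span of the words of length at most `k`. -/
def wordSpan (F : Fin N → A) (k : ℕ) : Submodule ℂ A :=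
  Submodule.span ℂ {u | ∃ w : List (Fin N), w.length ≤ k ∧ u = (w.map F).prod}

lemma prod_mem_wordSpan (F : Fin N → A) {w : List (Fin N)} {k : ℕ} (hw : w.length ≤ k) :
    (w.map F).prod ∈ wordSpan F k :=
  Submodule.subset_span ⟨w, hw, rfl⟩

lemma mul_mem_wordSpan (F : Fin N → A) {k : ℕ} (i : Fin N) {u : A} (hu : u ∈ wordSpan F k) :
    F i * u ∈ wordSpan F (k + 1) := by
  induction hu using Submodule.span_induction with
  | mem u hu =>
    obtain ⟨w, hw, rfl⟩ := hu
    rw [← List.prod_cons, ← List.map_cons]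
    exact prod_mem_wordSpan F (by simpa using hw)
  | zero => simp
  | add a b _ _ ha hb => rw [mul_add]; exact add_mem ha hb
  | smul c a _ ha => rw [mul_smul_comm]; exact Submodule.smul_mem _ _ ha

lemma span_mul_prod_mem_wordSpan (F : Fin N → A) {w : List (Fin N)} {x : A}
    (hx : x ∈ Submodule.span ℂ (Set.range F)) : x * (w.map F).prod ∈ wordSpan F (w.length + 1) := by
  induction hx using Submodule.span_induction with
  | mem x hx =>
    obtain ⟨i, rfl⟩ := hx
    exact mul_mem_wordSpan F i (prod_mem_wordSpan F le_rfl)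
  | zero => simp
  | add a b _ _ ha hb => rw [add_mul]; exact add_mem ha hb
  | smul c a _ ha => rw [smul_mul_assoc]; exact Submodule.smul_mem _ _ ha

/-- Permuting the letters of a word changes the product by a scalar, up to shorter words. -/
lemma exists_smul_sub_mem_wordSpan {F : Fin N → A}
    (hcomm : ∀ i j, ∃ c : ℂ, F i * F j - c • (F j * F i) ∈ Submodule.span ℂ (Set.range F))
    {w w' : List (Fin N)} (hw : w.Perm w') :
    ∃ c : ℂ, (w.map F).prod - c • (w'.map F).prod ∈ wordSpan F (w.length - 1) := by
  induction hw with
  | nil => exact ⟨1, by simp⟩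
  | @cons i l l' hl ih =>
    -- For a one-letter word the truncated bound `l.length - 1` of the induction hypothesis is 0
    -- instead of -1, so multiplication by the letter would overshoot; this case is settled
    -- directly.
    rcases l with _ | ⟨j, l⟩
    · obtain rfl : l' = [] := by simpa using hl
      exact ⟨1, by simp⟩
    · obtain ⟨c, hc⟩ := ih
      have h1 := mul_mem_wordSpan F i hc
      refine ⟨c, ?_⟩
      simp only [List.map_cons, List.prod_cons, List.length_cons, Nat.add_sub_cancel] at h1 ⊢
      rwa [mul_sub, mul_smul_comm] at h1
  | swap i j l =>
    obtain ⟨c, hc⟩ := hcomm j i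
    refine ⟨c, ?_⟩
    have h1 := span_mul_prod_mem_wordSpan F (w := l) hc
    simp only [List.map_cons, List.prod_cons, List.length_cons, Nat.add_sub_cancel]
    rwa [sub_mul, smul_mul_assoc, mul_assoc, mul_assoc] at h1
  | trans h1 h2 ih1 ih2 =>
    obtain ⟨c, hc⟩ := ih1
    obtain ⟨d, hd⟩ := ih2
    refine ⟨c * d, ?_⟩
    rw [← h1.length_eq] at hd
    have := add_mem hc (Submodule.smul_mem _ c hd)
    rwa [smul_sub, smul_smul, sub_add_sub_cancel] at this

/-- The ordered admissible monomials span the algebra generated by a finite family of elements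
which supercommute up to linear combinations of the family. -/
lemma adjoin_le_span_orderedMonomial {F : Fin N → A} {par : Fin N → ZMod 2}
    (hcomm : ∀ i j, ∃ c : ℂ, F i * F j - c • (F j * F i) ∈ Submodule.span ℂ (Set.range F))
    (hsq : ∀ i, par i = 1 → F i * F i ∈ Submodule.span ℂ (Set.range F)) :
    Subalgebra.toSubmodule (Algebra.adjoin ℂ (Set.range F)) ≤
      Submodule.span ℂ {u | ∃ a : Fin N → ℕ, (∀ i, par i = 1 → a i ≤ 1) ∧
        u = orderedMonomial F a} := by
  set Mon := Submodule.span ℂ {u | ∃ a : Fin N → ℕ, (∀ i, par i = 1 → a i ≤ 1) ∧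
        u = orderedMonomial F a} with hMon
  have key : ∀ k, wordSpan F k ≤ Mon := by
    have step : ∀ k, wordSpan F (k - 1) ≤ Mon → ∀ w : List (Fin N), w.length = k →
        (w.map F).prod ∈ Mon := by
      intro k hk w hw
      by_cases hadm : ∀ i, par i = 1 → w.count i ≤ 1
      · obtain ⟨c, hc⟩ := exists_smul_sub_mem_wordSpan hcomm (perm_descWord w)
        rw [hw] at hc
        rw [← orderedMonomial_eq_prod] at hc
        have h1 := Submodule.smul_mem Mon c (Submodule.subset_span ⟨_, hadm, rfl⟩ :
          orderedMonomial F (fun i => w.count i) ∈ Mon)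
        have := add_mem (hk hc) h1
        rwa [sub_add_cancel] at this
      -- An odd letter occurs twice: its two copies are moved to the front, up to shorter words, and
      -- their product is a combination of single letters, so the length drops.
      · push Not at hadm
        obtain ⟨i, hi, hcount⟩ := hadm
        have hperm : ∃ w', w.Perm (i :: i :: w') := by
          have h1 : i ∈ w := List.count_pos_iff.1 (by omega)
          have h2 := List.perm_cons_erase h1
          have h3 : i ∈ w.erase i := by
            apply List.count_pos_iff.1
            rw [List.count_erase_self]
            omega
          exact ⟨_, h2.trans (List.Perm.cons i (List.perm_cons_erase h3))⟩
        obtain ⟨w', hw'⟩ := hperm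
        obtain ⟨c, hc⟩ := exists_smul_sub_mem_wordSpan hcomm hw'
        rw [hw] at hc
        have hlen := hw'.length_eq
        rw [hw] at hlen
        simp only [List.length_cons] at hlen
        have h1 : ((i :: i :: w').map F).prod ∈ wordSpan F (k - 1) := by
          have := span_mul_prod_mem_wordSpan F (w := w') (hsq i hi)
          simp only [List.map_cons, List.prod_cons]
          rw [← mul_assoc, hlen]
          exact this
        have := add_mem hc (Submodule.smul_mem _ c h1)
        rw [sub_add_cancel] at this
        exact hk this
    intro k
    induction k with
    | zero =>
      refine Submodule.span_le.2 ?_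
      rintro _ ⟨w, hw, rfl⟩
      obtain rfl : w = [] := by simpa using hw
      refine Submodule.subset_span ⟨0, by simp, ?_⟩
      simp [orderedMonomial]
    | succ k ih =>
      refine Submodule.span_le.2 ?_
      rintro _ ⟨w, hw, rfl⟩
      rcases Nat.lt_or_ge w.length (k + 1) with h1 | h1
      · exact ih (prod_mem_wordSpan F (by omega))
      · exact step (k + 1) ih w (by omega)
  rw [Algebra.adjoin_eq_span, Submodule.span_le]
  intro u hu
  obtain ⟨l, hl, rfl⟩ := Submonoid.exists_list_of_mem_closure hu
  have : ∃ w : List (Fin N), l = w.map F := by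
    clear hu
    induction l with
    | nil => exact ⟨[], rfl⟩
    | cons a l ih =>
      obtain ⟨w, rfl⟩ := ih fun y hy => hl y (List.mem_cons_of_mem _ hy)
      obtain ⟨i, rfl⟩ := hl a List.mem_cons_self
      exact ⟨i :: w, rfl⟩
  obtain ⟨w, rfl⟩ := this
  exact key _ (prod_mem_wordSpan F le_rfl)

end OrderedMonomial

/-! ### Highest weight modules -/

section HighestWeight

variable {g : Type*} [AddCommGroup g] [Module ℂ g] [LieSuperalgebra g]
  {h : LieSubalgebra ℂ (EvenPart g)} (ord : CompatibleOrder (rootSpan h))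

lemma add_mem_negRoots {ord : CompatibleOrder (rootSpan h)} {α β : Module.Dual ℂ h}
    (hα : α ∈ negRoots ord) (hβ : β ∈ negRoots ord) (hne : rootSpace h (α + β) ≠ ⊥) :
    α + β ∈ negRoots ord := by
  obtain ⟨hα, hα'⟩ := hα
  obtain ⟨hβ, hβ'⟩ := hβ
  have := ord.total
  have h1 := ord.add _ _ ⟨β, Submodule.subset_span hβ⟩ hα'
  rw [zero_add] at h1
  have h2 : ord.lt (⟨α, Submodule.subset_span hα⟩ + ⟨β, Submodule.subset_span hβ⟩) 0 :=
    _root_.trans h1 hβ'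
  refine ⟨⟨?_, hne⟩, h2⟩
  intro h0
  have h3 : (⟨α, Submodule.subset_span hα⟩ + ⟨β, Submodule.subset_span hβ⟩ : rootSpan h) = 0 :=
    Subtype.ext h0
  rw [h3] at h2
  exact irrefl _ h2

lemma bracket_mem_nMinus {x y : g} (hx : x ∈ nMinus ord) (hy : y ∈ nMinus ord) :
    bracket x y ∈ nMinus ord := by
  have hmem : ∀ {α}, α ∈ negRoots ord → rootSpace h α ≤ nMinus ord := fun {α} hα =>
    le_iSup₂_of_le (f := fun α (_ : α ∈ negRoots ord) => rootSpace h α) α hα le_rfl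
  unfold nMinus at hx hy
  rw [iSup_subtype'] at hx hy
  induction hx using Submodule.iSup_induction' with
  | zero => simp
  | add a b _ _ ha hb => rw [bracket_add_left]; exact add_mem ha hb
  | mem α x hx =>
    induction hy using Submodule.iSup_induction' with
    | zero => simp
    | add a b _ _ ha hb => rw [map_add]; exact add_mem ha hb
    | mem β y hy =>
      have h1 := bracket_mem_rootSpace hx hy
      by_cases hbot : rootSpace h (α.1 + β.1) = ⊥
      · rw [hbot, Submodule.mem_bot] at h1
        rw [h1]
        exact zero_mem _
      · exact hmem (add_mem_negRoots α.2 β.2 hbot) h1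

/-- `parityAut` acts on g by x ↦ `evenProj x - oddProj x`; the lemma makes n⁺ stable under it. -/
lemma evenProj_sub_oddProj_mem_nPlus {x : g} (hx : x ∈ nPlus ord) :
    evenProj x - oddProj x ∈ nPlus ord := by
  unfold nPlus at hx
  rw [iSup_subtype'] at hx
  induction hx using Submodule.iSup_induction' with
  | zero => simp
  | add a b _ _ ha hb =>
    rw [map_add, map_add, add_sub_add_comm]
    exact add_mem ha hb
  | mem α x hx =>
    have := evenProj_mem_rootSpace hx
    exact le_iSup₂_of_le (f := fun α (_ : α ∈ posRoots ord) => rootSpace h α) α.1 α.2 le_rfl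
      (sub_mem this.1 this.2)

lemma UEA.ι_sq_of_odd {x : g} (hx : x ∈ part 1) :
    UEA.ι x * UEA.ι x = (2⁻¹ : ℂ) • UEA.ι (bracket x x) := by
  have h1 := UEA.ι_mul_ι hx hx
  rw [superSign_one_one, neg_one_smul] at h1
  have h2 : (2 : ℂ) • (UEA.ι x * UEA.ι x) = UEA.ι (bracket x x) := by
    rw [two_smul]
    nth_rewrite 1 [h1]
    abel
  rw [← h2, smul_smul]
  norm_num

variable {V : Type*} [AddCommGroup V] [Module ℂ V] [Module (UEA g) V]
  [IsScalarTower ℂ (UEA g) V]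

/-- A vector of weight `μ` killed by `n⁺`. -/
structure IsHighestWeightVector (μ : Module.Dual ℂ h) (v : V) : Prop where
  nPlus_smul : ∀ x ∈ nPlus ord, UEA.ι x • v = 0
  cartan_smul : ∀ H : h, UEA.ι ((H : EvenPart g) : g) • v = μ H • v

variable [h.IsCartanSubalgebra] {ord}

/-- A module generated by a highest weight vector is spanned by the ordered monomials in any
homogeneous spanning family of `n⁻`, applied to the highest weight vector. -/
lemma IsHighestWeightVector.mem_span (hg : IsBasic g) {μ : Module.Dual ℂ h} {v : V}
    (hv : IsHighestWeightVector ord μ v) {N : ℕ} {f : Fin N → g} {par : Fin N → ZMod 2}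
    (hspan : Submodule.span ℂ (Set.range f) = nMinus ord) (hpar : ∀ i, f i ∈ part (par i))
    (u : UEA g) :
    u • v ∈ Submodule.span ℂ {x | ∃ a : Fin N → ℕ, (∀ i, par i = 1 → a i ≤ 1) ∧
      x = orderedMonomial (fun i => UEA.ι (f i)) a • v} := by
  have hmem : ∀ x ∈ nMinus ord,
      UEA.ι x ∈ Submodule.span ℂ (Set.range fun i => UEA.ι (f i)) := by
    intro x hx
    rw [← hspan] at hx
    have := Submodule.mem_map_of_mem (f := UEA.ι) hx
    rw [Submodule.map_span, ← Set.range_comp] at this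
    exact this
  have hf : ∀ i, f i ∈ nMinus ord := fun i => hspan ▸ Submodule.subset_span ⟨i, rfl⟩
  have hA := adjoin_le_span_orderedMonomial (F := fun i => UEA.ι (f i)) (par := par)
    (fun i j => ⟨superSign ℂ (par i) (par j), by
      rw [UEA.ι_mul_ι (hpar i) (hpar j), add_sub_cancel_left]
      exact hmem _ (bracket_mem_nMinus ord (hf i) (hf j))⟩)
    (fun i hi => by
      rw [UEA.ι_sq_of_odd (hi ▸ hpar i)]
      exact Submodule.smul_mem _ _ (hmem _ (bracket_mem_nMinus ord (hf i) (hf i))))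
  set A := Algebra.adjoin ℂ (Set.range fun i => UEA.ι (f i)) with hAdef
  have hAmem : ∀ x ∈ nMinus ord, UEA.ι x ∈ A := fun x hx =>
    (Algebra.span_le_adjoin ℂ _) (hmem x hx)
  -- T is the orbit of v under the subalgebra generated by n⁻. It is all of U(g) v once it is shown
  -- to be stable under g.
  let T : Submodule ℂ V := (Subalgebra.toSubmodule A).map
    ((LinearMap.toSpanSingleton (UEA g) V v).restrictScalars ℂ)
  have hTA : ∀ a ∈ A, ∀ x ∈ T, a • x ∈ T := by
    rintro a ha _ ⟨b, hb, rfl⟩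
    exact ⟨a * b, A.mul_mem ha hb, by simp [mul_smul]⟩
  have hvT : v ∈ T := ⟨1, A.one_mem, by simp⟩
  -- Induction on the word, for all x simultaneously. The empty word uses the triangular
  -- decomposition. Otherwise x is moved past the first letter; both x and its bracket with that
  -- letter then act on a shorter word.
  have hstab : ∀ l : List (Fin N), ∀ x : g,
      UEA.ι x • (l.map fun i => UEA.ι (f i)).prod • v ∈ T := by
    intro l
    induction l with
    | nil =>
      intro x
      obtain ⟨a, ha, H, b, hb, rfl⟩ := exists_triangular hg ord x
      simp only [List.map_nil, List.prod_nil, one_smul, map_add, add_smul, hv.nPlus_smul b hb,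
        hv.cartan_smul H, add_zero]
      exact add_mem (hTA _ (hAmem a ha) _ hvT) (Submodule.smul_mem _ _ hvT)
    | cons i l ih =>
      have hhom : ∀ (j : ZMod 2) (x : g), x ∈ part j →
          UEA.ι x • ((i :: l).map fun i => UEA.ι (f i)).prod • v ∈ T := by
        intro j x hx
        rw [List.map_cons, List.prod_cons, mul_smul, ← mul_smul, UEA.ι_mul_ι hx (hpar i), add_smul,
          smul_assoc, mul_smul]
        exact add_mem (Submodule.smul_mem _ _ (hTA _ (hAmem _ (hf i)) _ (ih x))) (ih _)
      intro x
      rw [← evenProj_add_oddProj x, map_add, add_smul]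
      exact add_mem (hhom 0 _ (evenProj_mem x)) (hhom 1 _ (oddProj_mem x))
  have hstab' : ∀ x : g, ∀ y ∈ T, UEA.ι x • y ∈ T := by
    rintro x _ ⟨b, hb, rfl⟩
    rw [SetLike.mem_coe, Subalgebra.mem_toSubmodule, hAdef, ← Subalgebra.mem_toSubmodule,
      Algebra.adjoin_eq_span] at hb
    induction hb using Submodule.span_induction with
    | mem b hb =>
      obtain ⟨l, hl, rfl⟩ := Submonoid.exists_list_of_mem_closure hb
      have : ∃ w : List (Fin N), l = w.map fun i => UEA.ι (f i) := by
        clear hb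
        induction l with
        | nil => exact ⟨[], rfl⟩
        | cons a l ih =>
          obtain ⟨w, rfl⟩ := ih fun y hy => hl y (List.mem_cons_of_mem _ hy)
          obtain ⟨i, rfl⟩ := hl a List.mem_cons_self
          exact ⟨i :: w, rfl⟩
      obtain ⟨w, rfl⟩ := this
      exact hstab w x
    | zero => simp
    | add a b _ _ ha hb => rw [map_add, smul_add]; exact add_mem ha hb
    | smul c a _ ha =>
      rw [map_smul, smul_algebra_smul_comm]
      exact Submodule.smul_mem _ _ ha
  have huv : u • v ∈ T := by
    refine UEA.induction (T.comap ((LinearMap.toSpanSingleton (UEA g) V v).restrictScalars ℂ))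
      ?_ ?_ u
    · simpa using hvT
    · intro i x _ u hu
      have := hstab' x _ hu
      simpa [mul_smul] using this
  obtain ⟨a, ha, hau⟩ := huv
  have h1 : a ∈ _ := hA ha
  have hau : a • v = u • v := hau
  rw [← hau]
  have h2 := Submodule.mem_map_of_mem
    (f := (LinearMap.toSpanSingleton (UEA g) V v).restrictScalars ℂ) h1
  rw [Submodule.map_span] at h2
  refine Submodule.span_mono ?_ h2
  rintro _ ⟨_, ⟨b, hb, rfl⟩, rfl⟩
  exact ⟨b, hb, rfl⟩

end HighestWeight

/-! ### Local nilpotence of even negative root vectors on K(μ) -/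

section FiniteQuotient

variable {g : Type*} [AddCommGroup g] [Module ℂ g] [LieSuperalgebra g]
  {h : LieSubalgebra ℂ (EvenPart g)} {ord : CompatibleOrder (rootSpan h)}

/-- A module over `U(g)` is a module over the even part of `g`. -/
abbrev evenLieRingModule (V : Type*) [AddCommGroup V] [Module (UEA g) V] :
    LieRingModule (EvenPart g) V where
  bracket x m := UEA.ι x.1 • m
  add_lie x y m := by
    change UEA.ι (x.1 + y.1) • m = _
    rw [map_add, add_smul]
  lie_add x m n := smul_add _ _ _
  leibniz_lie x y m := by
    change UEA.ι x.1 • UEA.ι y.1 • m = UEA.ι (bracket x.1 y.1) • m + UEA.ι y.1 • UEA.ι x.1 • m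
    have h1 := UEA.ι_mul_ι x.2 y.2
    rw [superSign_zero_left, one_smul] at h1
    rw [← mul_smul, h1, add_smul, mul_smul, add_comm]

attribute [local instance] evenLieRingModule

lemma evenLieModule (V : Type*) [AddCommGroup V] [Module ℂ V] [Module (UEA g) V]
    [IsScalarTower ℂ (UEA g) V] : LieModule ℂ (EvenPart g) V where
  smul_lie c x m := by
    change UEA.ι (c • x.1) • m = c • UEA.ι x.1 • m
    rw [map_smul, smul_assoc]
  lie_smul c x m := smul_algebra_smul_comm _ _ _

lemma vermaIdeal_le_iff {μ : Module.Dual ℂ h} {L : Submodule (UEA g) (UEA g)} :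
    vermaIdeal ord μ ≤ L ↔
      IsHighestWeightVector ord μ (Submodule.Quotient.mk 1 : UEA g ⧸ L) := by
  have hmk : ∀ u : UEA g, u • (Submodule.Quotient.mk 1 : UEA g ⧸ L) = Submodule.Quotient.mk u :=
    fun u => by rw [← Submodule.Quotient.mk_smul, smul_eq_mul, mul_one]
  have hH : ∀ H : h, UEA.ι ((H : EvenPart g) : g) • (Submodule.Quotient.mk 1 : UEA g ⧸ L) -
      μ H • (Submodule.Quotient.mk 1 : UEA g ⧸ L) = Submodule.Quotient.mk
        (UEA.ι ((H : EvenPart g) : g) - algebraMap ℂ (UEA g) (μ H)) := by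
    intro H
    rw [hmk, ← Submodule.Quotient.mk_smul, ← Algebra.algebraMap_eq_smul_one,
      ← Submodule.Quotient.mk_sub]
  unfold vermaIdeal
  rw [Submodule.span_le]
  constructor
  · intro hL
    refine ⟨fun x hx => ?_, fun H => ?_⟩
    · rw [hmk, Submodule.Quotient.mk_eq_zero]
      exact hL (Or.inl ⟨x, hx, rfl⟩)
    · rw [← sub_eq_zero, hH, Submodule.Quotient.mk_eq_zero]
      exact hL (Or.inr ⟨H, rfl⟩)
  · rintro ⟨h1, h2⟩ _ (⟨x, hx, rfl⟩ | ⟨H, rfl⟩)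
    · rw [SetLike.mem_coe, ← Submodule.Quotient.mk_eq_zero, ← hmk, h1 x hx]
    · rw [SetLike.mem_coe, ← Submodule.Quotient.mk_eq_zero, ← hH, h2, sub_self]

lemma vermaIdeal_le_maxFinIdeal (μ : Module.Dual ℂ h) : vermaIdeal ord μ ≤ maxFinIdeal ord μ :=
  le_sInf fun _ hL => hL.1

variable [h.IsCartanSubalgebra]

/-- In a nonzero finite-dimensional quotient of the Verma module the highest weight vector is
primitive for an sl₂-triple through f. So μ(H) is a natural number n and f^(n+1) kills it. The
exponent depends on μ alone, so this power lies in the whole intersection. -/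
lemma exists_pow_mem_maxFinIdeal (hg : IsBasic g) (μ : Module.Dual ℂ h) {β : Module.Dual ℂ h}
    (hβ : β ∈ negRoots ord) {f : g} (hf : f ∈ rootSpace h β) (hf0 : f ∈ part 0) :
    ∃ n, UEA.ι f ^ n ∈ maxFinIdeal ord μ := by
  by_cases hfne : f = 0
  · exact ⟨1, by simp [hfne]⟩
  obtain ⟨hβ, hlt⟩ := hβ
  obtain ⟨e, H, he, hH, hs⟩ := exists_sl2 hg (α := -β) (neg_ne_zero.2 hβ.1)
    (by rwa [neg_neg]) hf0 hfne
  have hpos : -β ∈ posRoots ord := by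
    have hroot : -β ∈ roots h := ⟨neg_ne_zero.2 hβ.1, fun hbot => by
      rw [hbot, Submodule.mem_bot] at he
      exact hs.e_ne_zero (Subtype.ext he)⟩
    refine ⟨hroot, ?_⟩
    have h1 := ord.add _ _ ⟨-β, Submodule.subset_span hroot⟩ hlt
    have h2 : (⟨β, Submodule.subset_span hβ⟩ + ⟨-β, Submodule.subset_span hroot⟩ : rootSpan h) = 0 :=
      Subtype.ext (add_neg_cancel β)
    rwa [h2, zero_add] at h1
  -- The exponent has to be fixed before the quotient. When μ(H) is not a natural number, the value
  -- 0 is harmless because only the zero quotient is finite-dimensional.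
  have hn : ∃ n : ℕ, ∀ k : ℕ, μ H = k → n = k := by
    by_cases hk : ∃ k : ℕ, μ H = k
    · obtain ⟨k, hk⟩ := hk
      exact ⟨k, fun k' hk' => by exact_mod_cast hk.symm.trans hk'⟩
    · exact ⟨0, fun k hk' => absurd ⟨k, hk'⟩ hk⟩
  obtain ⟨n, hn⟩ := hn
  refine ⟨n + 1, ?_⟩
  unfold maxFinIdeal
  rw [Submodule.mem_sInf]
  rintro L ⟨hL, hfin⟩
  have hv := vermaIdeal_le_iff.1 hL
  have := evenLieModule (g := g) (UEA g ⧸ L)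
  by_cases hv0 : (Submodule.Quotient.mk 1 : UEA g ⧸ L) = 0
  · rw [Submodule.Quotient.mk_eq_zero] at hv0
    simpa using L.smul_mem (UEA.ι f ^ (n + 1)) hv0
  · have hp : hs.HasPrimitiveVectorWith (Submodule.Quotient.mk 1 : UEA g ⧸ L) (μ H) :=
      ⟨hv0, hv.cartan_smul H, hv.nPlus_smul _ (Submodule.mem_iSup_of_mem (-β)
        (Submodule.mem_iSup_of_mem hpos he))⟩
    obtain ⟨k, hk⟩ := hp.exists_nat
    have h1 := hp.pow_toEnd_f_eq_zero_of_eq_nat hk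
    obtain rfl := hn k hk
    have h2 : ∀ (m : ℕ) (x : UEA g ⧸ L),
        (LieModule.toEnd ℂ (EvenPart g) (UEA g ⧸ L) ⟨f, hf0⟩ ^ m) x = UEA.ι f ^ m • x := by
      intro m
      induction m with
      | zero => simp
      | succ m ih =>
        intro x
        rw [pow_succ', pow_succ', Module.End.mul_apply, ih, mul_smul]
        rfl
    rw [h2, ← Submodule.Quotient.mk_smul, Submodule.Quotient.mk_eq_zero] at h1
    simpa using h1

/-- ad f shifts weights by β ≠ 0, and only finitely many weights occur in g. -/
lemma exists_pow_bracket_eq_zero (hg : IsBasic g) {β : Module.Dual ℂ h}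
    (hβ : β ≠ 0) {f : g} (hf : f ∈ rootSpace h β) (hf0 : f ∈ part 0) :
    ∃ n, bracket (g := g) f ^ n = 0 := by
  have := hg.finite
  have h1 : (⟨f, hf0⟩ : EvenPart g) ∈ LieAlgebra.rootSpace h β := by
    apply LieModule.weightSpace_le_genWeightSpace
    rw [LieModule.mem_weightSpace]
    intro H
    exact Subtype.ext (hf H)
  have h2 := LieModule.isNilpotent_toEnd_of_mem_rootSpace (M := g) (H := h) (χ := β)
    (fun h0 => hβ (DFunLike.coe_injective h0)) h1
  exact h2

/-- Moving powers of f past elements of g costs iterated brackets with f, which vanish eventually.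
Hence nilpotence of f on a generator spreads to the whole cyclic module. -/
lemma exists_pow_mul_mem {f : g} (hf : f ∈ part 0) {k n : ℕ} (hk : bracket (g := g) f ^ k = 0)
    {L : Submodule (UEA g) (UEA g)} (hn : UEA.ι f ^ n ∈ L) (u : UEA g) :
    ∃ m, UEA.ι f ^ m * u ∈ L := by
  -- In f x u = x (f u) + [f, x] u the first term needs one power less to bring u into L, the second
  -- one bracket less to kill x. So the induction runs on j + n.
  have key : ∀ (s j n : ℕ), j + n = s → ∀ (x : g) (u : UEA g), (bracket (g := g) f ^ j) x = 0 →
      UEA.ι f ^ n * u ∈ L → UEA.ι f ^ (j + n) * (UEA.ι x * u) ∈ L := by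
    intro s
    induction s with
    | zero =>
      intro j n hjn x u hx _
      obtain rfl : j = 0 := by omega
      obtain rfl : n = 0 := by omega
      simp only [pow_zero, Module.End.one_apply] at hx
      simp [hx]
    | succ s ih =>
      intro j n hjn x u hx hu
      rcases j with _ | j
      · simp only [pow_zero, Module.End.one_apply] at hx
        simp [hx]
      rcases n with _ | n
      · rw [pow_zero, one_mul] at hu
        rw [← mul_assoc]
        exact L.smul_mem _ hu
      have h1 : UEA.ι f * (UEA.ι x * u) = UEA.ι x * (UEA.ι f * u) + UEA.ι (bracket f x) * u := by
        have hcomm : ∀ y : g, UEA.ι f * UEA.ι y = UEA.ι y * UEA.ι f + UEA.ι (bracket f y) := by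
          intro y
          have h0 := UEA.ι_mul_ι hf (evenProj_mem y)
          have h1 := UEA.ι_mul_ι hf (oddProj_mem y)
          simp only [superSign_zero_left, one_smul] at h0 h1
          rw [← evenProj_add_oddProj y]
          simp only [map_add, mul_add, add_mul, h0, h1]
          abel
        rw [← mul_assoc, hcomm, add_mul, mul_assoc]
      have h2 : j + 1 + (n + 1) = (j + 1 + n) + 1 := by ring
      have h3 : j + 1 + n = j + (n + 1) := by ring
      rw [h2, pow_succ, mul_assoc, h1, mul_add]
      refine add_mem (ih (j + 1) n (by omega) x _ hx ?_) ?_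
      · rwa [← mul_assoc, ← pow_succ]
      · rw [h3]
        refine ih j (n + 1) (by omega) _ u ?_ hu
        rwa [pow_succ] at hx
  let S : Submodule ℂ (UEA g) :=
    { carrier := {u | ∃ m, UEA.ι f ^ m * u ∈ L}
      zero_mem' := ⟨0, by simp⟩
      add_mem' := by
        rintro a b ⟨m, hm⟩ ⟨m', hm'⟩
        refine ⟨m + m', ?_⟩
        rw [mul_add]
        refine add_mem ?_ ?_
        · rw [add_comm, pow_add, mul_assoc]
          exact L.smul_mem _ hm
        · rw [pow_add, mul_assoc]
          exact L.smul_mem _ hm'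
      smul_mem' := by
        rintro c a ⟨m, hm⟩
        refine ⟨m, ?_⟩
        rw [mul_smul_comm]
        exact Submodule.smul_of_tower_mem L c hm }
  refine UEA.induction S ⟨n, by simpa using hn⟩ ?_ u
  rintro i x _ u ⟨m, hm⟩
  exact ⟨k + m, key _ k m rfl x u (by rw [hk]; rfl) hm⟩

/-- `n⁻` is spanned by finitely many homogeneous root vectors. -/
lemma exists_rootVectors (hg : IsBasic g) (ord : CompatibleOrder (rootSpan h)) :
    ∃ (N : ℕ) (f : Fin N → g) (par : Fin N → ZMod 2),
      Submodule.span ℂ (Set.range f) = nMinus ord ∧ (∀ i, f i ∈ part (par i)) ∧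
      ∀ i, ∃ β ∈ negRoots ord, f i ∈ rootSpace h β := by
  have := hg.finite
  -- The basis in a `Datum` is homogeneous only for the parity. The nilpotence arguments need weight
  -- vectors, so a spanning family of parity-homogeneous root vectors is extracted.
  set S : Set g := {x | ∃ β ∈ negRoots ord, x ∈ rootSpace h β ∧ ∃ i, x ∈ part i} with hS
  have hspan : Submodule.span ℂ S = nMinus ord := by
    apply le_antisymm
    · rw [Submodule.span_le]
      rintro x ⟨β, hβ, hx, -⟩
      exact Submodule.mem_iSup_of_mem β (Submodule.mem_iSup_of_mem hβ hx)
    · unfold nMinus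
      refine iSup₂_le fun β hβ x hx => ?_
      have h1 := evenProj_mem_rootSpace hx
      rw [← evenProj_add_oddProj x]
      exact add_mem (Submodule.subset_span ⟨β, hβ, h1.1, 0, evenProj_mem x⟩)
        (Submodule.subset_span ⟨β, hβ, h1.2, 1, oddProj_mem x⟩)
  obtain ⟨s, hs, hs'⟩ := (Submodule.fg_span_iff_fg_span_finset_subset S).1
    (IsNoetherian.noetherian (Submodule.span ℂ S))
  have hmem : ∀ i : Fin s.card, (s.equivFin.symm i : g) ∈ S := fun i => hs (s.equivFin.symm i).2
  choose β hβ using fun i => hmem i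
  refine ⟨s.card, fun i => s.equivFin.symm i, fun i => (hβ i).2.2.choose, ?_,
    fun i => (hβ i).2.2.choose_spec, fun i => ⟨β i, (hβ i).1, (hβ i).2.1⟩⟩
  rw [← hspan, hs']
  congr 1
  ext x
  simp only [Set.mem_range, SetLike.mem_coe]
  constructor
  · rintro ⟨i, rfl⟩
    exact (s.equivFin.symm i).2
  · intro hx
    exact ⟨s.equivFin ⟨x, hx⟩, by simp⟩

end FiniteQuotient

/-! ### Products of powers of locally nilpotent operators -/

section LocallyNilpotent

variable {V : Type*} [AddCommGroup V] [Module ℂ V]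

lemma exists_pow_eq_zero_of_fg {Y : Module.End ℂ V} (hY : ∀ x, ∃ m : ℕ, (Y ^ m) x = 0)
    {W : Submodule ℂ V} (hW : W.FG) : ∃ m : ℕ, ∀ x ∈ W, ∀ n, m ≤ n → (Y ^ n) x = 0 := by
  obtain ⟨s, rfl⟩ := hW
  choose m hm using hY
  refine ⟨s.sup m, fun x hx n hn => ?_⟩
  have hle : Submodule.span ℂ (s : Set V) ≤ LinearMap.ker (Y ^ n) := by
    rw [Submodule.span_le]
    intro y hy
    exact Module.End.pow_map_zero_of_le ((Finset.le_sup (f := m) hy).trans hn) (hm y)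
  exact hle hx

/-- The products of powers of finitely many endomorphisms, each of which is locally nilpotent or
occurs with finitely many exponents only, map a vector into a finite-dimensional subspace. -/
lemma fg_span_prod_pow {N : ℕ} {Y : Fin N → Module.End ℂ V} {P : Fin N → ℕ → Prop}
    (hY : ∀ i, (∀ x, ∃ m : ℕ, (Y i ^ m) x = 0) ∨ {n | P i n}.Finite) (v : V) (l : List (Fin N)) :
    (Submodule.span ℂ {x | ∃ a : Fin N → ℕ, (∀ i, P i (a i)) ∧
      x = (l.map fun i => Y i ^ a i).prod v}).FG := by
  induction l with
  | nil =>
    have : FiniteDimensional ℂ (Submodule.span ℂ {v}) := inferInstance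
    refine Submodule.FG.of_le (T := Submodule.span ℂ {v}) (Submodule.fg_span_singleton v) ?_
    refine Submodule.span_mono ?_
    rintro x ⟨a, -, rfl⟩
    simp
  | cons i l ih =>
    set W := Submodule.span ℂ {x | ∃ a : Fin N → ℕ, (∀ i, P i (a i)) ∧
      x = (l.map fun i => Y i ^ a i).prod v} with hW
    -- Only finitely many exponents of the new factor act nontrivially on the finite-dimensional
    -- space W, so the new span lies in a finite sum of images of W.
    obtain ⟨s, hs⟩ : ∃ s : Finset ℕ, ∀ n, P i n → ∀ x ∈ W, n ∉ s → (Y i ^ n) x = 0 := by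
      rcases hY i with h1 | h1
      · obtain ⟨m, hm⟩ := exists_pow_eq_zero_of_fg h1 ih
        refine ⟨Finset.range m, fun n _ x hx hn => hm x hx n ?_⟩
        simpa using hn
      · exact ⟨h1.toFinset, fun n hn x _ hn' => absurd (h1.mem_toFinset.2 hn) hn'⟩
    have hfg : (⨆ n ∈ s, W.map (Y i ^ n)).FG :=
      Submodule.fg_biSup s _ fun n _ => ih.map _
    refine Submodule.FG.of_le hfg ?_
    rw [Submodule.span_le]
    rintro x ⟨a, ha, rfl⟩
    have hmem : (l.map fun i => Y i ^ a i).prod v ∈ W := Submodule.subset_span ⟨a, ha, rfl⟩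
    rw [List.map_cons, List.prod_cons, Module.End.mul_apply]
    by_cases hn : a i ∈ s
    · exact Submodule.mem_iSup_of_mem (a i) (Submodule.mem_iSup_of_mem hn ⟨_, hmem, rfl⟩)
    · rw [hs _ (ha i) _ hmem hn]
      exact zero_mem _

end LocallyNilpotent

/-! ### Finite-dimensionality of K(μ) and nilpotence of the action of n⁻ -/

section FiniteQuotient

variable {g : Type*} [AddCommGroup g] [Module ℂ g] [LieSuperalgebra g]
  {h : LieSubalgebra ℂ (EvenPart g)} [h.IsCartanSubalgebra]

lemma isHighestWeightVector_maxFinQuot (ord : CompatibleOrder (rootSpan h))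
    (μ : Module.Dual ℂ h) :
    IsHighestWeightVector ord μ (Submodule.Quotient.mk 1 : MaxFinQuot ord μ) :=
  vermaIdeal_le_iff.1 (vermaIdeal_le_maxFinIdeal μ)

lemma smul_mk_one {L : Submodule (UEA g) (UEA g)} (u : UEA g) :
    u • (Submodule.Quotient.mk 1 : UEA g ⧸ L) = Submodule.Quotient.mk u := by
  rw [← Submodule.Quotient.mk_smul, smul_eq_mul, mul_one]

/-- The maximal finite-dimensional quotient of a Verma module is finite-dimensional. -/
lemma finiteDimensional_maxFinQuot (hg : IsBasic g) (ord : CompatibleOrder (rootSpan h))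
    (μ : Module.Dual ℂ h) : FiniteDimensional ℂ (MaxFinQuot ord μ) := by
  obtain ⟨N, f, par, hspan, hpar, hroot⟩ := exists_rootVectors hg ord
  have hv := isHighestWeightVector_maxFinQuot ord μ
  let Y : Fin N → Module.End ℂ (MaxFinQuot ord μ) := fun i =>
    Algebra.lsmul ℂ ℂ (MaxFinQuot ord μ) (UEA.ι (f i))
  -- Even root vectors are locally nilpotent on K(μ); odd ones occur with exponent at most 1.
  have hfg := fg_span_prod_pow (Y := Y) (P := fun i n => par i = 1 → n ≤ 1) (fun i => by
    rcases zmod_two_cases (par i) with hi | hi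
    · left
      intro x
      obtain ⟨u, rfl⟩ := Submodule.Quotient.mk_surjective _ x
      obtain ⟨β, hβ, hfβ⟩ := hroot i
      have hf0 : f i ∈ part 0 := hi ▸ hpar i
      obtain ⟨k, hk⟩ := exists_pow_bracket_eq_zero hg hβ.1.1 hfβ hf0
      obtain ⟨n, hn⟩ := exists_pow_mem_maxFinIdeal hg μ hβ hfβ hf0
      obtain ⟨m, hm⟩ := exists_pow_mul_mem hf0 hk hn u
      refine ⟨m, ?_⟩
      rw [← map_pow, Algebra.lsmul_coe]
      change UEA.ι (f i) ^ m • (Submodule.Quotient.mk u : MaxFinQuot ord μ) = 0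
      rw [← Submodule.Quotient.mk_smul, Submodule.Quotient.mk_eq_zero]
      exact hm
    · right
      exact (Set.finite_Iic 1).subset fun n hn => hn hi)
    (Submodule.Quotient.mk 1) (List.finRange N).reverse
  refine ⟨?_⟩
  refine Submodule.FG.of_le hfg ?_
  intro x _
  obtain ⟨u, rfl⟩ := Submodule.Quotient.mk_surjective _ x
  have h0 := hv.mem_span hg hspan hpar u
  rw [smul_mk_one] at h0
  refine Submodule.span_mono ?_ h0
  rintro _ ⟨a, ha, rfl⟩
  refine ⟨a, ha, ?_⟩
  have h1 : ((List.finRange N).reverse.map fun i => Y i ^ a i).prod =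
      Algebra.lsmul ℂ ℂ (MaxFinQuot ord μ) (orderedMonomial (fun i => UEA.ι (f i)) a) := by
    unfold orderedMonomial
    rw [map_list_prod, List.map_map]
    congr 1
    refine List.map_congr_left fun i _ => ?_
    simp [Y]
  rw [h1, Algebra.lsmul_coe]

attribute [local instance] evenLieRingModule

/-- The vectors of weight `χ` in a module. -/
def weightSubspace (h : LieSubalgebra ℂ (EvenPart g)) (V : Type*) [AddCommGroup V] [Module ℂ V]
    [Module (UEA g) V] [IsScalarTower ℂ (UEA g) V] (χ : Module.Dual ℂ h) : Submodule ℂ V where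
  carrier := {x | ∀ H : h, UEA.ι ((H : EvenPart g) : g) • x = χ H • x}
  add_mem' hx hy H := by rw [smul_add, hx H, hy H, smul_add]
  zero_mem' H := by simp
  smul_mem' c x hx H := by rw [smul_algebra_smul_comm, hx H, smul_comm]

variable {V : Type*} [AddCommGroup V] [Module ℂ V] [Module (UEA g) V]
  [IsScalarTower ℂ (UEA g) V]

lemma finite_weightSubspace_ne_bot [FiniteDimensional ℂ V] :
    {χ : Module.Dual ℂ h | weightSubspace h V χ ≠ ⊥}.Finite := by
  have := evenLieModule (g := g) V
  have h1 := LieModule.finite_genWeightSpace_ne_bot ℂ h V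
  refine Set.Finite.of_finite_image (f := fun χ : Module.Dual ℂ h => (χ : h → ℂ))
    (h1.subset ?_) (DFunLike.coe_injective.injOn)
  rintro _ ⟨χ, hχ, rfl⟩
  obtain ⟨x, hx, hx0⟩ := Submodule.exists_mem_ne_zero_of_ne_bot hχ
  intro hbot
  apply hx0
  have h2 : x ∈ LieModule.genWeightSpace V (χ : h → ℂ) := by
    apply LieModule.weightSpace_le_genWeightSpace
    rw [LieModule.mem_weightSpace]
    exact hx
  rwa [hbot, LieSubmodule.mem_bot] at h2

lemma smul_mem_weightSubspace {χ β : Module.Dual ℂ h} {x : g} {y : V} (hx : x ∈ rootSpace h β)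
    (hy : y ∈ weightSubspace h V χ) : UEA.ι x • y ∈ weightSubspace h V (χ + β) := by
  intro H
  have hcomm : ∀ z : g, UEA.ι ((H : EvenPart g) : g) * UEA.ι z =
      UEA.ι z * UEA.ι ((H : EvenPart g) : g) + UEA.ι (bracket ((H : EvenPart g) : g) z) := by
    intro z
    have h0 := UEA.ι_mul_ι H.1.2 (evenProj_mem z)
    have h1 := UEA.ι_mul_ι H.1.2 (oddProj_mem z)
    simp only [superSign_zero_left, one_smul] at h0 h1
    rw [← evenProj_add_oddProj z]
    simp only [map_add, mul_add, add_mul, h0, h1]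
    abel
  rw [← mul_smul, hcomm, add_smul, mul_smul, hy H, hx H, map_smul, smul_assoc,
    smul_algebra_smul_comm, LinearMap.add_apply, add_smul]

/-- `n⁻` acts nilpotently on a finite-dimensional highest weight module. -/
lemma IsHighestWeightVector.exists_prod_smul_eq_zero [FiniteDimensional ℂ V] (hg : IsBasic g)
    {ord : CompatibleOrder (rootSpan h)} {μ : Module.Dual ℂ h} {v : V}
    (hv : IsHighestWeightVector ord μ v) (hgen : ∀ x : V, ∃ u : UEA g, u • v = x) :
    ∃ M : ℕ, ∀ l : List g, (∀ x ∈ l, x ∈ nMinus ord) → M ≤ l.length →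
      ∀ x : V, (l.map UEA.ι).prod • x = 0 := by
  classical
  have := ord.total
  let K : rootSpan h → Submodule ℂ V := fun δ => weightSubspace h V (μ + δ)
  have hfin : {δ : rootSpan h | K δ ≠ ⊥}.Finite := by
    refine Set.Finite.of_finite_image (f := fun δ : rootSpan h => μ + (δ : Module.Dual ℂ h))
      ((finite_weightSubspace_ne_bot (h := h) (V := V)).subset ?_) ?_
    · rintro _ ⟨δ, hδ, rfl⟩
      exact hδ
    · intro a _ b _ hab
      exact Subtype.ext (add_left_cancel hab)
  let Ω : Finset (rootSpan h) := hfin.toFinset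
  -- Elements of n⁻ are sums of vectors of different weights, so weights are replaced by a numerical
  -- filtration: `cnt δ` is the number of occurring weights that are at most δ. A negative root
  -- strictly lowers an occurring weight, hence also this number.
  let cnt : rootSpan h → ℕ := fun δ => (Ω.filter fun δ' => δ' = δ ∨ ord.lt δ' δ).card
  let Fil : ℕ → Submodule ℂ V := fun n => ⨆ (δ : rootSpan h) (_ : cnt δ ≤ n), K δ
  have hshift : ∀ (β : Module.Dual ℂ h) (hβ : β ∈ negRoots ord) (x : g), x ∈ rootSpace h β →
      ∀ (δ : rootSpan h) (y : V), y ∈ K δ →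
        UEA.ι x • y ∈ K (δ + ⟨β, Submodule.subset_span hβ.1⟩) := by
    intro β hβ x hx δ y hy
    have := smul_mem_weightSubspace hx hy
    rwa [add_assoc] at this
  have hlt : ∀ (β : Module.Dual ℂ h) (hβ : β ∈ negRoots ord) (δ : rootSpan h),
      ord.lt (δ + ⟨β, Submodule.subset_span hβ.1⟩) δ := by
    intro β hβ δ
    have := ord.add _ _ δ hβ.2
    rwa [zero_add, add_comm] at this
  have htop : ⨆ δ, K δ = ⊤ := by
    obtain ⟨N, f, par, hspan, hpar, hroot⟩ := exists_rootVectors hg ord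
    rw [eq_top_iff]
    intro x _
    obtain ⟨u, rfl⟩ := hgen x
    have h1 := hv.mem_span hg hspan hpar u
    refine (Submodule.span_le.2 ?_) h1
    rintro _ ⟨a, -, rfl⟩
    rw [orderedMonomial_eq_prod]
    induction descWord a with
    | nil =>
      refine Submodule.mem_iSup_of_mem 0 ?_
      simp only [List.map_nil, List.prod_nil, one_smul]
      intro H
      simpa using hv.cartan_smul H
    | cons i l ih =>
      rw [List.map_cons, List.prod_cons, mul_smul]
      obtain ⟨β, hβ, hfβ⟩ := hroot i
      replace ih : (l.map fun i => UEA.ι (f i)).prod • v ∈ ⨆ δ, K δ := ih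
      generalize (l.map fun i => UEA.ι (f i)).prod • v = y at ih
      induction ih using Submodule.iSup_induction' with
      | zero => rw [smul_zero]; exact zero_mem _
      | add a b _ _ ha hb => rw [smul_add]; exact add_mem ha hb
      | mem δ y hy => exact Submodule.mem_iSup_of_mem _ (hshift β hβ _ hfβ δ y hy)
  have hFil0 : Fil 0 = ⊥ := by
    rw [eq_bot_iff]
    refine iSup₂_le fun δ hδ => ?_
    by_contra hne
    -- A weight that occurs counts itself, so its number is positive.
    have hmem : δ ∈ Ω.filter fun δ' => δ' = δ ∨ ord.lt δ' δ := by
      rw [Finset.mem_filter, Set.Finite.mem_toFinset]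
      exact ⟨fun hbot => hne (hbot ▸ le_rfl), Or.inl rfl⟩
    have := Finset.card_pos.2 ⟨δ, hmem⟩
    exact absurd hδ (by simpa [cnt] using this.ne')
  have hFilstep : ∀ n, ∀ x ∈ nMinus ord, ∀ y ∈ Fil (n + 1), UEA.ι x • y ∈ Fil n := by
    intro n x hx y hy
    unfold nMinus at hx
    rw [iSup_subtype'] at hx
    induction hx using Submodule.iSup_induction' with
    | zero => rw [map_zero, zero_smul]; exact zero_mem _
    | add a b _ _ ha hb => rw [map_add, add_smul]; exact add_mem ha hb
    | mem β x hx =>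
      have hy' : y ∈ ⨆ δ : {δ : rootSpan h // cnt δ ≤ n + 1}, K δ := by
        rw [iSup_subtype]; exact hy
      induction hy' using Submodule.iSup_induction' with
      | zero => rw [smul_zero]; exact zero_mem _
      | add a b ha' hb' ha hb =>
        rw [smul_add]
        refine add_mem (ha ?_) (hb ?_)
        · rw [iSup_subtype] at ha'; exact ha'
        · rw [iSup_subtype] at hb'; exact hb'
      | mem δ y hyδ =>
        have h1 := hshift β β.2 x hx δ y hyδ
        by_cases hy0 : y = 0
        · rw [hy0, smul_zero]; exact zero_mem _
        refine Submodule.mem_iSup_of_mem _ (Submodule.mem_iSup_of_mem ?_ h1)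
        -- The set of weights below the shifted weight loses at least δ itself.
        have hss : (Ω.filter fun δ' => δ' = δ.1 + ⟨β.1, Submodule.subset_span β.2.1⟩ ∨
            ord.lt δ' (δ.1 + ⟨β.1, Submodule.subset_span β.2.1⟩)) ⊂
            Ω.filter fun δ' => δ' = δ.1 ∨ ord.lt δ' δ.1 := by
          rw [Finset.ssubset_iff_of_subset]
          · refine ⟨δ.1, ?_, ?_⟩
            · rw [Finset.mem_filter, Set.Finite.mem_toFinset]
              refine ⟨fun hbot => hy0 ?_, Or.inl rfl⟩
              rwa [hbot, Submodule.mem_bot] at hyδ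
            · simp only [Finset.mem_filter, not_and, not_or]
              intro _
              have h2 := hlt β β.2 δ.1
              refine ⟨fun heq => ?_, fun h3 => ?_⟩
              · rw [← heq] at h2
                exact irrefl _ h2
              · exact irrefl _ (_root_.trans h2 h3)
          · intro δ' hδ'
            simp only [Finset.mem_filter] at hδ' ⊢
            refine ⟨hδ'.1, Or.inr ?_⟩
            rcases hδ'.2 with rfl | h3
            · exact hlt β β.2 δ.1
            · exact _root_.trans h3 (hlt β β.2 δ.1)
        have h4 := Finset.card_lt_card hss
        have h5 : cnt δ.1 ≤ n + 1 := δ.2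
        change cnt (δ.1 + ⟨β.1, Submodule.subset_span β.2.1⟩) ≤ n
        change cnt (δ.1 + ⟨β.1, Submodule.subset_span β.2.1⟩) < cnt δ.1 at h4
        omega
  have hFiltop : ∀ x : V, x ∈ Fil Ω.card := by
    intro x
    have hx : x ∈ ⨆ δ, K δ := htop ▸ trivial
    refine (iSup_le fun δ => ?_ : ⨆ δ, K δ ≤ Fil Ω.card) hx
    exact le_iSup₂_of_le (f := fun δ (_ : cnt δ ≤ Ω.card) => K δ) δ (Finset.card_filter_le _ _)
      le_rfl
  have hprod : ∀ l : List g, (∀ x ∈ l, x ∈ nMinus ord) → ∀ n, ∀ y ∈ Fil (n + l.length),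
      (l.map UEA.ι).prod • y ∈ Fil n := by
    intro l
    induction l with
    | nil => intro _ n y hy; simpa using hy
    | cons x l ih =>
      intro hl n y hy
      rw [List.map_cons, List.prod_cons, mul_smul]
      refine hFilstep n x (hl x List.mem_cons_self) _ ?_
      refine ih (fun z hz => hl z (List.mem_cons_of_mem _ hz)) (n + 1) y ?_
      rwa [List.length_cons, ← add_assoc, add_right_comm] at hy
  have hmono : ∀ {m n : ℕ}, m ≤ n → Fil m ≤ Fil n := fun {m n} hmn =>
    iSup₂_le fun δ hδ =>
      le_iSup₂_of_le (f := fun δ (_ : cnt δ ≤ n) => K δ) δ (hδ.trans hmn) le_rfl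
  refine ⟨Ω.card, fun l hl hlen x => ?_⟩
  have h1 := hprod l hl 0 x (by rw [zero_add]; exact hmono hlen (hFiltop x))
  rwa [hFil0, Submodule.mem_bot] at h1

end FiniteQuotient

/-! ### Essential monomials -/

section Essential

variable {g : Type*} [AddCommGroup g] [Module ℂ g] [LieSuperalgebra g] (D : Datum g)

namespace Datum

/-- Multi-exponents with the chosen total order. -/
def OrdExp : Type := D.Exp

instance : LinearOrder D.OrdExp :=
  have h1 : IsStrictTotalOrder D.OrdExp D.mono.lt := D.mono.total
  have h2 : DecidableRel (D.mono.lt : D.OrdExp → D.OrdExp → Prop) := Classical.decRel _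
  @linearOrderOfSTO D.OrdExp D.mono.lt h1 h2

/-- The identity map to the ordered exponents. -/
def toOrd (a : D.Exp) : D.OrdExp := a

variable {D}

lemma toOrd_lt {a b : D.Exp} : D.toOrd a < D.toOrd b ↔ D.mono.lt a b := Iff.rfl

lemma toOrd_add_lt {a b : D.Exp} (c : D.Exp) (hab : D.toOrd a < D.toOrd b) :
    D.toOrd (a + c) < D.toOrd (b + c) := D.mono.add a b c hab

lemma toOrd_add_lt_left {a b : D.Exp} (c : D.Exp) (hab : D.toOrd a < D.toOrd b) :
    D.toOrd (c + a) < D.toOrd (c + b) := by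
  rw [add_comm c, add_comm c]
  exact toOrd_add_lt c hab

lemma monomial_eq_orderedMonomial (a : D.Exp) :
    D.monomial a = orderedMonomial (fun i => UEA.ι (D.f i : g)) a := rfl

lemma mk_eq_smul_hwv (k : ℕ) (u : UEA g) : (Submodule.Quotient.mk u : D.K k) = u • D.hwv k :=
  (smul_mk_one u).symm

lemma smul_hwv_eq_zero {k : ℕ} {u : UEA g} :
    u • D.hwv k = 0 ↔ u ∈ maxFinIdeal D.ord (k • D.weight) := by
  rw [← mk_eq_smul_hwv, Submodule.Quotient.mk_eq_zero]

lemma finiteDimensional_K (hg : IsBasic g) (k : ℕ) : FiniteDimensional ℂ (D.K k) :=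
  have := D.cartan
  finiteDimensional_maxFinQuot hg D.ord _

lemma span_range_f : Submodule.span ℂ (Set.range fun i => (D.f i : g)) = nMinus D.ord := by
  have h1 := congrArg (Submodule.map (nMinus D.ord).subtype) D.f.span_eq
  rw [Submodule.map_span, Submodule.map_top, Submodule.range_subtype, ← Set.range_comp] at h1
  exact h1

lemma span_monomial_smul_hwv (hg : IsBasic g) (k : ℕ) :
    Submodule.span ℂ {x | ∃ a, D.Admissible a ∧ x = D.monomial a • D.hwv k} = ⊤ := by
  have := D.cartan
  rw [eq_top_iff]
  intro x _
  obtain ⟨u, rfl⟩ := Submodule.Quotient.mk_surjective _ x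
  rw [mk_eq_smul_hwv]
  exact (isHighestWeightVector_maxFinQuot D.ord (k • D.weight)).mem_span hg span_range_f D.f_mem u

/-- f^a is a product of ∑ aᵢ elements of n⁻, and long products of these vanish on K(kλ). This
finiteness does the work of a well-order on exponents, which is not available. -/
lemma finite_monomial_smul_hwv_ne_zero (hg : IsBasic g) (k : ℕ) :
    {a : D.Exp | D.monomial a • D.hwv k ≠ 0}.Finite := by
  have := D.cartan
  have := finiteDimensional_K (D := D) hg k
  obtain ⟨M, hM⟩ := (isHighestWeightVector_maxFinQuot D.ord
    (k • D.weight)).exists_prod_smul_eq_zero hg (fun x => by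
      obtain ⟨u, rfl⟩ := Submodule.Quotient.mk_surjective _ x
      exact ⟨u, smul_mk_one u⟩)
  refine (Set.finite_Iic (fun _ : Fin D.N => M)).subset fun a ha => ?_
  by_contra hle
  apply ha
  rw [monomial_eq_orderedMonomial, orderedMonomial_eq_prod]
  have h1 := hM ((descWord a).map fun i => (D.f i : g)) (fun x hx => by
    obtain ⟨i, -, rfl⟩ := List.mem_map.1 hx
    exact (D.f i).2) (by
    rw [List.length_map, length_descWord]
    obtain ⟨i, hi⟩ : ∃ i, M < a i := by
      simpa [Pi.le_def] using hle
    exact hi.le.trans (Finset.single_le_sum (fun _ _ => Nat.zero_le _) (Finset.mem_univ i)))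
    (D.hwv k)
  rwa [List.map_map] at h1

lemma IsEssential.ne_zero {k : ℕ} {a : D.Exp} (ha : D.IsEssential k a) :
    D.monomial a • D.hwv k ≠ 0 := fun h0 => ha.2 (h0 ▸ zero_mem _)

lemma finite_essential (hg : IsBasic g) (k : ℕ) : {a : D.Exp | D.IsEssential k a}.Finite :=
  (finite_monomial_smul_hwv_ne_zero hg k).subset fun _ ha => ha.ne_zero

/-- Admissible monomials are combinations of essential monomials which are not larger. -/
lemma monomial_mem_span_essential (hg : IsBasic g) (k : ℕ) {c : D.Exp} (hc : D.Admissible c) :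
    D.monomial c • D.hwv k ∈ Submodule.span ℂ {x | ∃ a, D.IsEssential k a ∧
      D.toOrd a ≤ D.toOrd c ∧ x = D.monomial a • D.hwv k} := by
  classical
  set T := (finite_monomial_smul_hwv_ne_zero (D := D) hg k).toFinset with hT
  -- The induction runs on the number of smaller exponents b with f^b v ≠ 0, which is finite.
  have key : ∀ (n : ℕ) (c : D.Exp), D.Admissible c →
      (T.filter fun b => D.toOrd b < D.toOrd c).card = n →
      D.monomial c • D.hwv k ∈ Submodule.span ℂ {x | ∃ a, D.IsEssential k a ∧
        D.toOrd a ≤ D.toOrd c ∧ x = D.monomial a • D.hwv k} := by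
    intro n
    induction n using Nat.strong_induction_on with
    | _ n ih =>
      intro c hc hn
      by_cases hess : D.IsEssential k c
      · exact Submodule.subset_span ⟨c, hess, le_rfl, rfl⟩
      · have h1 : D.monomial c • D.hwv k ∈ Submodule.span ℂ
            {v | ∃ b, D.Admissible b ∧ D.mono.lt b c ∧ v = D.monomial b • D.hwv k} := by
          by_contra h2
          exact hess ⟨hc, h2⟩
        refine (Submodule.span_le.2 ?_) h1
        rintro _ ⟨b, hb, hbc, rfl⟩
        by_cases hb0 : D.monomial b • D.hwv k = 0
        · rw [hb0]; exact zero_mem _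
        have hbT : b ∈ T := by rw [hT, Set.Finite.mem_toFinset]; exact hb0
        have hlt : (T.filter fun b' => D.toOrd b' < D.toOrd b).card < n := by
          rw [← hn]
          apply Finset.card_lt_card
          rw [Finset.ssubset_iff_of_subset]
          · exact ⟨b, Finset.mem_filter.2 ⟨hbT, hbc⟩, fun h3 =>
              lt_irrefl _ (Finset.mem_filter.1 h3).2⟩
          · intro b' hb'
            rw [Finset.mem_filter] at hb' ⊢
            exact ⟨hb'.1, hb'.2.trans hbc⟩
        refine Submodule.span_mono ?_ (ih _ hlt b hb rfl)
        rintro _ ⟨a, ha, hab, rfl⟩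
        exact ⟨a, ha, hab.trans (le_of_lt hbc), rfl⟩
  exact key _ c hc rfl

/-- In a linear relation the term of largest exponent would lie in the span of smaller ones,
contrary to essentiality. -/
lemma linearIndependent_essential (k : ℕ) :
    LinearIndependent ℂ fun a : {a : D.Exp // D.IsEssential k a} =>
      D.monomial a.1 • D.hwv k := by
  classical
  rw [linearIndependent_iff']
  intro s c hsum
  by_contra! hne
  obtain ⟨i, hi, hci⟩ := hne
  obtain ⟨m, hm, hmax⟩ := Finset.exists_max_image (s.filter fun i => c i ≠ 0)
    (fun i => D.toOrd i.1) ⟨i, Finset.mem_filter.2 ⟨hi, hci⟩⟩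
  rw [Finset.mem_filter] at hm
  apply m.2.2
  rw [← Finset.add_sum_erase s _ hm.1] at hsum
  have h1 : D.monomial m.1 • D.hwv k =
      -((c m)⁻¹ • ∑ x ∈ s.erase m, c x • D.monomial x.1 • D.hwv k) := by
    rw [eq_neg_iff_add_eq_zero, ← smul_right_injective _ hm.2 |>.eq_iff, smul_add, smul_smul,
      mul_inv_cancel₀ hm.2, one_smul, hsum, smul_zero]
  rw [h1]
  refine neg_mem (Submodule.smul_mem _ _ (Submodule.sum_mem _ fun x hx => ?_))
  by_cases hcx : c x = 0
  · rw [hcx, zero_smul]; exact zero_mem _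
  rw [Finset.mem_erase] at hx
  refine Submodule.smul_mem _ _ (Submodule.subset_span ⟨x.1, x.2.1, ?_, rfl⟩)
  have h2 := hmax x (Finset.mem_filter.2 ⟨hx.2, hcx⟩)
  exact lt_of_le_of_ne h2 fun h3 => hx.1 (Subtype.ext h3)

/-- The basis of `K(kλ)` of essential vectors. -/
def essentialBasis (hg : IsBasic g) (k : ℕ) :
    Module.Basis {a : D.Exp // D.IsEssential k a} ℂ (D.K k) :=
  Module.Basis.mk (linearIndependent_essential k) (by
    rw [← span_monomial_smul_hwv hg k, Submodule.span_le]
    rintro _ ⟨a, ha, rfl⟩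
    refine Submodule.span_mono ?_ (monomial_mem_span_essential hg k ha)
    rintro _ ⟨b, hb, -, rfl⟩
    exact ⟨⟨b, hb⟩, rfl⟩)

lemma essentialBasis_apply (hg : IsBasic g) (k : ℕ) (a : {a : D.Exp // D.IsEssential k a}) :
    essentialBasis hg k a = D.monomial a.1 • D.hwv k := by
  simp [essentialBasis]

variable (D) in
/-- The functionals on `U(g)` which come from `K(kλ)`. -/
def sections (k : ℕ) : Submodule ℂ (SuperDual g) := LinearMap.range (D.pull k)

lemma eval_pull (k : ℕ) (η : Module.Dual ℂ (D.K k)) (u : UEA g) :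
    SuperDual.eval u (D.pull k η) = η (u • D.hwv k) := by
  rw [← mk_eq_smul_hwv]
  rfl

lemma mem_sections_iff {k : ℕ} {φ : SuperDual g} :
    φ ∈ D.sections k ↔ ∀ u ∈ maxFinIdeal D.ord (k • D.weight), SuperDual.eval u φ = 0 := by
  constructor
  · rintro ⟨η, rfl⟩ u hu
    rw [eval_pull, smul_hwv_eq_zero.2 hu, map_zero]
  · intro hφ
    let L := (maxFinIdeal D.ord (k • D.weight)).restrictScalars ℂ
    let φ' : Module.Dual ℂ (UEA g) := φ
    let η : (UEA g ⧸ L) →ₗ[ℂ] ℂ := L.liftQ φ' fun u hu => LinearMap.mem_ker.2 (hφ u hu)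
    let e : D.K k →ₗ[ℂ] UEA g ⧸ L :=
      (Submodule.Quotient.restrictScalarsEquiv ℂ (maxFinIdeal D.ord (k • D.weight))).symm.toLinearMap
    exact ⟨η ∘ₗ e, rfl⟩

/-- A functional on `K(kλ)` is determined by its values on essential vectors. -/
lemma eq_zero_of_mem_sections (hg : IsBasic g) {k : ℕ} {φ : SuperDual g} (hφ : φ ∈ D.sections k)
    (h0 : ∀ a, D.IsEssential k a → SuperDual.eval (D.monomial a) φ = 0) : φ = 0 := by
  obtain ⟨η, rfl⟩ := hφ
  have : η = 0 := by
    refine (essentialBasis hg k).ext fun a => ?_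
    rw [essentialBasis_apply, ← eval_pull, h0 a.1 a.2, LinearMap.zero_apply]
  rw [this, map_zero]

end Datum

/-! ### Parity and maximal finite-dimensional quotients -/

lemma finiteDimensional_quotient_of_ker_le {L : Submodule (UEA g) (UEA g)} {W : Type*}
    [AddCommGroup W] [Module ℂ W] [FiniteDimensional ℂ W] (φ : UEA g →ₗ[ℂ] W)
    (hφ : ∀ u, φ u = 0 → u ∈ L) : FiniteDimensional ℂ (UEA g ⧸ L) := by
  let ψ : (UEA g ⧸ LinearMap.ker φ) →ₗ[ℂ] UEA g ⧸ L :=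
    (LinearMap.ker φ).liftQ (L.mkQ.restrictScalars ℂ) fun u hu => by
      rw [LinearMap.mem_ker]
      exact (Submodule.Quotient.mk_eq_zero L).2 (hφ u hu)
  have : FiniteDimensional ℂ (UEA g ⧸ LinearMap.ker φ) :=
    FiniteDimensional.of_injective φ.quotKerEquivRange.toLinearMap φ.quotKerEquivRange.injective
  refine Module.Finite.of_surjective ψ fun x => ?_
  obtain ⟨u, rfl⟩ := Submodule.Quotient.mk_surjective _ x
  exact ⟨Submodule.Quotient.mk u, rfl⟩

variable {h : LieSubalgebra ℂ (EvenPart g)} {ord : CompatibleOrder (rootSpan h)}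

lemma parityAut_ι_eq (x : g) : parityAut (UEA.ι x) = UEA.ι (evenProj x - oddProj x) := by
  rw [parityAut, UEA.lift_ι]
  rfl

lemma vermaIdeal_le_of {μ : Module.Dual ℂ h} {L : Submodule (UEA g) (UEA g)}
    (h1 : ∀ x ∈ nPlus ord, UEA.ι x ∈ L)
    (h2 : ∀ H : h, UEA.ι ((H : EvenPart g) : g) - algebraMap ℂ (UEA g) (μ H) ∈ L) :
    vermaIdeal ord μ ≤ L := by
  unfold vermaIdeal
  rw [Submodule.span_le]
  rintro _ (⟨x, hx, rfl⟩ | ⟨H, rfl⟩)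
  · exact h1 x hx
  · exact h2 H

/-- The preimage under the parity automorphism of a left ideal of finite codimension containing the
Verma ideal is again of this kind, since n⁺ is parity-stable and h is even. So the intersection of
all of them is stable, and K(μ) is graded with an even highest weight vector. -/
lemma parityAut_mem_maxFinIdeal {μ : Module.Dual ℂ h} {u : UEA g}
    (hu : u ∈ maxFinIdeal ord μ) : parityAut u ∈ maxFinIdeal ord μ := by
  unfold maxFinIdeal at hu ⊢
  rw [Submodule.mem_sInf] at hu ⊢
  rintro L ⟨hL, hfin⟩
  let L' : Submodule (UEA g) (UEA g) :=
    { carrier := {u | parityAut u ∈ L}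
      add_mem' := fun ha hb => by
        rw [Set.mem_ofPred_eq, map_add]; exact add_mem ha hb
      zero_mem' := by rw [Set.mem_ofPred_eq, map_zero]; exact zero_mem _
      smul_mem' := fun c a ha => by
        rw [Set.mem_ofPred_eq, smul_eq_mul, map_mul]; exact L.smul_mem _ ha }
  refine hu L' ⟨vermaIdeal_le_of (fun x hx => ?_) fun H => ?_, ?_⟩
  · change parityAut (UEA.ι x) ∈ L
    rw [parityAut_ι_eq]
    exact hL (Submodule.subset_span (Or.inl ⟨_, evenProj_sub_oddProj_mem_nPlus ord hx, rfl⟩))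
  · change parityAut _ ∈ L
    rw [map_sub, AlgHom.commutes, parityAut_ι H.1.2, superSign_zero_left, one_smul]
    exact hL (Submodule.subset_span (Or.inr ⟨H, rfl⟩))
  · exact finiteDimensional_quotient_of_ker_le
      ((L.mkQ.restrictScalars ℂ) ∘ₗ parityAut.toLinearMap) fun u hu =>
        (Submodule.Quotient.mk_eq_zero L).1 hu

lemma parityPow_mem_maxFinIdeal {μ : Module.Dual ℂ h} (i : ZMod 2) {u : UEA g}
    (hu : u ∈ maxFinIdeal ord μ) : parityPow i u ∈ maxFinIdeal ord μ := by
  rcases zmod_two_cases i with rfl | rfl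
  · simpa [parityPow] using hu
  · simpa [parityPow] using parityAut_mem_maxFinIdeal hu

namespace Datum

variable {D}

lemma superSign_add (i j k : ZMod 2) :
    superSign ℂ (i + j) k = superSign ℂ i k * superSign ℂ j k := by
  rcases zmod_two_cases i with rfl | rfl <;> rcases zmod_two_cases j with rfl | rfl <;>
    rcases zmod_two_cases k with rfl | rfl <;> simp [superSign]

lemma superSign_sum {ι : Type*} (s : Finset ι) (f : ι → ZMod 2) (k : ZMod 2) :
    superSign ℂ (∑ i ∈ s, f i) k = ∏ i ∈ s, superSign ℂ (f i) k := by
  classical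
  induction s using Finset.induction_on with
  | empty => simp [superSign_zero_left]
  | insert i s hi ih => rw [Finset.sum_insert hi, Finset.prod_insert hi, superSign_add, ih]

lemma parityAut_monomial (a : D.Exp) :
    parityAut (D.monomial a) = superSign ℂ (D.expParity a) 1 • D.monomial a := by
  have h1 : superSign ℂ (D.expParity a) 1 =
      ((List.finRange D.N).reverse.map fun i => superSign ℂ (D.par i) 1 ^ a i).prod := by
    rw [expParity, superSign_sum, List.map_reverse, List.prod_reverse, ← List.ofFn_eq_map,
      List.prod_ofFn]
    refine Finset.prod_congr rfl fun i _ => ?_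
    induction a i with
    | zero => simp [superSign_zero_left]
    | succ n ih => rw [Nat.cast_succ, add_mul, one_mul, superSign_add, ih, pow_succ]
  rw [h1, monomial, map_list_prod, List.map_map]
  generalize (List.finRange D.N).reverse = l
  induction l with
  | nil => simp
  | cons i l ih =>
    simp only [List.map_cons, List.prod_cons, ih, Function.comp_apply, map_pow,
      parityAut_ι (D.f_mem i), smul_pow, smul_mul_smul_comm]

/-- The coordinate functional of f^a v, scaled by ∏ aᵢ!, has the required values. It is homogeneous
because each f^b v is a parity eigenvector, so the defect of homogeneity is a section vanishing on
all essential vectors. Hence `eta` is never its default value at essential exponents. -/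
lemma isDualVector_eta (hg : IsBasic g) {k : ℕ} {a : D.Exp} (ha : D.IsEssential k a) :
    D.IsDualVector k a (D.eta k a) := by
  classical
  have hex : ∃ η, D.IsDualVector k a η := by
    refine ⟨(∏ i, ((a i).factorial : ℂ)) • (essentialBasis hg k).coord ⟨a, ha⟩, ?_⟩
    have hval : ∀ b (hb : D.IsEssential k b),
        (essentialBasis hg k).coord ⟨a, ha⟩ (D.monomial b • D.hwv k) = if b = a then 1 else 0 := by
      intro b hb
      rw [← essentialBasis_apply hg k ⟨b, hb⟩, Module.Basis.coord_apply, Module.Basis.repr_self,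
        Finsupp.single_apply]
      simp
    constructor
    · set η := (∏ i, ((a i).factorial : ℂ)) • (essentialBasis hg k).coord ⟨a, ha⟩ with hη
      let ψ : SuperDual g := SuperDual.of
        ((D.pull k η : Module.Dual ℂ (UEA g)) ∘ₗ parityAut.toLinearMap) -
          superSign ℂ (D.expParity a) 1 • D.pull k η
      have hψ : ∀ u, SuperDual.eval u ψ = SuperDual.eval (parityAut u) (D.pull k η) -
          superSign ℂ (D.expParity a) 1 * SuperDual.eval u (D.pull k η) := by
        intro u
        rw [map_sub, map_smul]
        rfl
      have h0 : ψ = 0 := by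
        refine eq_zero_of_mem_sections (D := D) hg (k := k) ?_ ?_
        · rw [mem_sections_iff]
          intro u hu
          have h1 := mem_sections_iff.1 (⟨η, rfl⟩ : D.pull k η ∈ D.sections k)
          rw [hψ, h1 _ hu, h1 _ (parityAut_mem_maxFinIdeal hu), mul_zero, sub_zero]
        · intro b hb
          rw [hψ, parityAut_monomial, eval_pull, eval_pull, smul_assoc, map_smul, hη,
            LinearMap.smul_apply, hval b hb]
          split
          case isTrue hba => subst hba; simp
          case isFalse => simp
      intro u
      rw [← sub_eq_zero, ← hψ, h0, map_zero]
    · intro b hb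
      rw [map_smul, LinearMap.smul_apply, hval b hb]
      split
      case isTrue hba =>
        subst hba
        have : (∏ i, ((b i).factorial : ℂ)) ≠ 0 :=
          Finset.prod_ne_zero_iff.2 fun i _ => by exact_mod_cast (b i).factorial_ne_zero
        simp [this]
      case isFalse => simp
  unfold eta
  rw [dif_pos hex]
  exact hex.choose_spec

lemma eta_apply (hg : IsBasic g) {k : ℕ} {a : D.Exp} (ha : D.IsEssential k a) {b : D.Exp}
    (hb : D.IsEssential k b) : SuperDual.eval (D.monomial b) (D.pull k (D.eta k a)) =
      if b = a then ∏ i, ((b i).factorial : ℂ) else 0 := by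
  have h1 := (isDualVector_eta hg ha).2 b hb
  have h2 : (∏ i, ((b i).factorial : ℂ)) ≠ 0 :=
    Finset.prod_ne_zero_iff.2 fun i _ => by exact_mod_cast (b i).factorial_ne_zero
  rw [map_smul, smul_eq_mul, inv_mul_eq_iff_eq_mul₀ h2, ← eval_pull] at h1
  rw [h1]
  split <;> simp

end Datum

end Essential

section Cartan

variable {g : Type*} [AddCommGroup g] [Module ℂ g] [LieSuperalgebra g]

/-! ### Products of functionals on highest weight modules -/

section TensorKernel

variable {h : LieSubalgebra ℂ (EvenPart g)} {ord : CompatibleOrder (rootSpan h)}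

variable (ord) in
/-- The quotient map to `K(μ)`, over the complex numbers. -/
def maxFinMk (μ : Module.Dual ℂ h) :
    UEA g →ₗ[ℂ] UEA g ⧸ (maxFinIdeal ord μ).restrictScalars ℂ :=
  ((maxFinIdeal ord μ).restrictScalars ℂ).mkQ

lemma maxFinMk_eq_zero {μ : Module.Dual ℂ h} {u : UEA g} :
    maxFinMk ord μ u = 0 ↔ u ∈ maxFinIdeal ord μ := by
  rw [maxFinMk, Submodule.mkQ_apply, Submodule.Quotient.mk_eq_zero]
  rfl

lemma finiteDimensional_maxFinMk [h.IsCartanSubalgebra] (hg : IsBasic g) (μ : Module.Dual ℂ h) :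
    FiniteDimensional ℂ (UEA g ⧸ (maxFinIdeal ord μ).restrictScalars ℂ) :=
  have := finiteDimensional_maxFinQuot hg ord μ
  Module.Finite.equiv (Submodule.Quotient.restrictScalarsEquiv ℂ (maxFinIdeal ord μ)).symm

/-- An operator on `U(g)` preserving the kernel of `U(g) → K(μ)` descends to `K(μ)`. -/
lemma exists_descend {μ : Module.Dual ℂ h} (A : Module.End ℂ (UEA g))
    (hA : ∀ u ∈ maxFinIdeal ord μ, A u ∈ maxFinIdeal ord μ) :
    ∃ A' : Module.End ℂ (UEA g ⧸ (maxFinIdeal ord μ).restrictScalars ℂ),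
      maxFinMk ord μ ∘ₗ A = A' ∘ₗ maxFinMk ord μ :=
  ⟨Submodule.mapQ _ _ A hA, rfl⟩

lemma comul_ι (x : g) : comul (UEA.ι x) = UEA.ι x ⊗ₜ[ℂ] 1 + 1 ⊗ₜ[ℂ] UEA.ι x := by
  have hom : ∀ (i : ZMod 2) (y : g), y ∈ part i →
      comul (UEA.ι y) = UEA.ι y ⊗ₜ[ℂ] 1 + 1 ⊗ₜ[ℂ] UEA.ι y := by
    intro i y hy
    have h1 := comul_ι_mul hy 1
    have h2 : parityPow i (1 : UEA g) = 1 := by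
      rcases zmod_two_cases i with rfl | rfl <;> simp [parityPow]
    rw [mul_one, comul_one, TensorProduct.map_tmul, TensorProduct.map_tmul, h2] at h1
    simpa using h1
  rw [← evenProj_add_oddProj x, map_add, map_add, hom 0 _ (evenProj_mem x),
    hom 1 _ (oddProj_mem x), TensorProduct.add_tmul, TensorProduct.tmul_add]
  abel

/-- The `g`-map `K(μ + ν) → K(ν) ⊗ K(μ)` which sends `v` to `v ⊗ v`. -/
lemma map_comul_eq_zero [h.IsCartanSubalgebra] (hg : IsBasic g) {μ ν : Module.Dual ℂ h}
    {u : UEA g} (hu : u ∈ maxFinIdeal ord (μ + ν)) :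
    TensorProduct.map (maxFinMk ord ν) (maxFinMk ord μ) (comul u) = 0 := by
  set ϖ := TensorProduct.map (maxFinMk ord ν) (maxFinMk ord μ) with hϖ
  have := finiteDimensional_maxFinMk (ord := ord) hg μ
  have := finiteDimensional_maxFinMk (ord := ord) hg ν
  -- The kernel of ϖ is stable under A ⊗ B whenever A and B descend to the two quotients.
  have hdesc : ∀ A B : Module.End ℂ (UEA g),
      (∀ u ∈ maxFinIdeal ord ν, A u ∈ maxFinIdeal ord ν) →
      (∀ u ∈ maxFinIdeal ord μ, B u ∈ maxFinIdeal ord μ) →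
      ∀ t, ϖ t = 0 → ϖ (TensorProduct.map A B t) = 0 := by
    intro A B hA hB t ht
    obtain ⟨A', hA'⟩ := exists_descend A hA
    obtain ⟨B', hB'⟩ := exists_descend B hB
    rw [hϖ, ← LinearMap.comp_apply, ← TensorProduct.map_comp, hA', hB', TensorProduct.map_comp,
      LinearMap.comp_apply, ← hϖ, ht, map_zero]
  have hι : ∀ (i : ZMod 2) (x : g), x ∈ part i → ∀ u, ϖ (comul u) = 0 →
      ϖ (comul (UEA.ι x * u)) = 0 := by
    intro i x hx u hu
    rw [comul_ι_mul hx, map_add,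
      hdesc _ _ (fun v hv => (maxFinIdeal ord ν).smul_mem (UEA.ι x) hv) (fun v hv => hv) _ hu,
      hdesc _ _ (fun v hv => parityPow_mem_maxFinIdeal i hv)
        (fun v hv => (maxFinIdeal ord μ).smul_mem (UEA.ι x) hv) _ hu, add_zero]
  have hmul : ∀ c u : UEA g, ϖ (comul u) = 0 → ϖ (comul (c * u)) = 0 := by
    intro c
    refine UEA.induction
      { carrier := {c | ∀ u : UEA g, ϖ (comul u) = 0 → ϖ (comul (c * u)) = 0}
        add_mem' := fun {a b} ha hb u hu => by
          rw [add_mul, map_add, map_add, ha u hu, hb u hu, add_zero]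
        zero_mem' := fun u _ => by rw [zero_mul, map_zero, map_zero]
        smul_mem' := fun r a ha u hu => by
          rw [smul_mul_assoc, map_smul, map_smul, ha u hu, smul_zero] }
      (fun u hu => by rwa [one_mul]) (fun i x hx a ha u hu => ?_) c
    rw [mul_assoc]
    exact hι i x hx _ (ha u hu)
  -- L is the annihilator of v ⊗ v. It contains the Verma ideal of μ + ν and has finite codimension,
  -- as K(ν) ⊗ K(μ) is finite-dimensional, so it contains the intersection defining K(μ + ν).
  let L : Submodule (UEA g) (UEA g) :=
    { carrier := {u | ϖ (comul u) = 0}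
      add_mem' := fun {a b} ha hb => by
        change ϖ (comul (a + b)) = 0
        rw [map_add, map_add, ha, hb, add_zero]
      zero_mem' := by
        change ϖ (comul 0) = 0
        rw [map_zero, map_zero]
      smul_mem' := fun c u hu => hmul c u hu }
  have hL : vermaIdeal ord (μ + ν) ≤ L := by
    refine vermaIdeal_le_of (fun x hx => ?_) fun H => ?_
    · have h1 : ∀ κ : Module.Dual ℂ h, maxFinMk ord κ (UEA.ι x) = 0 := fun κ =>
        maxFinMk_eq_zero.2 (vermaIdeal_le_maxFinIdeal κ
          (Submodule.subset_span (Or.inl ⟨x, hx, rfl⟩)))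
      change ϖ (comul (UEA.ι x)) = 0
      rw [comul_ι, map_add, hϖ, TensorProduct.map_tmul, TensorProduct.map_tmul, h1, h1,
        TensorProduct.zero_tmul, TensorProduct.tmul_zero, add_zero]
    · have h1 : ∀ κ : Module.Dual ℂ h, maxFinMk ord κ
          (UEA.ι ((H : EvenPart g) : g) - algebraMap ℂ (UEA g) (κ H)) = 0 := fun κ =>
        maxFinMk_eq_zero.2 (vermaIdeal_le_maxFinIdeal κ
          (Submodule.subset_span (Or.inr ⟨H, rfl⟩)))
      have h2 : ∀ κ : Module.Dual ℂ h, maxFinMk ord κ (UEA.ι ((H : EvenPart g) : g)) =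
          κ H • maxFinMk ord κ 1 := fun κ => by
        have := h1 κ
        rwa [map_sub, Algebra.algebraMap_eq_smul_one, map_smul, sub_eq_zero] at this
      change ϖ (comul _) = 0
      rw [map_sub, comul_ι, Algebra.algebraMap_eq_smul_one, map_smul, comul_one, map_sub,
        map_smul, map_add, hϖ, TensorProduct.map_tmul, TensorProduct.map_tmul, h2, h2,
        TensorProduct.map_tmul, LinearMap.add_apply, add_smul, TensorProduct.tmul_smul,
        ← TensorProduct.smul_tmul']
      abel
  have hfin : FiniteDimensional ℂ (UEA g ⧸ L) :=
    finiteDimensional_quotient_of_ker_le (ϖ ∘ₗ comul) fun u hu => hu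
  have hmem : u ∈ sInf {L | vermaIdeal ord (μ + ν) ≤ L ∧ FiniteDimensional ℂ (UEA g ⧸ L)} := hu
  exact (Submodule.mem_sInf.1 hmem) L ⟨hL, hfin⟩

lemma eval_mul_eq_zero [h.IsCartanSubalgebra] (hg : IsBasic g) {μ ν : Module.Dual ℂ h}
    {φ ψ : SuperDual g} (hφ : ∀ u ∈ maxFinIdeal ord μ, SuperDual.eval u φ = 0)
    (hψ : ∀ u ∈ maxFinIdeal ord ν, SuperDual.eval u ψ = 0) {u : UEA g}
    (hu : u ∈ maxFinIdeal ord (μ + ν)) : SuperDual.eval u (φ * ψ) = 0 := by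
  let φ' : (UEA g ⧸ (maxFinIdeal ord μ).restrictScalars ℂ) →ₗ[ℂ] ℂ :=
    Submodule.liftQ _ (φ : Module.Dual ℂ (UEA g)) fun u hu => LinearMap.mem_ker.2 (hφ u hu)
  let ψ' : (UEA g ⧸ (maxFinIdeal ord ν).restrictScalars ℂ) →ₗ[ℂ] ℂ :=
    Submodule.liftQ _ (ψ : Module.Dual ℂ (UEA g)) fun u hu => LinearMap.mem_ker.2 (hψ u hu)
  have h1 : dualPair φ ψ = (LinearMap.mul' ℂ ℂ ∘ₗ TensorProduct.map ψ' φ') ∘ₗ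
      TensorProduct.map (maxFinMk ord ν) (maxFinMk ord μ) :=
    TensorProduct.ext' fun a b => rfl
  rw [SuperDual.eval_mul, h1, LinearMap.comp_apply, map_comul_eq_zero hg hu, map_zero]

/-- The trivial module is a finite-dimensional quotient of the Verma module of weight 0. This puts
the unit of R(λ) in degree 0. -/
lemma counit_eq_zero_of_mem {u : UEA g} (hu : u ∈ maxFinIdeal ord (0 : Module.Dual ℂ h)) :
    counit u = 0 := by
  let L : Submodule (UEA g) (UEA g) :=
    { carrier := {u | counit u = 0}
      add_mem' := fun {a b} ha hb => by
        change counit (a + b) = 0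
        rw [map_add, ha, hb, add_zero]
      zero_mem' := map_zero _
      smul_mem' := fun c u hu => by
        change counit (c * u) = 0
        rw [map_mul, hu, mul_zero] }
  have hι : ∀ x : g, counit (UEA.ι x) = 0 := fun x => by
    simpa using counit_ι_mul x (1 : UEA g)
  have hL : vermaIdeal ord (0 : Module.Dual ℂ h) ≤ L :=
    vermaIdeal_le_of (fun x _ => hι x) fun H => by
      change counit _ = 0
      rw [map_sub, hι, LinearMap.zero_apply, map_zero, map_zero, sub_zero]
  have hfin : FiniteDimensional ℂ (UEA g ⧸ L) :=
    finiteDimensional_quotient_of_ker_le counit.toLinearMap fun u hu => hu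
  have hmem : u ∈ sInf {L | vermaIdeal ord (0 : Module.Dual ℂ h) ≤ L ∧
    FiniteDimensional ℂ (UEA g ⧸ L)} := hu
  exact (Submodule.mem_sInf.1 hmem) L ⟨hL, hfin⟩

end TensorKernel

variable {D : Datum g}

namespace Datum

lemma mul_mem_sections (hg : IsBasic g) {m n : ℕ} {φ ψ : SuperDual g} (hφ : φ ∈ D.sections m)
    (hψ : ψ ∈ D.sections n) : φ * ψ ∈ D.sections (m + n) := by
  have := D.cartan
  rw [mem_sections_iff] at hφ hψ ⊢
  rw [add_smul]
  exact fun u hu => eval_mul_eq_zero hg hφ hψ hu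

lemma one_mem_sections : (1 : SuperDual g) ∈ D.sections 0 := by
  rw [mem_sections_iff, zero_smul]
  exact fun u hu => counit_eq_zero_of_mem hu

/-! ### The coproduct of ordered monomials -/

lemma prod_pow_add_single {M : Type*} [Monoid M] {N : ℕ} (x : Fin N → M) {p : Fin N → ℕ}
    {i : Fin N} (hp : ∀ j, i ≤ j → p j = 0) (s : ℕ) {l : List (Fin N)}
    (hl : l.Pairwise (· > ·)) (hi : i ∈ l) :
    (l.map fun j => x j ^ (p + Pi.single i s : Fin N → ℕ) j).prod =
      x i ^ s * (l.map fun j => x j ^ p j).prod := by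
  induction l with
  | nil => simp at hi
  | cons j l ih =>
    rw [List.pairwise_cons] at hl
    rw [List.map_cons, List.map_cons, List.prod_cons, List.prod_cons]
    by_cases hj : i = j
    · subst hj
      have h1 : (l.map fun j => x j ^ (p + Pi.single i s : Fin N → ℕ) j) =
          l.map fun j => x j ^ p j := by
        refine List.map_congr_left fun j hj => ?_
        have : j ≠ i := (hl.1 j hj).ne
        simp [Pi.single_eq_of_ne this]
      rw [h1]
      simp [hp i le_rfl]
    · have hi' : i ∈ l := (List.mem_cons.1 hi).resolve_left hj
      rw [ih hl.2 hi']
      have h1 := hp j (hl.1 i hi').le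
      simp [h1, Pi.single_eq_of_ne (Ne.symm hj)]

/-- The factors are written with decreasing indices, so a letter at or beyond all positions of the
support of p stands on the far left. -/
lemma monomial_add_single {p : D.Exp} {i : Fin D.N} (hp : ∀ j, i ≤ j → p j = 0) (s : ℕ) :
    D.monomial (p + Pi.single i s) = UEA.ι (D.f i : g) ^ s * D.monomial p := by
  refine prod_pow_add_single (fun j => UEA.ι (D.f j : g)) hp s ?_ (by simp)
  rw [List.pairwise_reverse]
  exact List.pairwise_lt_finRange D.N

lemma monomial_zero : D.monomial 0 = 1 := by
  simp [monomial]

/-- The operator of `f_i` on `U(g) ⊗ U(g)`. -/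
def tensorOp (D : Datum g) (i : Fin D.N) : Module.End ℂ (UEA g ⊗[ℂ] UEA g) :=
  TensorProduct.map (lmul (UEA.ι (D.f i : g))) LinearMap.id +
    TensorProduct.map (parityPow (D.par i)) (lmul (UEA.ι (D.f i : g)))

lemma comul_pow_mul (i : Fin D.N) (k : ℕ) (u : UEA g) :
    comul (UEA.ι (D.f i : g) ^ k * u) = (tensorOp D i ^ k) (comul u) := by
  induction k with
  | zero => simp
  | succ k ih =>
    rw [pow_succ', pow_succ', mul_assoc, comul_ι_mul (D.f_mem i), ih]
    rfl

lemma exists_parityPow_monomial (i : ZMod 2) (a : D.Exp) :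
    ∃ c : ℂ, c ≠ 0 ∧ parityPow i (D.monomial a) = c • D.monomial a := by
  rcases zmod_two_cases i with rfl | rfl
  · exact ⟨1, one_ne_zero, by simp [parityPow]⟩
  · refine ⟨superSign ℂ (D.expParity a) 1, ?_, ?_⟩
    · unfold superSign; split <;> simp
    · simpa [parityPow] using parityAut_monomial a

/-- Products `f^p ⊗ f^q` with `p + q = c` and `p ≠ b`. -/
def offSpan (D : Datum g) (c b : D.Exp) : Submodule ℂ (UEA g ⊗[ℂ] UEA g) :=
  Submodule.span ℂ {t | ∃ p q : D.Exp, p + q = c ∧ p ≠ b ∧ t = D.monomial p ⊗ₜ[ℂ] D.monomial q}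

/-- For even f_i the operators f_i ⊗ 1 and 1 ⊗ f_i commute, and the binomial theorem gives the
coefficient `k.choose r`. For odd f_i the exponent is at most 1, and the coefficients are 1 or the
nonzero parity scalar of f^p. -/
lemma tensorOp_pow_tmul {i : Fin D.N} {p q : D.Exp} (hp : ∀ j, i ≤ j → p j = 0)
    (hq : ∀ j, i ≤ j → q j = 0) {k : ℕ} (hk : D.par i = 1 → k ≤ 1) {r s : ℕ} (hrs : r + s = k) :
    ∃ γ : ℂ, γ ≠ 0 ∧ (tensorOp D i ^ k) (D.monomial p ⊗ₜ[ℂ] D.monomial q) -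
      γ • D.monomial (p + Pi.single i r) ⊗ₜ[ℂ] D.monomial (q + Pi.single i s) ∈
      Submodule.span ℂ {t | ∃ r' s' : ℕ, r' + s' = k ∧ r' ≠ r ∧
        t = D.monomial (p + Pi.single i r') ⊗ₜ[ℂ] D.monomial (q + Pi.single i s')} := by
  rcases zmod_two_cases (D.par i) with h0 | h1
  · set X : Module.End ℂ (UEA g ⊗[ℂ] UEA g) :=
      TensorProduct.map (lmul (UEA.ι (D.f i : g))) LinearMap.id with hX
    set Z : Module.End ℂ (UEA g ⊗[ℂ] UEA g) :=
      TensorProduct.map LinearMap.id (lmul (UEA.ι (D.f i : g))) with hZ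
    have hop : tensorOp D i = X + Z := by
      rw [tensorOp, h0]
      simp [hX, hZ, parityPow, Module.End.one_eq_id]
    have hcomm : Commute X Z := by
      change X ∘ₗ Z = Z ∘ₗ X
      rw [hX, hZ, ← TensorProduct.map_comp, ← TensorProduct.map_comp]
      rfl
    have hXZ : ∀ a b : ℕ, (X ^ a * Z ^ b) (D.monomial p ⊗ₜ[ℂ] D.monomial q) =
        D.monomial (p + Pi.single i a) ⊗ₜ[ℂ] D.monomial (q + Pi.single i b) := by
      intro a b
      rw [hX, hZ, TensorProduct.map_pow, TensorProduct.map_pow, monomial_add_single hp,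
        monomial_add_single hq]
      simp [Module.End.mul_apply, LinearMap.pow_mulLeft, ← Module.End.one_eq_id]
    refine ⟨(k.choose r : ℂ), ?_, ?_⟩
    · exact_mod_cast (Nat.choose_pos (by omega)).ne'
    · rw [hop, hcomm.add_pow, LinearMap.sum_apply]
      have hr : r ∈ Finset.range (k + 1) := Finset.mem_range.2 (by omega)
      rw [← Finset.add_sum_erase _ _ hr]
      have hterm : ∀ a b : ℕ, (X ^ a * Z ^ b * ((k.choose a : ℕ) : Module.End ℂ (UEA g ⊗[ℂ] UEA g)))
          (D.monomial p ⊗ₜ[ℂ] D.monomial q) = (k.choose a : ℂ) •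
          D.monomial (p + Pi.single i a) ⊗ₜ[ℂ] D.monomial (q + Pi.single i b) := by
        intro a b
        rw [← hXZ, (Nat.cast_commute _ _).symm.eq, Module.End.mul_apply, Module.End.natCast_apply,
          Nat.cast_smul_eq_nsmul]
      rw [hterm, show k - r = s by omega, add_sub_cancel_left]
      refine Submodule.sum_mem _ fun a ha => ?_
      rw [Finset.mem_erase, Finset.mem_range] at ha
      rw [hterm]
      exact Submodule.smul_mem _ _ (Submodule.subset_span ⟨a, k - a, by omega, ha.1, rfl⟩)
  · have hk1 := hk h1
    rcases Nat.le_one_iff_eq_zero_or_eq_one.1 hk1 with rfl | rfl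
    · obtain ⟨rfl, rfl⟩ : r = 0 ∧ s = 0 := by omega
      refine ⟨1, one_ne_zero, ?_⟩
      simp
    · obtain ⟨c, hc, hpar⟩ := exists_parityPow_monomial (D := D) (D.par i) p
      have hval : (tensorOp D i ^ 1) (D.monomial p ⊗ₜ[ℂ] D.monomial q) =
          D.monomial (p + Pi.single i 1) ⊗ₜ[ℂ] D.monomial (q + Pi.single i 0) +
          c • D.monomial (p + Pi.single i 0) ⊗ₜ[ℂ] D.monomial (q + Pi.single i 1) := by
        rw [monomial_add_single hp 1, monomial_add_single hp 0, monomial_add_single hq 0,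
          monomial_add_single hq 1, pow_one, tensorOp,
          LinearMap.add_apply, TensorProduct.map_tmul, TensorProduct.map_tmul, hpar,
          ← TensorProduct.smul_tmul']
        simp
      rw [hval]
      obtain ⟨rfl, rfl⟩ | ⟨rfl, rfl⟩ : (r = 0 ∧ s = 1) ∨ (r = 1 ∧ s = 0) := by omega
      · refine ⟨c, hc, ?_⟩
        rw [add_sub_cancel_right]
        exact Submodule.subset_span ⟨1, 0, rfl, one_ne_zero, rfl⟩
      · refine ⟨1, one_ne_zero, ?_⟩
        rw [one_smul, add_sub_cancel_left]
        exact Submodule.smul_mem _ _ (Submodule.subset_span ⟨0, 1, rfl, zero_ne_one, rfl⟩)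

/-- The support of c is exhausted from the lowest index upwards: the leftmost factor of f^c acts on
the coproduct of the remaining ones by `tensorOp_pow_tmul`, and nonzero coefficients multiply. As p
+ q = c is fixed, p ≠ b already separates a term from f^b ⊗ f^e. -/
lemma comul_monomial {c b e : D.Exp} (hc : D.Admissible c) (hbe : b + e = c) :
    ∃ γ : ℂ, γ ≠ 0 ∧ comul (D.monomial c) - γ • D.monomial b ⊗ₜ[ℂ] D.monomial e ∈
      offSpan D c b := by
  suffices key : ∀ (n : ℕ) (c b e : D.Exp), (∀ j : Fin D.N, n ≤ j → c j = 0) → D.Admissible c →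
      b + e = c → ∃ γ : ℂ, γ ≠ 0 ∧
        comul (D.monomial c) - γ • D.monomial b ⊗ₜ[ℂ] D.monomial e ∈ offSpan D c b from
    key D.N c b e (fun j hj => absurd j.2 hj.not_gt) hc hbe
  intro n
  induction n with
  | zero =>
    intro c b e h0 _ hbe
    have hc0 : c = 0 := funext fun j => h0 j (Nat.zero_le _)
    have hb0 : b = 0 ∧ e = 0 := by rwa [hc0, add_eq_zero] at hbe
    refine ⟨1, one_ne_zero, ?_⟩
    rw [hc0, hb0.1, hb0.2, monomial_zero, comul_one, one_smul, sub_self]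
    exact zero_mem _
  | succ n ih =>
    intro c b e h0 hc hbe
    by_cases hn : n < D.N
    · set i : Fin D.N := ⟨n, hn⟩ with hi
      have hsplit : ∀ a : D.Exp, a = Function.update a i 0 + Pi.single i (a i) := by
        intro a
        ext j
        by_cases hj : j = i
        · subst hj; simp
        · simp [Function.update_of_ne hj, Pi.single_eq_of_ne hj]
      have hsupp : ∀ a : D.Exp, a ≤ c → ∀ j, i ≤ j → Function.update a i 0 j = 0 := by
        intro a hac j hij
        by_cases hj : j = i
        · subst hj; simp
        · rw [Function.update_of_ne hj]
          have h1 : n + 1 ≤ (j : ℕ) := by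
            have h2 : (i : ℕ) < j := lt_of_le_of_ne hij fun h3 => hj (Fin.ext h3.symm)
            exact h2
          have h3 := hac j
          rw [h0 j h1] at h3
          exact Nat.le_zero.1 h3
      have hbc : b ≤ c := hbe ▸ le_self_add
      have hec : e ≤ c := hbe ▸ le_add_self
      have hbe' : Function.update b i 0 + Function.update e i 0 = Function.update c i 0 := by
        rw [← hbe]
        ext j
        by_cases hj : j = i
        · subst hj; simp
        · simp [Function.update_of_ne hj]
      obtain ⟨γ, hγ, hmem⟩ := ih (Function.update c i 0) (Function.update b i 0)
        (Function.update e i 0) (fun j hj => hsupp c le_rfl j hj) (fun j hj => by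
          by_cases hji : j = i
          · subst hji; simp
          · rw [Function.update_of_ne hji]; exact hc j hj) hbe'
      have hki : D.par i = 1 → c i ≤ 1 := hc i
      have hbei : b i + e i = c i := by rw [← hbe]; rfl
      obtain ⟨γ', hγ', hmem'⟩ := tensorOp_pow_tmul (hsupp b hbc) (hsupp e hec) hki hbei
      refine ⟨γ * γ', mul_ne_zero hγ hγ', ?_⟩
      rw [← hsplit b, ← hsplit e] at hmem'
      have hexp : comul (D.monomial c) =
          (tensorOp D i ^ c i) (comul (D.monomial (Function.update c i 0))) := by
        conv_lhs => rw [hsplit c, monomial_add_single (hsupp c le_rfl), comul_pow_mul]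
      have hdecomp : comul (D.monomial c) - (γ * γ') • D.monomial b ⊗ₜ[ℂ] D.monomial e =
          (tensorOp D i ^ c i) (comul (D.monomial (Function.update c i 0)) -
            γ • D.monomial (Function.update b i 0) ⊗ₜ[ℂ] D.monomial (Function.update e i 0)) +
          γ • ((tensorOp D i ^ c i) (D.monomial (Function.update b i 0) ⊗ₜ[ℂ]
            D.monomial (Function.update e i 0)) - γ' • D.monomial b ⊗ₜ[ℂ] D.monomial e) := by
        rw [hexp, map_sub, map_smul, smul_sub, smul_smul]
        abel
      rw [hdecomp]
      refine add_mem ?_ (Submodule.smul_mem _ _ ?_)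
      · rw [← Submodule.mem_comap]
        refine (Submodule.span_le.2 ?_) hmem
        rintro _ ⟨p, q, hpq, hpb, rfl⟩
        have hpc : p ≤ Function.update c i 0 := hpq ▸ le_self_add
        have hqc : q ≤ Function.update c i 0 := hpq ▸ le_add_self
        have hp0 : ∀ j, i ≤ j → p j = 0 := fun j hj =>
          Nat.le_zero.1 ((hpc j).trans (hsupp c le_rfl j hj).le)
        have hq0 : ∀ j, i ≤ j → q j = 0 := fun j hj =>
          Nat.le_zero.1 ((hqc j).trans (hsupp c le_rfl j hj).le)
        -- Such a term differs from b at an index below i, and adding a multiple of the i-th unit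
        -- vector cannot repair this.
        have hall : ∀ r s : ℕ, r + s = c i →
            D.monomial (p + Pi.single i r) ⊗ₜ[ℂ] D.monomial (q + Pi.single i s) ∈
              offSpan D c b := by
          intro r s hrs
          refine Submodule.subset_span ⟨_, _, ?_, ?_, rfl⟩
          · rw [add_add_add_comm, hpq, ← Pi.single_add, hrs, ← hsplit]
          · rintro rfl
            apply hpb
            ext j
            by_cases hj : j = i
            · subst hj; simpa using hp0 i le_rfl
            · simp [Function.update_of_ne hj, Pi.single_eq_of_ne hj]
        -- The split 0 + c i is an arbitrary choice: only the shape of the terms is used here, not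
        -- the coefficient.
        obtain ⟨δ, -, hδ⟩ := tensorOp_pow_tmul hp0 hq0 hki (zero_add (c i))
        have h1 : (tensorOp D i ^ c i) (D.monomial p ⊗ₜ[ℂ] D.monomial q) -
            δ • D.monomial (p + Pi.single i 0) ⊗ₜ[ℂ] D.monomial (q + Pi.single i (c i)) ∈
            offSpan D c b := by
          refine (Submodule.span_le.2 ?_) hδ
          rintro _ ⟨r, s, hrs, -, rfl⟩
          exact hall r s hrs
        have h2 := add_mem h1 (Submodule.smul_mem _ δ (hall 0 (c i) (zero_add _)))
        rwa [sub_add_cancel] at h2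
      · refine (Submodule.span_le.2 ?_) hmem'
        rintro _ ⟨r, s, hrs, hrb, rfl⟩
        refine Submodule.subset_span ⟨_, _, ?_, ?_, rfl⟩
        · rw [add_add_add_comm, hbe', ← Pi.single_add, hrs, ← hsplit]
        · intro h1
          apply hrb
          have h2 := congrFun h1 i
          simpa using h2
    · exact ih c b e (fun j hj => absurd j.2 (by omega)) hc hbe

end Datum

end Cartan

section Leading

variable {g : Type*} [AddCommGroup g] [Module ℂ g] [LieSuperalgebra g] {D : Datum g}

namespace Datum

/-! ### Leading exponents of functionals -/

variable (D) in
/-- `φ` is a functional on `K(kλ)` that vanishes on `f^c v` for `c < a`, and not for `c = a`. -/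
structure Lead (k : ℕ) (a : D.Exp) (φ : SuperDual g) : Prop where
  mem : φ ∈ D.sections k
  eq_zero : ∀ c, D.Admissible c → D.toOrd c < D.toOrd a → SuperDual.eval (D.monomial c) φ = 0
  ne_zero : D.Admissible a → SuperDual.eval (D.monomial a) φ ≠ 0

lemma Admissible.of_le {a b : D.Exp} (hb : D.Admissible b) (hab : a ≤ b) : D.Admissible a :=
  fun i hi => (hab i).trans (hb i hi)

lemma dualPair_eq_zero_of_lead {m n : ℕ} {a b : D.Exp} {φ ψ : SuperDual g} (hφ : D.Lead m a φ)
    (hψ : D.Lead n b ψ) {p q : D.Exp} (hpq : D.Admissible (p + q))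
    (h : D.toOrd p < D.toOrd b ∨ D.toOrd q < D.toOrd a) :
    dualPair φ ψ (D.monomial p ⊗ₜ D.monomial q) = 0 := by
  rw [dualPair_tmul]
  rcases h with h | h
  · rw [hψ.eq_zero p (hpq.of_le le_self_add) h, zero_mul]
  · rw [hφ.eq_zero q (hpq.of_le le_add_self) h, mul_zero]

/-- The value at f^c is a combination of ψ(f^p) φ(f^q) with p + q = c. A nonzero term needs p ≥ b
and q ≥ a, which is impossible for c < a + b and leaves only p = b, q = a for c = a + b. That term
has nonzero coefficient by `comul_monomial`. -/
lemma Lead.mul (hg : IsBasic g) {m n : ℕ} {a b : D.Exp} {φ ψ : SuperDual g} (hφ : D.Lead m a φ)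
    (hψ : D.Lead n b ψ) : D.Lead (m + n) (a + b) (φ * ψ) where
  mem := mul_mem_sections hg hφ.mem hψ.mem
  eq_zero c hc hlt := by
    -- With the first factor taken to be f^0, the lemma just expresses the coproduct by products f^p
    -- ⊗ f^q with p + q = c.
    obtain ⟨γ, -, hγ⟩ := comul_monomial hc (zero_add c)
    have hall : ∀ p q : D.Exp, p + q = c → dualPair φ ψ (D.monomial p ⊗ₜ D.monomial q) = 0 := by
      rintro p q rfl
      refine dualPair_eq_zero_of_lead hφ hψ hc ?_
      by_contra! hle
      apply hlt.not_ge
      rcases hle.1.eq_or_lt with h1 | h1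
      · rcases hle.2.eq_or_lt with h2 | h2
        · have h1' : b = p := h1
          have h2' : a = q := h2
          rw [h1', h2', add_comm]
        · have h1' : b = p := h1
          rw [h1', add_comm p q]
          exact (toOrd_add_lt p h2).le
      · have h3 : D.toOrd (a + b) < D.toOrd (a + p) := toOrd_add_lt_left a h1
        rcases hle.2.eq_or_lt with h2 | h2
        · have h2' : a = q := h2
          rw [← h2', add_comm p a]
          exact h3.le
        · exact (h3.trans (by rw [add_comm p q]; exact toOrd_add_lt p h2)).le
    rw [SuperDual.eval_mul]
    have h1 : comul (D.monomial c) ∈ LinearMap.ker (dualPair φ ψ) := by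
      have h2 : offSpan D c 0 ≤ LinearMap.ker (dualPair φ ψ) := by
        refine Submodule.span_le.2 ?_
        rintro _ ⟨p, q, hpq, -, rfl⟩
        exact hall p q hpq
      have h3 := add_mem (h2 hγ) (Submodule.smul_mem _ γ
        (LinearMap.mem_ker.2 (hall 0 c (zero_add c))))
      rwa [sub_add_cancel] at h3
    exact h1
  ne_zero hab := by
    have ha : D.Admissible a := hab.of_le le_self_add
    have hb : D.Admissible b := hab.of_le le_add_self
    obtain ⟨γ, hγ0, hγ⟩ := comul_monomial hab (add_comm b a)
    have h2 : offSpan D (a + b) b ≤ LinearMap.ker (dualPair φ ψ) := by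
      refine Submodule.span_le.2 ?_
      rintro _ ⟨p, q, hpq, hpb, rfl⟩
      refine dualPair_eq_zero_of_lead hφ hψ (by rwa [hpq]) ?_
      by_contra! hle
      have h1 : D.toOrd b < D.toOrd p := lt_of_le_of_ne hle.1 fun h => hpb h.symm
      have h3 : D.toOrd (a + b) < D.toOrd (a + p) := toOrd_add_lt_left a h1
      rcases hle.2.eq_or_lt with h4 | h4
      · have h4' : a = q := h4
        have h6 : a + p = a + b := by
          rw [add_comm a p]
          exact (congrArg (p + ·) h4').trans hpq
        rw [h6] at h3
        exact lt_irrefl _ h3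
      · have h5 : D.toOrd (a + p) < D.toOrd (q + p) := toOrd_add_lt p h4
        rw [add_comm q p, hpq] at h5
        exact lt_asymm h3 h5
    have h3 : dualPair φ ψ (comul (D.monomial (a + b)) -
        γ • D.monomial b ⊗ₜ[ℂ] D.monomial a) = 0 := h2 hγ
    rw [map_sub, sub_eq_zero, map_smul, dualPair_tmul] at h3
    rw [SuperDual.eval_mul, h3, smul_eq_mul]
    exact mul_ne_zero hγ0 (mul_ne_zero (hψ.ne_zero hb) (hφ.ne_zero ha))

lemma counit_monomial {a : D.Exp} (ha : a ≠ 0) : counit (D.monomial a) = 0 := by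
  obtain ⟨i, hi⟩ : ∃ i, a i ≠ 0 := by
    by_contra! h
    exact ha (funext h)
  have hι : counit (UEA.ι (D.f i : g)) = 0 := by
    simpa using counit_ι_mul (D.f i : g) (1 : UEA g)
  rw [monomial, map_list_prod, List.prod_eq_zero_iff, List.map_map]
  refine List.mem_map.2 ⟨i, by simp, ?_⟩
  rw [Function.comp_apply, map_pow, hι, zero_pow hi]

lemma Lead.one : D.Lead 0 0 (1 : SuperDual g) where
  mem := one_mem_sections
  eq_zero c _ hlt := by
    rw [SuperDual.eval_one]
    refine counit_monomial ?_
    rintro rfl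
    exact lt_irrefl _ hlt
  ne_zero _ := by
    rw [SuperDual.eval_one, monomial_zero, map_one]
    exact one_ne_zero

/-- Functionals on `K(kλ)` vanishing at the `f^c v` with `c ≤ a`. -/
def filtDual (D : Datum g) (k : ℕ) (a : D.Exp) : Submodule ℂ (SuperDual g) where
  carrier := {φ | φ ∈ D.sections k ∧ ∀ c, D.Admissible c → D.toOrd c ≤ D.toOrd a →
    SuperDual.eval (D.monomial c) φ = 0}
  add_mem' hφ hψ := ⟨add_mem hφ.1 hψ.1, fun c hc hca => by
    rw [map_add, hφ.2 c hc hca, hψ.2 c hc hca, add_zero]⟩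
  zero_mem' := ⟨zero_mem _, fun c _ _ => map_zero _⟩
  smul_mem' r φ hφ := ⟨Submodule.smul_mem _ r hφ.1, fun c hc hca => by
    rw [map_smul, hφ.2 c hc hca, smul_zero]⟩

/-- A functional on `K(kλ)` vanishing on essential vectors up to `a` vanishes on all `f^c v`,
`c ≤ a`. -/
lemma eval_eq_zero_of_essential (hg : IsBasic g) {k : ℕ} {φ : SuperDual g}
    (hφ : φ ∈ D.sections k) {c : D.Exp} (hc : D.Admissible c)
    (h0 : ∀ b, D.IsEssential k b → D.toOrd b ≤ D.toOrd c →
      SuperDual.eval (D.monomial b) φ = 0) : SuperDual.eval (D.monomial c) φ = 0 := by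
  obtain ⟨η, rfl⟩ := hφ
  rw [eval_pull, ← LinearMap.mem_ker]
  refine (Submodule.span_le.2 ?_) (monomial_mem_span_essential hg k hc)
  rintro _ ⟨b, hb, hbc, rfl⟩
  have := h0 b hb hbc
  rwa [eval_pull] at this

/-- For c < a the vector f^c v is a combination of essential vectors with exponents at most c, and
η_{a,k} kills all of these. -/
lemma lead_eta (hg : IsBasic g) {k : ℕ} {a : D.Exp} (ha : D.IsEssential k a) :
    D.Lead k a (D.pull k (D.eta k a)) where
  mem := ⟨_, rfl⟩
  eq_zero c hc hlt := eval_eq_zero_of_essential hg ⟨_, rfl⟩ hc fun b hb hbc => by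
    rw [eta_apply hg ha hb, if_neg]
    rintro rfl
    exact (hbc.trans_lt hlt).false
  ne_zero _ := by
    rw [eta_apply hg ha ha, if_pos rfl]
    exact Finset.prod_ne_zero_iff.2 fun i _ => by exact_mod_cast (a i).factorial_ne_zero

/-- The functional separates f^a v from the span of the smaller f^b v. -/
lemma Lead.isEssential {k : ℕ} {a : D.Exp} {φ : SuperDual g} (hφ : D.Lead k a φ)
    (ha : D.Admissible a) : D.IsEssential k a := by
  refine ⟨ha, fun hmem => hφ.ne_zero ha ?_⟩
  obtain ⟨η, hη⟩ := hφ.mem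
  rw [← hη, eval_pull, ← LinearMap.mem_ker]
  refine (Submodule.span_le.2 ?_) hmem
  rintro _ ⟨b, hb, hba, rfl⟩
  have := hφ.eq_zero b hb hba
  rwa [← hη, eval_pull] at this

lemma eta_mem_filtDual (hg : IsBasic g) {k : ℕ} {a b : D.Exp} (hb : D.IsEssential k b)
    (hab : D.toOrd a < D.toOrd b) : D.pull k (D.eta k b) ∈ filtDual D k a :=
  ⟨⟨_, rfl⟩, fun c hc hca => (lead_eta hg hb).eq_zero c hc (hca.trans_lt hab)⟩

/-- The factor 1/∏ bᵢ! appears because η_{b,k} takes the value ∏ bᵢ! on the unnormalized vector f^b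
v. -/
lemma eq_sum_eta (hg : IsBasic g) {k : ℕ} {φ : SuperDual g} (hφ : φ ∈ D.sections k) :
    φ = ∑ b ∈ (finite_essential (D := D) hg k).toFinset,
      (SuperDual.eval (D.monomial b) φ * (∏ i, ((b i).factorial : ℂ))⁻¹) •
        D.pull k (D.eta k b) := by
  classical
  rw [← sub_eq_zero]
  refine eq_zero_of_mem_sections hg (sub_mem hφ (Submodule.sum_mem _ fun b _ =>
    Submodule.smul_mem _ _ ⟨_, rfl⟩)) fun a ha => ?_
  rw [map_sub, map_sum, sub_eq_zero, Finset.sum_eq_single a]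
  · rw [map_smul, eta_apply hg ha ha, if_pos rfl, smul_eq_mul, mul_assoc, inv_mul_cancel₀, mul_one]
    exact Finset.prod_ne_zero_iff.2 fun i _ => by exact_mod_cast (a i).factorial_ne_zero
  · intro b hb hba
    rw [map_smul, eta_apply hg ((Set.Finite.mem_toFinset (finite_essential hg k)).1 hb) ha, if_neg (Ne.symm hba),
      smul_zero]
  · intro h
    exact absurd ((Set.Finite.mem_toFinset (finite_essential hg k)).2 ha) h

/-- The inclusion of the component of degree `k` of `R(λ)`. -/
def atDeg (g : Type*) [AddCommGroup g] [Module ℂ g] [LieSuperalgebra g] (k : ℕ) :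
    SuperDual g →ₗ[ℂ] (SuperDual g)[X] :=
  (Polynomial.monomial k).restrictScalars ℂ

lemma atDeg_injective (k : ℕ) : Function.Injective (atDeg g k) := Polynomial.monomial_injective k

lemma etaR_eq (k : ℕ) (a : D.Exp) : D.etaR k a = atDeg g k (D.pull k (D.eta k a)) := rfl

/-- The coefficients of a functional in the basis η are its values at essential monomials up to
factorials. So the filtration is described by vanishing conditions, which are easier to check on
products. -/
lemma filt_eq_map (hg : IsBasic g) (k : ℕ) (a : D.Exp) :
    D.filt k a = (filtDual D k a).map (atDeg g k) := by
  apply le_antisymm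
  · refine Submodule.span_le.2 ?_
    rintro _ ⟨b, hb, hab, rfl⟩
    exact ⟨_, eta_mem_filtDual hg hb hab, rfl⟩
  · rintro _ ⟨φ, hφ, rfl⟩
    rw [eq_sum_eta hg hφ.1, map_sum]
    refine Submodule.sum_mem _ fun b hb => ?_
    rw [Set.Finite.mem_toFinset] at hb
    rw [map_smul]
    rcases lt_or_ge (D.toOrd a) (D.toOrd b) with h | h
    · exact Submodule.smul_mem _ _ (Submodule.subset_span ⟨b, hb, h, rfl⟩)
    · rw [hφ.2 b hb.1 h, zero_mul, zero_smul]
      exact zero_mem _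

lemma atDeg_mem_filt (hg : IsBasic g) {k : ℕ} {a : D.Exp} {φ : SuperDual g} :
    atDeg g k φ ∈ D.filt k a ↔ φ ∈ filtDual D k a := by
  rw [filt_eq_map hg, Submodule.mem_map]
  refine ⟨?_, fun h => ⟨φ, h, rfl⟩⟩
  rintro ⟨ψ, hψ, h⟩
  rwa [← atDeg_injective k h]

/-! ### Values of words in `R(λ)` -/

lemma lift_X {R : Type*} [CommRing R] {ι : Type*} {p : ι → ZMod 2} {A : Type*} [Ring A]
    [Algebra R A] (x : ι → A)
    (hx : ∀ i j, x i * x j = superSign R (p i) (p j) • (x j * x i)) (i : ι) :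
    SuperPoly.lift R p x hx (SuperPoly.X R p i) = x i := by
  have h := RingQuot.liftAlgHom_mkAlgHom_apply R (s := SuperPoly.Rel R ι p) (FreeAlgebra.lift R x)
    (by rintro _ _ ⟨i, j⟩; simpa using hx i j) (FreeAlgebra.ι R i)
  rw [FreeAlgebra.lift_ι_apply] at h
  exact h

lemma word_nil {R : Type*} [CommRing R] {ι : Type*} {p : ι → ZMod 2} :
    SuperPoly.word R p [] = 1 := rfl

lemma word_cons {R : Type*} [CommRing R] {ι : Type*} {p : ι → ZMod 2} (i : ι) (l : List ι) :
    SuperPoly.word R p (i :: l) = SuperPoly.X R p i * SuperPoly.word R p l := by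
  simp [SuperPoly.word]

lemma word_append {R : Type*} [CommRing R] {ι : Type*} {p : ι → ZMod 2} (l l' : List ι) :
    SuperPoly.word R p (l ++ l') = SuperPoly.word R p l * SuperPoly.word R p l' := by
  simp [SuperPoly.word]

lemma wordExp_append (l l' : List D.Gen) : D.wordExp (l ++ l') = D.wordExp l + D.wordExp l' := by
  simp [wordExp]

lemma evalR_X (a : D.Gen) : D.evalR (SuperPoly.X ℂ D.genParity a) = D.etaR 1 a := lift_X _ _ a

/-- Leading exponents are additive and each generator η_{a,1} leads at a. If the total exponent is
inadmissible, only the vanishing below it is asserted. -/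
lemma exists_lead_word (hg : IsBasic g) (l : List D.Gen) :
    ∃ φ, D.evalR (SuperPoly.word ℂ D.genParity l) = atDeg g l.length φ ∧
      D.Lead l.length (D.wordExp l) φ := by
  induction l with
  | nil => exact ⟨1, by rw [word_nil, map_one]; rfl, Lead.one⟩
  | cons a l ih =>
    obtain ⟨φ, h1, h2⟩ := ih
    refine ⟨D.pull 1 (D.eta 1 a) * φ, ?_, ?_⟩
    · rw [word_cons, map_mul, h1, evalR_X, List.length_cons, add_comm]
      exact Polynomial.monomial_mul_monomial _ _ _ _
    · have h3 : D.wordExp (a :: l) = a.1 + D.wordExp l := by simp [wordExp]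
      rw [h3, List.length_cons, add_comm]
      exact (lead_eta hg a.2).mul hg h2

/-- Elements of the component of degree `(a, k)` of `S` have their values in `R_k^{≥ a}`. -/
lemma exists_evalR_of_mem_comp (hg : IsBasic g) {a : D.Exp} {k : ℕ} {s : D.S}
    (hs : s ∈ D.comp a k) : ∃ φ ∈ D.sections k, D.evalR s = atDeg g k φ ∧
      ∀ c, D.Admissible c → D.toOrd c < D.toOrd a → SuperDual.eval (D.monomial c) φ = 0 := by
  induction hs using Submodule.span_induction with
  | mem s hs =>
    obtain ⟨l, rfl, rfl, rfl⟩ := hs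
    obtain ⟨φ, h1, h2⟩ := exists_lead_word hg l
    exact ⟨φ, h2.mem, h1, h2.eq_zero⟩
  | zero => exact ⟨0, zero_mem _, by simp, by simp⟩
  | add s t _ _ hs ht =>
    obtain ⟨φ, h1, h2, h3⟩ := hs
    obtain ⟨ψ, h4, h5, h6⟩ := ht
    exact ⟨φ + ψ, add_mem h1 h4, by rw [map_add, map_add, h2, h5], fun c hc hca => by
      rw [map_add, h3 c hc hca, h6 c hc hca, add_zero]⟩
  | smul r s _ hs =>
    obtain ⟨φ, h1, h2, h3⟩ := hs
    exact ⟨r • φ, Submodule.smul_mem _ r h1, by rw [map_smul, map_smul, h2], fun c hc hca => by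
      rw [map_smul, h3 c hc hca, smul_zero]⟩

/-- This is the inclusion opposite to favourability: an admissible sum of k elements of es₁ lies in
es_k. -/
lemma isEssential_wordExp (hg : IsBasic g) {l : List D.Gen} (hl : D.Admissible (D.wordExp l)) :
    D.IsEssential l.length (D.wordExp l) := by
  obtain ⟨φ, -, h⟩ := exists_lead_word hg l
  exact h.isEssential hl

end Datum

end Leading

section Grading

variable {g : Type*} [AddCommGroup g] [Module ℂ g] [LieSuperalgebra g] {D : Datum g}

namespace Datum

/-! ### The grading of the polynomial superalgebra -/

lemma span_range_word {R : Type*} [CommRing R] {ι : Type*} (p : ι → ZMod 2) :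
    Submodule.span R (Set.range (SuperPoly.word R p)) = ⊤ := by
  suffices h : ∀ x, x ∈ Submodule.span R (Set.range (SuperPoly.word R p)) from
    eq_top_iff.2 fun x _ => h x
  intro x
  obtain ⟨y, rfl⟩ := RingQuot.mkAlgHom_surjective R (SuperPoly.Rel R ι p) x
  induction y using FreeAlgebra.induction with
  | grade0 r =>
    rw [AlgHom.commutes, Algebra.algebraMap_eq_smul_one]
    exact Submodule.smul_mem _ _ (Submodule.subset_span ⟨[], rfl⟩)
  | grade1 i =>
    refine Submodule.subset_span ⟨[i], ?_⟩
    rw [word_cons, word_nil]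
    exact mul_one (SuperPoly.X R p i)
  | mul a b ha hb =>
    rw [map_mul]
    have h1 := Submodule.mul_mem_mul ha hb
    rw [Submodule.span_mul_span] at h1
    refine Submodule.span_mono ?_ h1
    rintro _ ⟨_, ⟨l, rfl⟩, _, ⟨l', rfl⟩, rfl⟩
    exact ⟨l ++ l', word_append l l'⟩
  | add a b ha hb =>
    rw [map_add]
    exact add_mem ha hb

/-- The algebra map recording degrees. -/
def degreeMap (D : Datum g) : D.S →ₐ[ℂ] AddMonoidAlgebra D.S (D.Exp × ℕ) :=
  SuperPoly.lift ℂ D.genParity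
    (fun a => AddMonoidAlgebra.single (a.1, 1) (SuperPoly.X ℂ D.genParity a)) fun a b => by
      rw [AddMonoidAlgebra.single_mul_single, AddMonoidAlgebra.single_mul_single,
        SuperPoly.X_mul_X, AddMonoidAlgebra.smul_single, add_comm]

lemma degreeMap_word (l : List D.Gen) : degreeMap D (SuperPoly.word ℂ D.genParity l) =
    AddMonoidAlgebra.single (D.wordExp l, l.length) (SuperPoly.word ℂ D.genParity l) := by
  induction l with
  | nil => rw [word_nil, map_one]; rfl
  | cons a l ih =>
    have h3 : D.wordExp (a :: l) = a.1 + D.wordExp l := by simp [wordExp]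
    rw [word_cons, map_mul, ih, degreeMap, lift_X, AddMonoidAlgebra.single_mul_single, h3,
      List.length_cons, Prod.mk_add_mk, add_comm 1]

/-- The homogeneous component of degree `d`. -/
def component (D : Datum g) (d : D.Exp × ℕ) : D.S →ₗ[ℂ] D.S where
  toFun x := (degreeMap D x).coeff d
  map_add' x y := by rw [map_add]; rfl
  map_smul' c x := by rw [map_smul]; rfl

lemma component_word (d : D.Exp × ℕ) (l : List D.Gen) :
    component D d (SuperPoly.word ℂ D.genParity l) =
      if (D.wordExp l, l.length) = d then SuperPoly.word ℂ D.genParity l else 0 := by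
  classical
  change (degreeMap D _).coeff d = _
  rw [degreeMap_word, AddMonoidAlgebra.coeff_single, Finsupp.single_apply]

lemma component_of_mem_comp (d : D.Exp × ℕ) {a : D.Exp} {k : ℕ} {x : D.S} (hx : x ∈ D.comp a k) :
    component D d x = if (a, k) = d then x else 0 := by
  induction hx using Submodule.span_induction with
  | mem x hx =>
    obtain ⟨l, rfl, rfl, rfl⟩ := hx
    exact component_word d l
  | zero => simp
  | add x y _ _ hx hy => rw [map_add, hx, hy]; split <;> simp
  | smul c x _ hx => rw [map_smul, hx]; split <;> simp

lemma word_mem_comp (l : List D.Gen) :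
    SuperPoly.word ℂ D.genParity l ∈ D.comp (D.wordExp l) l.length :=
  Submodule.subset_span ⟨l, rfl, rfl, rfl⟩

lemma mul_mem_comp {a b : D.Exp} {k m : ℕ} {x y : D.S} (hx : x ∈ D.comp a k)
    (hy : y ∈ D.comp b m) : x * y ∈ D.comp (a + b) (k + m) := by
  have h := Submodule.mul_mem_mul hx hy
  unfold comp at h ⊢
  rw [Submodule.span_mul_span] at h
  refine Submodule.span_mono ?_ h
  rintro _ ⟨_, ⟨l, h1, h2, rfl⟩, _, ⟨l', h3, h4, rfl⟩, rfl⟩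
  exact ⟨l ++ l', by rw [List.length_append, h1, h3], by rw [wordExp_append, h2, h4],
    (word_append l l').symm⟩

lemma IsBinomial.mem_comp {a : D.Exp} {k : ℕ} {s : D.S} (hs : D.IsBinomial a k s) :
    s ∈ D.comp a k := by
  obtain ⟨l, l', σ, h1, h2, h3, h4, rfl⟩ := hs
  exact add_mem (Submodule.subset_span ⟨l, h1, h3, rfl⟩)
    (Submodule.smul_mem _ _ (Submodule.subset_span ⟨l', h2, h4, rfl⟩))

/-- An element of the kernel of `S → gr R(λ)` of admissible degree `(a, k)` has its value
in `R_k^{> a}`. -/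
lemma evalR_mem_filt_of_mem_grKer {a : D.Exp} {k : ℕ} (ha : D.Admissible a) {s : D.S}
    (hs : s ∈ D.comp a k) (hker : s ∈ D.grKer) : D.evalR s ∈ D.filt k a := by
  -- Projection to degree (a, k) kills the words of inadmissible exponent and the spanning elements
  -- of other degrees; the remaining ones satisfy the claim by definition.
  have key : D.grKer ≤ (D.filt k a).comap (D.evalR.toLinearMap ∘ₗ component D (a, k)) := by
    refine Submodule.span_le.2 ?_
    rintro x (⟨l, hl, rfl⟩ | ⟨a', k', -, hx, hx'⟩)
    · change D.evalR (component D (a, k) _) ∈ D.filt k a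
      rw [component_word, if_neg, map_zero]
      · exact zero_mem _
      · intro h
        have h' : D.wordExp l = a := congrArg Prod.fst h
        exact hl (h' ▸ ha)
    · change D.evalR (component D (a, k) _) ∈ D.filt k a
      rw [component_of_mem_comp _ hx]
      split
      case isTrue h => obtain ⟨rfl, rfl⟩ := Prod.ext_iff.1 h; exact hx'
      case isFalse => rw [map_zero]; exact zero_mem _
  have h1 : D.evalR (component D (a, k) s) ∈ D.filt k a := key hker
  rwa [component_of_mem_comp _ hs, if_pos rfl] at h1

/-- An element of the kernel of `S → gr R(λ)` of the largest degree is a relation of `R(λ)`. -/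
lemma evalR_eq_zero_of_isMaxEssential (hg : IsBasic g) {a : D.Exp} {k : ℕ}
    (ha : D.IsMaxEssential k a) {s : D.S} (hs : s ∈ D.comp a k) (hker : s ∈ D.grKer) :
    D.evalR s = 0 := by
  have h1 := evalR_mem_filt_of_mem_grKer ha.1.1 hs hker
  obtain ⟨φ, hφ, h2, -⟩ := exists_evalR_of_mem_comp hg hs
  -- A functional vanishing up to the largest essential exponent vanishes on a basis.
  rw [h2, atDeg_mem_filt hg] at h1
  rw [h2, eq_zero_of_mem_sections hg hφ fun b hb => h1.2 b hb.1 ?_, map_zero]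
  rcases ha.2 b hb with rfl | h
  · exact le_rfl
  · exact le_of_lt (toOrd_lt.2 h)

variable (C : D.FamilyChoice)

namespace FamilyChoice

lemma gbar_mem_comp (i : Fin C.m) : C.gbar i ∈ D.comp (C.J i) (C.deg i) := by
  rcases C.gbar_form i with ⟨-, l, h1, h2, h3⟩ | ⟨-, h⟩
  · rw [h3, ← h1, ← h2]
    exact word_mem_comp l
  · exact h.mem_comp

/-- Homogeneous elements of the kernel are combinations of homogeneous multiples of the `ḡ_i`. -/
lemma mem_span_of_mem_grKer {a : D.Exp} {k : ℕ} {x : D.S} (hx : x ∈ D.comp a k)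
    (hker : x ∈ D.grKer) :
    x ∈ Submodule.span ℂ {y | ∃ (i : Fin C.m) (l l' : List D.Gen),
      D.wordExp l + C.J i + D.wordExp l' = a ∧ l.length + C.deg i + l'.length = k ∧
      y = SuperPoly.word ℂ D.genParity l * C.gbar i * SuperPoly.word ℂ D.genParity l'} := by
  set V := Submodule.span ℂ {y | ∃ (i : Fin C.m) (l l' : List D.Gen),
      D.wordExp l + C.J i + D.wordExp l' = a ∧ l.length + C.deg i + l'.length = k ∧
      y = SuperPoly.word ℂ D.genParity l * C.gbar i * SuperPoly.word ℂ D.genParity l'} with hV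
  have hcomp : component D (a, k) x = x := by rw [component_of_mem_comp _ hx, if_pos rfl]
  rw [← hcomp]
  have h1 : x ∈ TwoSidedIdeal.span (Set.range C.gbar) := by
    have h2 : x ∈ (TwoSidedIdeal.span (Set.range C.gbar) : Set D.S) := by
      rw [C.gbar_span]; exact hker
    exact h2
  rw [TwoSidedIdeal.mem_span_iff_mem_addSubgroup_closure] at h1
  clear hcomp hker hx
  -- Each product of a ḡ_i with words is homogeneous, so the projection to degree (a, k) either
  -- keeps it or kills it.
  have hmul : ∀ (i : Fin C.m) (l l' : List D.Gen), component D (a, k)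
      (SuperPoly.word ℂ D.genParity l * C.gbar i * SuperPoly.word ℂ D.genParity l') ∈ V := by
    intro i l l'
    have h2 : SuperPoly.word ℂ D.genParity l * C.gbar i * SuperPoly.word ℂ D.genParity l' ∈
        D.comp (D.wordExp l + C.J i + D.wordExp l') (l.length + C.deg i + l'.length) :=
      mul_mem_comp (mul_mem_comp (word_mem_comp l) (C.gbar_mem_comp i)) (word_mem_comp l')
    rw [component_of_mem_comp _ h2]
    split
    case isTrue h =>
      exact Submodule.subset_span ⟨i, l, l', (Prod.ext_iff.1 h).1, (Prod.ext_iff.1 h).2, rfl⟩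
    case isFalse => exact zero_mem _
  induction h1 using AddSubgroup.closure_induction with
  | mem y hy =>
    obtain ⟨_, ⟨u, -, _, ⟨i, rfl⟩, rfl⟩, v, -, rfl⟩ := hy
    have hu : u ∈ Submodule.span ℂ (Set.range (SuperPoly.word ℂ D.genParity)) := by
      rw [span_range_word]; trivial
    have hv : v ∈ Submodule.span ℂ (Set.range (SuperPoly.word ℂ D.genParity)) := by
      rw [span_range_word]; trivial
    change component D (a, k) (u * C.gbar i * v) ∈ V
    induction hu using Submodule.span_induction with
    | mem u hu =>
      obtain ⟨l, rfl⟩ := hu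
      induction hv using Submodule.span_induction with
      | mem v hv => obtain ⟨l', rfl⟩ := hv; exact hmul i l l'
      | zero => rw [mul_zero, map_zero]; exact zero_mem _
      | add v v' _ _ h h' => rw [mul_add, map_add]; exact add_mem h h'
      | smul c v _ h => rw [mul_smul_comm, map_smul]; exact V.smul_mem c h
    | zero => rw [zero_mul, zero_mul, map_zero]; exact zero_mem _
    | add v v' _ _ h h' => rw [add_mul, add_mul, map_add]; exact add_mem h h'
    | smul c v _ h => rw [smul_mul_assoc, smul_mul_assoc, map_smul]; exact V.smul_mem c h
  | zero => rw [map_zero]; exact zero_mem _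
  | add y z _ _ hy hz => rw [map_add]; exact add_mem hy hz
  | neg y _ hy => rw [map_neg]; exact neg_mem hy

end FamilyChoice

end Datum

end Grading

section Spanning

variable {g : Type*} [AddCommGroup g] [Module ℂ g] [LieSuperalgebra g] {D : Datum g}

namespace Datum

/-! ### Generation of the family -/

lemma incl_X (a : D.Gen) :
    D.incl (SuperPoly.X ℂ D.genParity a) = SuperPoly.X ℂ[X] D.genParity a := lift_X _ _ a

lemma incl_word (l : List D.Gen) :
    D.incl (SuperPoly.word ℂ D.genParity l) = SuperPoly.word ℂ[X] D.genParity l := by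
  rw [SuperPoly.word, map_list_prod, List.map_map]
  exact congrArg List.prod (List.map_congr_left fun a _ => incl_X a)

instance : IsScalarTower ℂ ℂ[X] D.St :=
  inferInstanceAs (IsScalarTower ℂ ℂ[X] (RingQuot (SuperPoly.Rel ℂ[X] D.Gen D.genParity)))

variable (C : D.FamilyChoice)

instance : IsScalarTower ℂ ℂ[X] C.Fam :=
  inferInstanceAs (IsScalarTower ℂ ℂ[X] (RingQuot fun x y : D.St => x ∈ C.relations ∧ y = 0))

namespace FamilyChoice

/-- The map `𝒮 → 𝓡`. -/
def toFam : D.S →ₐ[ℂ] C.Fam := (C.proj.restrictScalars ℂ).comp D.incl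

lemma proj_eq_zero {x : D.St} (hx : x ∈ C.relations) : C.proj x = 0 := by
  have h := RingQuot.mkAlgHom_rel ℂ[X] (s := fun x y : D.St => x ∈ C.relations ∧ y = 0)
    (x := x) (y := 0) ⟨hx, rfl⟩
  rw [map_zero] at h
  exact h

/-- This is the rewriting rule: ḡ_i is traded for a ℂ[t]-combination of elements with exponents
larger than J_i. -/
lemma toFam_gbar (i : Fin C.m) : C.toFam (C.gbar i) =
    -∑ j, (Polynomial.X ^ (D.wt C.w (C.U i j) - D.wt C.w (C.J i)).toNat : ℂ[X]) •
      C.toFam (C.gtail i j) := by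
  have h := C.proj_eq_zero (Or.inl ⟨i, rfl⟩)
  rw [map_add, map_sum] at h
  rw [eq_neg_iff_add_eq_zero, ← h]
  refine congrArg _ (Finset.sum_congr rfl fun j _ => ?_)
  rw [map_smul]
  rfl

variable {s : D.Gam → D.S}

lemma eval_lift (hg : IsBasic g) (hs : D.IsLift s) (γ : D.Gam) :
    ∃ ψ, D.evalR (s γ) = atDeg g γ.1.2 ψ ∧ D.Lead γ.1.2 γ.1.1 ψ := by
  obtain ⟨ψ, h1, h2, h3⟩ := exists_evalR_of_mem_comp hg (hs γ).1
  refine ⟨ψ, h2, h1, h3, fun _ => ?_⟩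
  have h4 := (hs γ).2
  rw [h2, etaR_eq, ← map_sub, atDeg_mem_filt hg] at h4
  have h5 := h4.2 γ.1.1 γ.2.1 le_rfl
  rw [map_sub, sub_eq_zero] at h5
  rw [h5]
  exact (lead_eta hg γ.2).ne_zero γ.2.1

/-- In an admissible degree the word and the chosen lift have the same leading exponent, so a scalar
multiple of the lift cancels the leading value. In an inadmissible degree the word is already in the
kernel and nothing is subtracted. -/
lemma exists_sub_mem_grKer (hg : IsBasic g) (hs : D.IsLift s) (l : List D.Gen) :
    ∃ t ∈ Submodule.span ℂ (Set.range s), SuperPoly.word ℂ D.genParity l - t ∈ D.grKer ∧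
      SuperPoly.word ℂ D.genParity l - t ∈ D.comp (D.wordExp l) l.length := by
  by_cases ha : D.Admissible (D.wordExp l)
  · let γ : D.Gam := ⟨(D.wordExp l, l.length), isEssential_wordExp hg ha⟩
    obtain ⟨φ, h1, h2⟩ := exists_lead_word hg l
    obtain ⟨ψ, h3, h4⟩ := eval_lift hg hs γ
    set c := SuperDual.eval (D.monomial (D.wordExp l)) φ /
      SuperDual.eval (D.monomial (D.wordExp l)) ψ with hc
    have hmem : SuperPoly.word ℂ D.genParity l - c • s γ ∈ D.comp (D.wordExp l) l.length :=
      sub_mem (word_mem_comp l) (Submodule.smul_mem _ c (hs γ).1)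
    refine ⟨c • s γ, Submodule.smul_mem _ c (Submodule.subset_span ⟨γ, rfl⟩),
      Submodule.subset_span (Or.inr ⟨_, _, ha, hmem, ?_⟩), hmem⟩
    have h5 : D.evalR (SuperPoly.word ℂ D.genParity l - c • s γ) =
        atDeg g l.length (φ - c • ψ) := by
      rw [map_sub, map_smul, h1, h3, map_sub, map_smul]
    rw [h5, atDeg_mem_filt hg]
    refine ⟨sub_mem h2.mem (Submodule.smul_mem _ c h4.mem), fun b hb hba => ?_⟩
    rw [map_sub, map_smul, smul_eq_mul]
    rcases hba.eq_or_lt with h | h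
    · have h' : b = D.wordExp l := h
      rw [h', hc, div_mul_cancel₀ _ (h4.ne_zero ha), sub_self]
    · rw [h2.eq_zero b hb h, h4.eq_zero b hb h, mul_zero, sub_zero]
  · refine ⟨0, zero_mem _, ?_, ?_⟩
    · rw [sub_zero]
      exact Submodule.subset_span (Or.inl ⟨l, ha, rfl⟩)
    · rw [sub_zero]
      exact word_mem_comp l

lemma finite_wordExp (hg : IsBasic g) (k : ℕ) :
    {a : D.Exp | ∃ l : List D.Gen, l.length = k ∧ D.wordExp l = a}.Finite := by
  have : Finite D.Gen := (finite_essential (D := D) hg 1).to_subtype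
  refine ((List.finite_length_eq D.Gen k).image D.wordExp).subset ?_
  rintro _ ⟨l, hl, rfl⟩
  exact ⟨l, hl, rfl⟩

/-- Descending induction on the exponent among words of the same length, measured by the number of
larger exponents. -/
lemma toFam_word_mem (hg : IsBasic g) (hs : D.IsLift s) (l : List D.Gen) :
    C.toFam (SuperPoly.word ℂ D.genParity l) ∈
      Submodule.span ℂ[X] (Set.range (C.theta s)) := by
  classical
  set M := Submodule.span ℂ[X] (Set.range (C.theta s)) with hM
  obtain ⟨k, hk⟩ : ∃ k, l.length = k := ⟨_, rfl⟩
  -- Inadmissible exponents are included: multiplying an admissible tail by words may leave the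
  -- admissible range.
  set E := (finite_wordExp (D := D) hg k).toFinset with hE
  obtain ⟨n, hn⟩ : ∃ n, (E.filter fun b => D.toOrd (D.wordExp l) < D.toOrd b).card = n := ⟨_, rfl⟩
  induction n using Nat.strong_induction_on generalizing l with
  | _ n ih =>
    have hcomp : ∀ b x, D.toOrd (D.wordExp l) < D.toOrd b → x ∈ D.comp b k →
        C.toFam x ∈ M := by
      intro b x hb hx
      have h1 : D.comp b k ≤ (M.restrictScalars ℂ).comap C.toFam.toLinearMap := by
        refine Submodule.span_le.2 ?_
        rintro _ ⟨l', hl', rfl, rfl⟩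
        refine ih _ ?_ l' hl' rfl
        rw [← hn]
        apply Finset.card_lt_card
        rw [Finset.ssubset_iff_of_subset]
        · refine ⟨D.wordExp l', Finset.mem_filter.2 ⟨?_, hb⟩, fun h3 =>
            lt_irrefl _ (Finset.mem_filter.1 h3).2⟩
          rw [hE, Set.Finite.mem_toFinset]
          exact ⟨l', hl', rfl⟩
        · intro b' hb'
          rw [Finset.mem_filter] at hb' ⊢
          exact ⟨hb'.1, hb.trans hb'.2⟩
      exact h1 hx
    obtain ⟨t, ht, hker, hmem⟩ := exists_sub_mem_grKer hg hs l
    have ht' : C.toFam t ∈ M := by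
      have h1 : Submodule.span ℂ (Set.range s) ≤
          (M.restrictScalars ℂ).comap C.toFam.toLinearMap := by
        refine Submodule.span_le.2 ?_
        rintro _ ⟨γ, rfl⟩
        exact Submodule.subset_span ⟨γ, rfl⟩
      exact h1 ht
    -- The difference is a combination of multiples of the ḡ_i in the same degree. Rewriting each
    -- ḡ_i raises the exponent, so the induction hypothesis applies.
    have hrel : C.toFam (SuperPoly.word ℂ D.genParity l - t) ∈ M := by
      have h1 := C.mem_span_of_mem_grKer hmem hker
      rw [hk] at h1
      have h2 : Submodule.span ℂ {y | ∃ (i : Fin C.m) (l1 l2 : List D.Gen),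
          D.wordExp l1 + C.J i + D.wordExp l2 = D.wordExp l ∧
          l1.length + C.deg i + l2.length = k ∧
          y = SuperPoly.word ℂ D.genParity l1 * C.gbar i * SuperPoly.word ℂ D.genParity l2} ≤
          (M.restrictScalars ℂ).comap C.toFam.toLinearMap := by
        refine Submodule.span_le.2 ?_
        rintro _ ⟨i, l1, l2, hexp, hlen, rfl⟩
        change C.toFam _ ∈ M
        rw [map_mul, map_mul, toFam_gbar, mul_neg, neg_mul, Finset.mul_sum, Finset.sum_mul]
        refine neg_mem (Submodule.sum_mem _ fun j _ => ?_)
        rw [mul_smul_comm, smul_mul_assoc, ← map_mul, ← map_mul]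
        refine Submodule.smul_mem _ _ (hcomp (D.wordExp l1 + C.U i j + D.wordExp l2) _ ?_ ?_)
        · rw [← hexp]
          exact toOrd_add_lt _ (toOrd_add_lt_left _ (toOrd_lt.2 (C.U_gt i j)))
        · rw [← hlen]
          exact mul_mem_comp (mul_mem_comp (word_mem_comp l1) (C.gtail_mem i j))
            (word_mem_comp l2)
      exact h2 h1
    have h3 := add_mem hrel ht'
    rwa [← map_add, sub_add_cancel] at h3

/-- The elements `θ_γ` generate the `ℂ[t]`-module `𝓡`. -/
lemma span_range_theta (hg : IsBasic g) (hs : D.IsLift s) :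
    Submodule.span ℂ[X] (Set.range (C.theta s)) = ⊤ := by
  suffices h : ∀ x, x ∈ Submodule.span ℂ[X] (Set.range (C.theta s)) from
    eq_top_iff.2 fun x _ => h x
  intro x
  obtain ⟨y, rfl⟩ := RingQuot.mkAlgHom_surjective ℂ[X]
    (fun x y : D.St => x ∈ C.relations ∧ y = 0) x
  have hy : y ∈ Submodule.span ℂ[X] (Set.range (SuperPoly.word ℂ[X] D.genParity)) := by
    rw [span_range_word]; trivial
  change C.proj y ∈ _
  induction hy using Submodule.span_induction with
  | mem y hy =>
    obtain ⟨l, rfl⟩ := hy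
    rw [← incl_word]
    exact C.toFam_word_mem hg hs l
  | zero => rw [map_zero]; exact zero_mem _
  | add y z _ _ hy hz => rw [map_add]; exact add_mem hy hz
  | smul c y _ hy => rw [map_smul]; exact Submodule.smul_mem _ c hy

end FamilyChoice

end Datum

end Spanning

section Independence

variable {g : Type*} [AddCommGroup g] [Module ℂ g] [LieSuperalgebra g] {D : Datum g}

namespace Datum

/-! ### Freeness of the family -/

instance : IsScalarTower ℂ ℂ[X] ℂ[T;T⁻¹] :=
  IsScalarTower.of_algebraMap_eq fun r => by
    rw [LaurentPolynomial.algebraMap_eq_toLaurent, Polynomial.algebraMap_eq,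
      Polynomial.toLaurent_C]
    rfl

/-- The algebra of Laurent polynomials in `t` over `U(g)^*[v]`. -/
abbrev Loc (g : Type*) [AddCommGroup g] [Module ℂ g] [LieSuperalgebra g] :=
  ℂ[T;T⁻¹] ⊗[ℂ] (SuperDual g)[X]

lemma etaR_supercomm (a b : D.Gen) : D.etaR 1 a * D.etaR 1 b =
    superSign ℂ (D.genParity a) (D.genParity b) • (D.etaR 1 b * D.etaR 1 a) := by
  rw [← evalR_X, ← evalR_X, ← map_mul, SuperPoly.X_mul_X, map_smul, map_mul]

/-- The map `𝒮[t] → R(λ)[t, t⁻¹]` sending the generator of `a` to `t^(-w(a)) η_{a,1}`. -/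
def rescale (D : Datum g) (w : Fin D.N → ℤ) : D.St →ₐ[ℂ[X]] Loc g :=
  SuperPoly.lift ℂ[X] D.genParity
    (fun a => (LaurentPolynomial.T (-D.wt w a.1) : ℂ[T;T⁻¹]) ⊗ₜ[ℂ] D.etaR 1 a) fun a b => by
      rw [Algebra.TensorProduct.tmul_mul_tmul, Algebra.TensorProduct.tmul_mul_tmul,
        etaR_supercomm a b, mul_comm (LaurentPolynomial.T _ : ℂ[T;T⁻¹])]
      unfold superSign
      split
      · rw [neg_one_smul, TensorProduct.tmul_neg]
        exact (neg_one_smul ℂ[X] _).symm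
      · rw [one_smul, one_smul]

lemma wt_add (w : Fin D.N → ℤ) (a b : D.Exp) : D.wt w (a + b) = D.wt w a + D.wt w b := by
  simp [wt, mul_add, Finset.sum_add_distrib]

lemma rescale_word (w : Fin D.N → ℤ) (l : List D.Gen) :
    rescale D w (D.incl (SuperPoly.word ℂ D.genParity l)) =
      (LaurentPolynomial.T (-D.wt w (D.wordExp l)) : ℂ[T;T⁻¹]) ⊗ₜ[ℂ]
        D.evalR (SuperPoly.word ℂ D.genParity l) := by
  induction l with
  | nil =>
    have h0 : D.wt w (D.wordExp []) = 0 := by simp [wt, wordExp]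
    rw [word_nil, map_one, map_one, map_one, h0, neg_zero, LaurentPolynomial.T_zero]
    rfl
  | cons a l ih =>
    have h3 : D.wordExp (a :: l) = a.1 + D.wordExp l := by simp [wordExp]
    rw [word_cons, map_mul, map_mul, ih, map_mul, incl_X, evalR_X, rescale, lift_X,
      Algebra.TensorProduct.tmul_mul_tmul, ← LaurentPolynomial.T_add, h3, wt_add, neg_add]

lemma rescale_of_mem_comp (w : Fin D.N → ℤ) {a : D.Exp} {k : ℕ} {x : D.S}
    (hx : x ∈ D.comp a k) : rescale D w (D.incl x) =
      (LaurentPolynomial.T (-D.wt w a) : ℂ[T;T⁻¹]) ⊗ₜ[ℂ] D.evalR x := by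
  induction hx using Submodule.span_induction with
  | mem x hx =>
    obtain ⟨l, rfl, rfl, rfl⟩ := hx
    exact rescale_word w l
  | zero => rw [map_zero, map_zero, map_zero, TensorProduct.tmul_zero]
  | add x y _ _ hx hy => rw [map_add, map_add, hx, hy, map_add, TensorProduct.tmul_add]
  | smul c x _ hx =>
    rw [map_smul, ← algebraMap_smul ℂ[X] c (D.incl x), map_smul, hx, algebraMap_smul, map_smul,
      TensorProduct.tmul_smul]

variable (C : D.FamilyChoice)

namespace FamilyChoice

/-- A tail of exponent U acquires t^(w(U) - w(J)) · t^(-w(U)) = t^(-w(J)), the same factor as ḡ_i,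
so the relation maps to t^(-w(J)) g_i(η) = 0. The binomials of largest degree are true relations of
R(λ). -/
lemma rescale_eq_zero (hg : IsBasic g) {x : D.St} (hx : x ∈ C.relations) :
    rescale D C.w x = 0 := by
  rcases hx with ⟨i, rfl⟩ | ⟨k, a, b, ha, hb, hker, rfl⟩
  · rw [map_add, rescale_of_mem_comp C.w (C.gbar_mem_comp i), map_sum]
    have h1 : ∀ j, rescale D C.w ((Polynomial.X ^ (D.wt C.w (C.U i j) -
        D.wt C.w (C.J i)).toNat : ℂ[X]) • D.incl (C.gtail i j)) =
        (LaurentPolynomial.T (-D.wt C.w (C.J i)) : ℂ[T;T⁻¹]) ⊗ₜ[ℂ] D.evalR (C.gtail i j) := by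
      intro j
      -- The exponent is positive by the choice of w, so `toNat` does not truncate.
      have h2 : (0 : ℤ) ≤ D.wt C.w (C.U i j) - D.wt C.w (C.J i) :=
        sub_nonneg.2 (C.w_lt i j).le
      rw [map_smul, rescale_of_mem_comp C.w (C.gtail_mem i j), TensorProduct.smul_tmul',
        Algebra.smul_def, LaurentPolynomial.algebraMap_X_pow, ← LaurentPolynomial.T_add,
        Int.toNat_of_nonneg h2]
      congr 2
      ring
    rw [Finset.sum_congr rfl fun j _ => h1 j, ← TensorProduct.tmul_sum, ← TensorProduct.tmul_add,
      ← map_sum, ← map_add, C.relation i, TensorProduct.tmul_zero]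
  · rw [rescale_of_mem_comp C.w hb.mem_comp,
      evalR_eq_zero_of_isMaxEssential hg ha hb.mem_comp hker, TensorProduct.tmul_zero]

/-- The map `𝓡 → R(λ)[t, t⁻¹]` induced by rescaling. -/
def famMap (hg : IsBasic g) : C.Fam →ₐ[ℂ[X]] Loc g :=
  RingQuot.liftAlgHom ℂ[X] (s := fun x y : D.St => x ∈ C.relations ∧ y = 0)
    ⟨rescale D C.w, by
      rintro x _ ⟨hx, rfl⟩
      rw [C.rescale_eq_zero hg hx, map_zero]⟩

lemma famMap_proj (hg : IsBasic g) (x : D.St) : C.famMap hg (C.proj x) = rescale D C.w x :=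
  RingQuot.liftAlgHom_mkAlgHom_apply ℂ[X] (rescale D C.w)
    (s := fun x y : D.St => x ∈ C.relations ∧ y = 0) (by
      rintro x _ ⟨hx, rfl⟩
      rw [C.rescale_eq_zero hg hx, map_zero]) x

end FamilyChoice

/-- The value at `f^a` of the coefficient of `vᵏ`. -/
def coeffEval (D : Datum g) (k : ℕ) (a : D.Exp) : (SuperDual g)[X] →ₗ[ℂ] ℂ :=
  SuperDual.eval (D.monomial a) ∘ₗ (Polynomial.lcoeff (SuperDual g) k).restrictScalars ℂ

lemma coeffEval_atDeg (k m : ℕ) (a : D.Exp) (φ : SuperDual g) :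
    coeffEval D k a (atDeg g m φ) = if m = k then SuperDual.eval (D.monomial a) φ else 0 := by
  change SuperDual.eval (D.monomial a) ((Polynomial.monomial m φ).coeff k) = _
  rw [Polynomial.coeff_monomial]
  split <;> simp

/-- The base change of `coeffEval` to Laurent polynomials. -/
def locCoeffEval (D : Datum g) (k : ℕ) (a : D.Exp) : Loc g →ₗ[ℂ[X]] ℂ[T;T⁻¹] :=
  (TensorProduct.AlgebraTensorModule.rid ℂ ℂ[X] ℂ[T;T⁻¹]).toLinearMap ∘ₗ
    TensorProduct.AlgebraTensorModule.map LinearMap.id (coeffEval D k a)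

lemma locCoeffEval_tmul (k : ℕ) (a : D.Exp) (p : ℂ[T;T⁻¹]) (r : (SuperDual g)[X]) :
    locCoeffEval D k a (p ⊗ₜ r) = coeffEval D k a r • p := rfl

namespace FamilyChoice

variable {s : D.Gam → D.S}

lemma famMap_theta (hg : IsBasic g) (hs : D.IsLift s) (γ : D.Gam) :
    C.famMap hg (C.theta s γ) =
      (LaurentPolynomial.T (-D.wt C.w γ.1.1) : ℂ[T;T⁻¹]) ⊗ₜ[ℂ] D.evalR (s γ) := by
  rw [theta, famMap_proj, rescale_of_mem_comp C.w (hs γ).1]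

/-- The elements `θ_γ` of `𝓡` are linearly independent over `ℂ[t]`. -/
lemma linearIndependent_theta (hg : IsBasic g) (hs : D.IsLift s) :
    LinearIndependent ℂ[X] (C.theta s) := by
  classical
  rw [linearIndependent_iff']
  intro S c hsum
  by_contra! hne
  obtain ⟨δ, hδ, hcδ⟩ := hne
  -- Within one degree k the smallest exponent with nonzero coefficient is selected. At its monomial
  -- all other terms of the relation vanish: those of degree k lead at larger exponents, and the
  -- rest have no coefficient at vᵏ.
  obtain ⟨γ, hγ, hmin⟩ := Finset.exists_min_image (S.filter fun γ => c γ ≠ 0 ∧ γ.1.2 = δ.1.2)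
    (fun γ => D.toOrd γ.1.1) ⟨δ, Finset.mem_filter.2 ⟨hδ, hcδ, rfl⟩⟩
  obtain ⟨hγS, hcγ, hγδ⟩ := Finset.mem_filter.1 hγ
  have h1 := congrArg (fun x => locCoeffEval D γ.1.2 γ.1.1 (C.famMap hg x)) hsum
  simp only [map_sum, map_smul, map_zero, C.famMap_theta hg hs, locCoeffEval_tmul] at h1
  rw [Finset.sum_eq_single_of_mem γ hγS] at h1
  · obtain ⟨ψ, h2, h3⟩ := eval_lift hg hs γ
    -- What remains is a product of the coefficient, a nonzero scalar and a power of t in the domain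
    -- ℂ[t, t⁻¹], into which ℂ[t] embeds.
    rw [h2, coeffEval_atDeg, if_pos rfl, Algebra.smul_def, LaurentPolynomial.algebraMap_eq_toLaurent,
      mul_eq_zero, smul_eq_zero, Polynomial.toLaurent_eq_zero] at h1
    rcases h1 with h1 | h1 | h1
    · exact hcγ h1
    · exact h3.ne_zero γ.2.1 h1
    · exact (LaurentPolynomial.isUnit_T (R := ℂ) _).ne_zero h1
  · intro β hβ hβγ
    by_cases hc : c β = 0
    · rw [hc, zero_smul]
    obtain ⟨ψ, h2, h3⟩ := eval_lift hg hs β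
    rw [h2, coeffEval_atDeg]
    split
    case isTrue hk =>
      have h4 := hmin β (Finset.mem_filter.2 ⟨hβ, hc, hk.trans hγδ⟩)
      rw [h3.eq_zero _ γ.2.1 (lt_of_le_of_ne h4 fun h => hβγ (Subtype.ext (Prod.ext h.symm hk))),
        zero_smul, smul_zero]
    case isFalse => rw [zero_smul, smul_zero]

/-- The basis of the `ℂ[t]`-module `𝓡` of the elements `θ_γ`. -/
def thetaBasis (hg : IsBasic g) (hs : D.IsLift s) : Module.Basis D.Gam ℂ[X] C.Fam :=
  Module.Basis.mk (C.linearIndependent_theta hg hs) (C.span_range_theta hg hs).ge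

lemma thetaBasis_apply (hg : IsBasic g) (hs : D.IsLift s) (γ : D.Gam) :
    C.thetaBasis hg hs γ = C.theta s γ := by
  rw [thetaBasis, Module.Basis.mk_apply]

end FamilyChoice

end Datum

end Independence

end FlatFamily

end

/-! ### The theorem -/

theorem mainTheorem4 {g : Type*} [AddCommGroup g] [Module ℂ g] [FlatFamily.LieSuperalgebra g]
    (hg : FlatFamily.IsBasic g) (D : FlatFamily.Datum g)
    (hdom : ∀ k : ℕ, FlatFamily.IsDominantIntegral D.ord (k • D.weight))
    (hfav : D.IsFavourable)
    (C : D.FamilyChoice) (s : D.Gam → D.S) (hs : D.IsLift s) :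
    (∃ b : Module.Basis (D.Gam × ℕ) ℂ C.Fam,
      ∀ (γ : D.Gam) (r : ℕ), b (γ, r) = (Polynomial.X ^ r : Polynomial ℂ) • C.theta s γ) ∧
    (∃ B : Module.Basis D.Gam (Polynomial ℂ) C.Fam, ∀ γ : D.Gam, B γ = C.theta s γ) ∧
    Module.Free (Polynomial ℂ) C.Fam ∧ Module.Flat (Polynomial ℂ) C.Fam := by
  have hfree : Module.Free (Polynomial ℂ) C.Fam := Module.Free.of_basis (C.thetaBasis hg hs)
  -- The ℂ-basis is the product of the basis t^r of ℂ[t] with the ℂ[t]-basis θ, up to the order of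
  -- the index pair.
  refine ⟨⟨((Polynomial.basisMonomials ℂ).smulTower (C.thetaBasis hg hs)).reindex
    (Equiv.prodComm _ _), fun γ r => ?_⟩, ⟨C.thetaBasis hg hs, C.thetaBasis_apply hg hs⟩, hfree,
    inferInstance⟩
  rw [Module.Basis.reindex_apply, Module.Basis.smulTower_apply, Equiv.prodComm_symm,
    Equiv.prodComm_apply, Prod.swap_prod_mk, C.thetaBasis_apply, Polynomial.coe_basisMonomials,
    Polynomial.X_pow_eq_monomial]
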